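/- Let $n\ge 1$, let $\mathbf T^n=\mathbf R^n/\mathbf Z^n$, let $r>2n+2$ be an integer or $\infty$, let $V:\mathbf T^n\to\mathbf R$ be $C^r$, let $|\cdot|^2$ be a flat Riemannian metric on $\mathbf T^n$ (given by a constant inner product on $\mathbf R^n$, the dual norm on covectors being denoted by the same symbol), let $H(q,p)=\frac12|p|^2+V(q)$ on $T^*\mathbf T^n$, and let $k>0$. For each $T>0$ let $\Omega_T\in C^r(\mathbf R^+,\mathbf R^+)$ and consider the Hamiltonian with variable-mass thermostat $$F_T(s,q,p_s,p)=H(q,p/s)+\tfrac12\,\Omega_T(s)\,p_s^2+nkT\ln s\qquad\text{on } T^*(\mathbf R^+\times\mathbf T^n).$$ Assume that $R_T(s)=\Omega_T(s/\sqrt T)$ converges, as $T\to\infty$, to a limit $\Omega\in C^r(\mathbf R^+,\mathbf R^+)$, all derivatives of order at most $r$ converging locally uniformly on $\mathbf R^+$. Then $F_T$ is both Kolmogorov and iso-energetically non-degenerate in the $T=\infty$ limit, in the following sense. The canonical change of variables $s=\sigma/\sqrt T$, $q=w$, $p_s=\sqrt T\,\Sigma$, $p=W$ turns $F_T$ into $T\,\widetilde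 F_T-\frac12 nkT\ln T$, where $$\widetilde F_T=\tfrac12|W/\sigma|^2+\tfrac12R_T(\sigma)\Sigma^2+\tfrac1T V(w)+nk\ln\sigma .$$ 1. As $T\to\infty$, $\widetilde F_T$ converges, with all derivatives of order at most $r$, locally uniformly on $T^*(\mathbf R^+\times\mathbf T^n)$, to $$F_\infty=\tfrac12|W/\sigma|^2+\tfrac12\Omega(\sigma)\Sigma^2+nk\ln\sigma .$$ 2. There is an open set $U\subset T^*(\mathbf R^+\times\mathbf T^n)$ whose closure contains the set of thermostatic equilibria of $F_\infty$ (the points where $\partial F_\infty/\partial\Sigma=0=\partial F_\infty/\partial\sigma$) such that $F_\infty$ is both Kolmogorov and iso-energetically non-degenerate at every point of $U$. Here a Hamiltonian $F$ is *Kolmogorov non-degenerate* (respectively *iso-energetically non-degenerate*) at $P$ if there are an open set $D\subset\mathbf R^{n+1}$ and a $C^r$ symplectic embedding $\Phi:\mathbf T^{n+1}\times D\to T^*(\mathbf R^+\times\mathbf T^n)$ (angle-action coordinates $(\theta,I)$) whose image contains $P$, say $P=\Phi(\theta_0,I_0)$, such that $F\circ\Phi(\theta,I)=h(I)$ depends on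 the actions only and, with $\omega=\left[\partial h/\partial I_i\right]$ and $d\omega=\left[\partial^2h/\partial I_i\partial I_j\right]$, $$\det d\omega\,(I_0)\ne0\qquad\Bigl(\text{respectively }\det\begin{bmatrix}d\omega&\omega\\ \omega'&0\end{bmatrix}(I_0)\ne0\Bigr).$$ -/

import Mathlib

open Filter Topology Set

/-- Position-momentum space `ℝ^(n+1) × ℝ^(n+1)`. It is used with two readings, in both of which
the first factor holds the positions and the second one the conjugate momenta:
* lifted coordinates `((σ, w), (Σ, W))` of `T^*(ℝ⁺ × 𝕋ⁿ)`: the index `0` carries the thermostat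
  variable `σ > 0` and its momentum `Σ`, the indices `i.succ` carry `w ∈ ℝⁿ` (read modulo `ℤⁿ`)
  and `W ∈ ℝⁿ`;
* lifted angle-action coordinates `(θ, I)` of `T^* 𝕋ⁿ⁺¹`, with `θ` read modulo `ℤⁿ⁺¹`. -/
abbrev Phase (n : ℕ) : Type := (Fin (n + 1) → ℝ) × (Fin (n + 1) → ℝ)

/-- The part `σ > 0`, i.e. the (lifted) phase space `T^*(ℝ⁺ × 𝕋ⁿ)`. -/
def thermostatPhaseSpace (n : ℕ) : Set (Phase n) := {x | 0 < x.1 0}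

/-- The canonical symplectic form `∑ i, dx i ∧ dX i`. -/
noncomputable def canonicalForm (n : ℕ) (u v : Phase n) : ℝ :=
  ∑ i, (u.1 i * v.2 i - u.2 i * v.1 i)

/-- Mechanical Hamiltonian `H(q,p) = ½ |p|² + V(q)`; the flat metric has constant matrix `g`, and
`|p|²` is the dual norm of the covector `p`. -/
noncomputable def mechanicalHamiltonian {n : ℕ} (g : Matrix (Fin n) (Fin n) ℝ)
    (V : (Fin n → ℝ) → ℝ) (q p : Fin n → ℝ) : ℝ :=
  1 / 2 * (p ⬝ᵥ (g⁻¹.mulVec p)) + V q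

/-- The thermostated Hamiltonian `F = H(q, p / s) + ½ Ω(s) p_s² + n k T ln s`, at the point with
`s = x.1 0`, `q = Fin.tail x.1`, `p_s = x.2 0` and `p = Fin.tail x.2`. -/
noncomputable def thermostatedHamiltonian {n : ℕ} (k : ℝ) (g : Matrix (Fin n) (Fin n) ℝ)
    (V : (Fin n → ℝ) → ℝ) (Ω : ℝ → ℝ) (T : ℝ) (x : Phase n) : ℝ :=
  mechanicalHamiltonian g V (Fin.tail x.1) ((x.1 0)⁻¹ • Fin.tail x.2)
    + 1 / 2 * Ω (x.1 0) * x.2 0 ^ 2 + n * k * T * Real.log (x.1 0)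

/-- The canonical change of variables `s = σ / √T`, `q = w`, `p_s = √T Σ`, `p = W`. -/
noncomputable def rescaling {n : ℕ} (T : ℝ) (x : Phase n) : Phase n :=
  (Fin.cons (x.1 0 / √T) (Fin.tail x.1), Fin.cons (√T * x.2 0) (Fin.tail x.2))

/-- The rescaled thermostated Hamiltonian `F_β`, determined by
`F ∘ rescaling = T * F_β - ½ n k T ln T`. -/
noncomputable def rescaledHamiltonian {n : ℕ} (k : ℝ) (g : Matrix (Fin n) (Fin n) ℝ)
    (V : (Fin n → ℝ) → ℝ) (Ω : ℝ → ℝ) (T : ℝ) (x : Phase n) : ℝ :=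
  T⁻¹ * (thermostatedHamiltonian k g V Ω T (rescaling T x) + 1 / 2 * (n * k * T * Real.log T))

/-- The `T = ∞` Hamiltonian `½ |W/σ|² + ½ Ω(σ) Σ² + n k ln σ`: the free particle with
variable-mass thermostat `Ω` at unit temperature. -/
noncomputable def limitHamiltonian {n : ℕ} (k : ℝ) (g : Matrix (Fin n) (Fin n) ℝ)
    (Ω : ℝ → ℝ) (x : Phase n) : ℝ :=
  thermostatedHamiltonian k g (fun _ => 0) Ω 1 x

/-- The set of thermostatic equilibria of `F`: the points of the phase space at which
`σ' = ∂F/∂Σ = 0` and `Σ' = -∂F/∂σ = 0`. -/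
def thermostaticEquilibria {n : ℕ} (F : Phase n → ℝ) : Set (Phase n) :=
  {x | x ∈ thermostatPhaseSpace n ∧ fderiv ℝ F x (0, Pi.single 0 1) = 0 ∧
    -fderiv ℝ F x (Pi.single 0 1, 0) = 0}

/-- Convergence `f T → f∞` as `T → ∞` in `C^r` on the open set `S`: locally uniform convergence on
`S` of all derivatives of order at most `r`. -/
def TendstoInCr {E : Type*} [NormedAddCommGroup E] [NormedSpace ℝ E] (r : ℕ∞)
    (f : ℝ → E → ℝ) (fInf : E → ℝ) (S : Set E) : Prop :=
  ∀ j : ℕ, (j : ℕ∞) ≤ r →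
    TendstoLocallyUniformlyOn (fun T x => iteratedFDeriv ℝ j (f T) x)
      (iteratedFDeriv ℝ j fInf) atTop S

/-- `a` and `b` are lifts of the same point of `T^* 𝕋ⁿ⁺¹` (all positions are angles). -/
def SameAngleAction {n : ℕ} (a b : Phase n) : Prop :=
  (∀ i, ∃ m : ℤ, b.1 i = a.1 i + m) ∧ b.2 = a.2

/-- `x` and `y` are lifts of the same point of `T^*(ℝ⁺ × 𝕋ⁿ)`
(all positions but the one with index `0` are angles). -/
def SamePhasePoint {n : ℕ} (x y : Phase n) : Prop :=
  y.1 0 = x.1 0 ∧ (∀ i : Fin n, ∃ m : ℤ, y.1 i.succ = x.1 i.succ + m) ∧ y.2 = x.2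

/-- `Φ` is (the lift of) a `C^r` symplectic embedding of `𝕋ⁿ⁺¹ × D`, `D ⊆ ℝⁿ⁺¹` open, into
`T^*(ℝ⁺ × 𝕋ⁿ)` that turns `F` into the function `h` of the actions alone. By `descends`, `Φ`
induces a well-defined and injective map on the quotients by the lattices. -/
structure IsActionAngleChart {n : ℕ} (r : ℕ∞) (F : Phase n → ℝ) (D : Set (Fin (n + 1) → ℝ))
    (Φ : Phase n → Phase n) (h : (Fin (n + 1) → ℝ) → ℝ) : Prop where
  isOpen : IsOpen D
  contDiffOn : ContDiffOn ℝ r Φ (univ ×ˢ D)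
  mapsTo : MapsTo Φ (univ ×ˢ D) (thermostatPhaseSpace n)
  descends : ∀ a ∈ (univ ×ˢ D : Set (Phase n)), ∀ b ∈ (univ ×ˢ D : Set (Phase n)),
    (SamePhasePoint (Φ a) (Φ b) ↔ SameAngleAction a b)
  symplectic : ∀ a ∈ (univ ×ˢ D : Set (Phase n)), ∀ u v : Phase n,
    canonicalForm n (fderiv ℝ Φ a u) (fderiv ℝ Φ a v) = canonicalForm n u v
  contDiffOn_h : ContDiffOn ℝ r h D
  hamiltonian_eq : ∀ a ∈ (univ ×ˢ D : Set (Phase n)), F (Φ a) = h a.2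

/-- The frequency vector `[∂h/∂I_i]`. -/
noncomputable def frequency {N : ℕ} (h : (Fin N → ℝ) → ℝ) (I : Fin N → ℝ) : Fin N → ℝ :=
  fun i => fderiv ℝ h I (Pi.single i 1)

/-- The Hessian matrix `[∂²h/∂I_i∂I_j]`. -/
noncomputable def hessianMatrix {N : ℕ} (h : (Fin N → ℝ) → ℝ) (I : Fin N → ℝ) :
    Matrix (Fin N) (Fin N) ℝ :=
  Matrix.of fun i j => fderiv ℝ (fun y => frequency h y i) I (Pi.single j 1)

/-- The bordered Hessian `[[∂²h, ∂h], [(∂h)ᵀ, 0]]`. -/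
noncomputable def borderedHessian {N : ℕ} (h : (Fin N → ℝ) → ℝ) (I : Fin N → ℝ) :
    Matrix (Fin N ⊕ Unit) (Fin N ⊕ Unit) ℝ :=
  Matrix.fromBlocks (hessianMatrix h I) (Matrix.replicateCol Unit (frequency h I))
    (Matrix.replicateRow Unit (frequency h I)) 0

/-- `F` is Kolmogorov non-degenerate at the phase point `P`: in some `C^r` angle-action
coordinates around the torus through `P`, the Hessian of the Hamiltonian with respect to the
actions is non-singular at the actions of `P`. -/
def KolmogorovNondegenerateAt {n : ℕ} (r : ℕ∞) (F : Phase n → ℝ) (P : Phase n) : Prop :=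
  ∃ (D : Set (Fin (n + 1) → ℝ)) (Φ : Phase n → Phase n) (h : (Fin (n + 1) → ℝ) → ℝ)
    (θ I : Fin (n + 1) → ℝ), IsActionAngleChart r F D Φ h ∧ I ∈ D ∧ Φ (θ, I) = P ∧
      (hessianMatrix h I).det ≠ 0

/-- `F` is iso-energetically non-degenerate at the phase point `P`: the same with the bordered
Hessian. -/
def IsoenergeticallyNondegenerateAt {n : ℕ} (r : ℕ∞) (F : Phase n → ℝ) (P : Phase n) : Prop :=
  ∃ (D : Set (Fin (n + 1) → ℝ)) (Φ : Phase n → Phase n) (h : (Fin (n + 1) → ℝ) → ℝ)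
    (θ I : Fin (n + 1) → ℝ), IsActionAngleChart r F D Φ h ∧ I ∈ D ∧ Φ (θ, I) = P ∧
      (borderedHessian h I).det ≠ 0

/-! The limit Hamiltonian separates in explicit coordinates. Put `N = n k`, `ℓ = (log N) / 2`, `j =
log |W|`, and write `log σ = j - x / 2 - ℓ`. Kinetic energy of the particle plus logarithmic
potential then become `N (e^x - x) / 2 + N (j - ℓ)`. Since `e^x - 1 - x = S ^ 2 / 2` defines a
global smooth coordinate `S` on the line (`excessRoot`, inverse `rootExcess`), and the kinetic term
of the thermostat is `N Y ^ 2 / 4` for a suitable multiple `Y` of `√Ω Σ`, polar coordinates `S = s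
cos φ`, `Y = s sin φ` give the energy `N (j + s ^ 2 / 4) + const`. The equilibria are exactly the
points `s = 0`.

With `G = σ / √Ω(σ)` as a function of `τ = log σ + ℓ`, the form `dσ ∧ dΣ` at fixed `W` is `(c / 2)
G(τ) x'(S) s dφ ∧ ds`, where `c ^ 2 = N / 2`. Let `M` and `E` be the integrals over the circle of
radius `s` of `G(τ) x'(S)` and `G(τ) x'(S) e^x`. The thermostat action is `c A` with `dA = (s M / 2)
ds + (M - E) dj`; the second coefficient comes from `(e^x - 1) x' = S` and an integration by parts.
The angle is a normalized arc integral, and the angles `w` need a periodic shift along the gradient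
of `j` (`thermostat_areaForm`, `canonicalForm_angleActionMap`). The frequencies are `N / (c M)` and
`(N E / M) ∇j`. Kernels of the Hessian and of the bordered Hessian reduce to small linear systems,
governed by `kolmogorovDet` and `isoenergeticDet`, functions of `(s, j)` alone.

It remains to find zeros of neither function arbitrarily close to `s = 0`. Both are expanded to
first order in `s ^ 2` (`hasDerivWithinAt_dets`), with coefficients polynomial in the 4-jet of `G`.
If the two coefficients of one function vanished for all `j` in an interval, `G` would satisfy two
ordinary differential equations. These are incompatible with `G > 0`: in the iso-energetic case by
linear elimination, in the Kolmogorov case because the logarithmic derivative of `G` solves a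
Riccati equation and would also have to be a root of a quartic that the Riccati flow does not
preserve.

The `C^r` convergence is separate: the rescaled and limit Hamiltonians differ by `Σ ^ 2 (R_T - Ω) /
2 + V / T`. -/

section ParametricIntegrals

/-! ### Smoothness of integrals depending on parameters. -/

variable {H F : Type} [NormedAddCommGroup H] [NormedSpace ℝ H]
  [NormedAddCommGroup F] [NormedSpace ℝ F]

theorem hasFDerivAt_intervalIntegral_of_contDiff [ProperSpace H] {f : H × ℝ → F}
    (hf : ContDiff ℝ 1 f) (a b : ℝ) (p : H) :
    HasFDerivAt (fun p => ∫ t in a..b, f (p, t))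
      (∫ t in a..b, (fderiv ℝ f (p, t)).comp (ContinuousLinearMap.inl ℝ H ℝ)) p := by
  have hf' : Continuous fun q : H × ℝ =>
      (fderiv ℝ f q).comp (ContinuousLinearMap.inl ℝ H ℝ) :=
    (hf.continuous_fderiv one_ne_zero).clm_comp continuous_const
  obtain ⟨C, hC⟩ := ((isCompact_closedBall p 1).prod (isCompact_uIcc (a := a) (b := b))).exists_bound_of_continuousOn
    hf'.continuousOn
  refine intervalIntegral.hasFDerivAt_integral_of_dominated_of_fderiv_le
    (F' := fun p t => (fderiv ℝ f (p, t)).comp (ContinuousLinearMap.inl ℝ H ℝ))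
    (bound := fun _ => C) (Metric.closedBall_mem_nhds p one_pos) ?_ ?_ ?_ ?_ ?_ ?_
  · exact Eventually.of_forall fun x =>
      (hf.continuous.comp (by fun_prop : Continuous fun t : ℝ => (x, t))).aestronglyMeasurable
  · exact (hf.continuous.comp (by fun_prop : Continuous fun t : ℝ => (p, t))).intervalIntegrable _ _
  · exact (hf'.comp (by fun_prop : Continuous fun t : ℝ => (p, t))).aestronglyMeasurable
  · exact Eventually.of_forall fun t ht x hx => hC (x, t) ⟨hx, uIoc_subset_uIcc ht⟩
  · exact intervalIntegrable_const
  · refine Eventually.of_forall fun t _ x _ => ?_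
    have h1 : HasFDerivAt (fun x : H => (x, t)) (ContinuousLinearMap.inl ℝ H ℝ) x :=
      hasFDerivAt_prodMk_left x t
    exact ((hf.differentiable one_ne_zero (x, t)).hasFDerivAt).comp x h1

/-- The induction replaces the integrand by its partial differential, whose values lie in a space of
continuous linear maps. The spaces are therefore quantified inside the induction, and they are kept
in `Type` so that this replacement stays in the same universe. -/
theorem contDiff_intervalIntegral_nat (k : ℕ) : ∀ {H F : Type} [NormedAddCommGroup H]
    [NormedSpace ℝ H] [NormedAddCommGroup F] [NormedSpace ℝ F] [ProperSpace H] {f : H × ℝ → F}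
    (_ : ContDiff ℝ k f) (a b : ℝ), ContDiff ℝ k (fun p => ∫ t in a..b, f (p, t)) := by
  induction k with
  | zero =>
    intro H F _ _ _ _ _ f hf a b
    rw [Nat.cast_zero, contDiff_zero] at hf ⊢
    exact intervalIntegral.continuous_parametric_intervalIntegral_of_continuous'
      (f := fun p t => f (p, t)) hf a b
  | succ k ih =>
    intro H F _ _ _ _ _ f hf a b
    have h1 : ContDiff ℝ 1 f := hf.of_le (by exact_mod_cast Nat.le_add_left 1 k)
    rw [Nat.cast_succ, contDiff_succ_iff_fderiv]
    refine ⟨fun p => (hasFDerivAt_intervalIntegral_of_contDiff h1 a b p).differentiableAt,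
      by simp, ?_⟩
    have : fderiv ℝ (fun p => ∫ t in a..b, f (p, t)) = fun p =>
        ∫ t in a..b, (fderiv ℝ f (p, t)).comp (ContinuousLinearMap.inl ℝ H ℝ) :=
      funext fun p => (hasFDerivAt_intervalIntegral_of_contDiff h1 a b p).fderiv
    rw [this]
    refine ih (f := fun q => (fderiv ℝ f q).comp (ContinuousLinearMap.inl ℝ H ℝ)) ?_ a b
    exact (hf.fderiv_right (by norm_cast)).clm_comp contDiff_const

theorem contDiff_intervalIntegral [ProperSpace H] {r : ℕ∞} {f : H × ℝ → F}
    (hf : ContDiff ℝ r f) (a b : ℝ) : ContDiff ℝ r (fun p => ∫ t in a..b, f (p, t)) := by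
  rw [contDiff_iff_forall_nat_le]
  exact fun m hm => contDiff_intervalIntegral_nat m (hf.of_le (by exact_mod_cast hm)) a b

/-- The primitive in an upper limit, jointly with the parameters. -/
theorem contDiff_primitive [ProperSpace H] {r : ℕ∞} {f : H × ℝ → ℝ} (hf : ContDiff ℝ r f) :
    ContDiff ℝ r (fun q : ℝ × H => ∫ t in (0 : ℝ)..q.1, f (q.2, t)) := by
  -- The substitution `t ↦ q.1 * t` moves the variable upper limit into the integrand.
  have : (fun q : ℝ × H => ∫ t in (0 : ℝ)..q.1, f (q.2, t)) =
      fun q => q.1 * ∫ t in (0 : ℝ)..1, f (q.2, q.1 * t) := by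
    funext q
    have := intervalIntegral.mul_integral_comp_mul_left (a := 0) (b := 1)
      (f := fun t => f (q.2, t)) q.1
    simpa using this.symm
  rw [this]
  refine contDiff_fst.mul (contDiff_intervalIntegral
    (f := fun z : (ℝ × H) × ℝ => f (z.1.2, z.1.1 * z.2)) (hf.comp ?_) 0 1)
  fun_prop

theorem hasDerivAt_intervalIntegral_of_contDiff {f : ℝ → ℝ → ℝ}
    (hf : ContDiff ℝ 1 (fun q : ℝ × ℝ => f q.1 q.2)) {f' : ℝ → ℝ} (a b s : ℝ)
    (hf' : ∀ t, HasDerivAt (fun s => f s t) (f' t) s) :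
    HasDerivAt (fun s => ∫ t in a..b, f s t) (∫ t in a..b, f' t) s := by
  refine (hasFDerivAt_intervalIntegral_of_contDiff hf a b s).hasDerivAt.congr_deriv ?_
  have hc : Continuous fun t : ℝ => (fderiv ℝ (fun q : ℝ × ℝ => f q.1 q.2) (s, t)).comp
      (ContinuousLinearMap.inl ℝ ℝ ℝ) :=
    ((hf.continuous_fderiv one_ne_zero).comp (by fun_prop : Continuous fun t : ℝ => (s, t))).clm_comp
      continuous_const
  rw [ContinuousLinearMap.intervalIntegral_apply (hc.intervalIntegrable _ _)]
  refine intervalIntegral.integral_congr fun t _ => ?_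
  have h1 : HasFDerivAt (fun x : ℝ => (x, t)) (ContinuousLinearMap.inl ℝ ℝ ℝ) s :=
    hasFDerivAt_prodMk_left s t
  have h2 := (((hf.differentiable one_ne_zero (s, t)).hasFDerivAt).comp s h1).hasDerivAt
  exact HasDerivAt.unique (f := fun x => f x t) h2 (hf' t)

end ParametricIntegrals

/-! ### The coordinate that turns `e^x - 1 - x` into a square. -/

section ExponentialExcess

/-- The smooth factor of `e^x - 1 - x = (x^2 / 2) q(x)`. -/
noncomputable def excessFactor (x : ℝ) : ℝ := 2 * ∫ t in (0 : ℝ)..1, (1 - t) * Real.exp (x * t)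

theorem contDiff_excessFactor {r : ℕ∞} : ContDiff ℝ r excessFactor := by
  refine contDiff_const.mul (contDiff_intervalIntegral
    (f := fun q : ℝ × ℝ => (1 - q.2) * Real.exp (q.1 * q.2)) ?_ 0 1)
  fun_prop

theorem sq_mul_excessFactor (x : ℝ) : x ^ 2 * excessFactor x = 2 * (Real.exp x - 1 - x) := by
  -- Taylor's formula with integral remainder; the primitive is the one given by integration by
  -- parts.
  have h : ∀ t ∈ uIcc (0 : ℝ) 1, HasDerivAt (fun t => ((1 - t) * x + 1) * Real.exp (x * t))
      (x ^ 2 * ((1 - t) * Real.exp (x * t))) t := by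
    intro t _
    have h1 : HasDerivAt (fun t : ℝ => (1 - t) * x + 1) (-1 * x) t :=
      (((hasDerivAt_id t).const_sub 1).mul_const x).add_const 1
    have h2 : HasDerivAt (fun t : ℝ => Real.exp (x * t)) (Real.exp (x * t) * (x * 1)) t :=
      ((hasDerivAt_id t).const_mul x).exp
    exact (h1.mul h2).congr_deriv (by ring)
  have := intervalIntegral.integral_eq_sub_of_hasDerivAt h
    (Continuous.intervalIntegrable (by fun_prop) _ _)
  rw [intervalIntegral.integral_const_mul] at this
  rw [excessFactor, mul_left_comm, this]
  simp
  ring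

theorem excessFactor_pos (x : ℝ) : 0 < excessFactor x := by
  refine mul_pos two_pos (intervalIntegral.intervalIntegral_pos_of_pos_on
    (Continuous.intervalIntegrable (by fun_prop) _ _) (fun t ht => ?_) one_pos)
  exact mul_pos (by linarith [ht.2]) (Real.exp_pos _)

/-- The signed root `±√(2 (e^x - 1 - x))`, a smooth coordinate on the line. -/
noncomputable def excessRoot (x : ℝ) : ℝ := x * √(excessFactor x)

theorem contDiff_excessRoot {r : ℕ∞} : ContDiff ℝ r excessRoot :=
  contDiff_id.mul (contDiff_excessFactor.sqrt fun x => (excessFactor_pos x).ne')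

theorem excessRoot_sq (x : ℝ) : excessRoot x ^ 2 = 2 * (Real.exp x - 1 - x) := by
  rw [excessRoot, mul_pow, Real.sq_sqrt (excessFactor_pos x).le, sq_mul_excessFactor]

theorem differentiable_excessRoot : Differentiable ℝ excessRoot :=
  (contDiff_excessRoot (r := 1)).differentiable (by simp)

theorem excessRoot_mul_deriv (x : ℝ) : excessRoot x * deriv excessRoot x = Real.exp x - 1 := by
  have h1 := ((differentiable_excessRoot x).hasDerivAt.pow 2)
  have h2 : HasDerivAt (fun x => excessRoot x ^ 2) (2 * (Real.exp x - 1)) x := by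
    simp_rw [excessRoot_sq]
    exact (((Real.hasDerivAt_exp x).sub_const 1).sub (hasDerivAt_id x)).const_mul 2
  have := h1.unique h2
  norm_num at this
  linarith

theorem excessFactor_zero : excessFactor 0 = 1 := by
  have h : ∫ t in (0 : ℝ)..1, (1 - t) = 1 / 2 := by
    rw [intervalIntegral.integral_sub (by simp) (by simp)]
    simp; norm_num
  simp [excessFactor, h]

theorem deriv_excessRoot_zero : deriv excessRoot 0 = 1 := by
  have hd : DifferentiableAt ℝ (fun x => √(excessFactor x)) 0 :=
    ((contDiff_excessFactor (r := 1)).sqrt fun x =>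
      (excessFactor_pos x).ne').differentiable (by simp) 0
  have := (hasDerivAt_id (0 : ℝ)).mul hd.hasDerivAt
  have h2 : HasDerivAt excessRoot 1 0 := this.congr_deriv (by simp [excessFactor_zero])
  exact h2.deriv

/-- Away from the origin `excessRoot x` and `e^x - 1` both have the sign of `x`, so
`excessRoot_mul_deriv` decides the sign of the derivative. At the origin that identity reads `0 =
0`, and the explicit value is needed. -/
theorem deriv_excessRoot_pos (x : ℝ) : 0 < deriv excessRoot x := by
  have h := excessRoot_mul_deriv x
  have hq := Real.sqrt_pos.2 (excessFactor_pos x)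
  rcases lt_trichotomy x 0 with hx | rfl | hx
  · have h1 : excessRoot x < 0 := mul_neg_of_neg_of_pos hx hq
    have h2 : Real.exp x - 1 < 0 := by linarith [Real.exp_lt_one_iff.2 hx]
    by_contra! h3
    nlinarith [mul_nonneg_of_nonpos_of_nonpos h1.le h3]
  · rw [deriv_excessRoot_zero]; exact one_pos
  · have h1 : 0 < excessRoot x := mul_pos hx hq
    have h2 : 0 < Real.exp x - 1 := by linarith [Real.one_lt_exp_iff.2 hx]
    by_contra! h3
    nlinarith [mul_nonpos_of_nonneg_of_nonpos h1.le h3]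

theorem strictMono_excessRoot : StrictMono excessRoot :=
  strictMono_of_deriv_pos deriv_excessRoot_pos

theorem surjective_excessRoot : Function.Surjective excessRoot := by
  refine (contDiff_excessRoot (r := 0)).continuous.surjective ?_ ?_
  · refine tendsto_atTop_mono' _ ?_ tendsto_id
    -- For `x ≥ 0`, the bound `e^x ≥ 1 + x + x ^ 2 / 2` makes the root at least `x`.
    filter_upwards [eventually_ge_atTop 0] with x hx
    have h1 : 0 ≤ excessRoot x := mul_nonneg hx (Real.sqrt_nonneg _)
    have h2 := Real.quadratic_le_exp_of_nonneg hx
    refine le_of_sq_le_sq ?_ h1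
    rw [excessRoot_sq]; simp only [id]; linarith
  -- On the negative side, dropping `e^x > 0` bounds the square of the root below by `-2 - 2 x`.
  · have ht : Tendsto (fun x : ℝ => -√(-2 - 2 * x)) atBot atBot := by
      refine tendsto_neg_atTop_atBot.comp (Real.tendsto_sqrt_atTop.comp ?_)
      refine tendsto_atTop_add_const_left _ (-2 : ℝ) ?_ |>.congr (fun x => (sub_eq_add_neg _ _).symm)
      exact tendsto_neg_atBot_atTop.comp (tendsto_id.const_mul_atBot two_pos)
    refine tendsto_atBot_mono' _ ?_ ht
    filter_upwards [eventually_le_atBot (-1)] with x hx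
    have h1 : excessRoot x ≤ 0 :=
      mul_nonpos_of_nonpos_of_nonneg (by linarith) (Real.sqrt_nonneg _)
    rw [le_neg]
    refine Real.sqrt_le_iff.2 ⟨by linarith, ?_⟩
    rw [neg_sq, excessRoot_sq]
    linarith [Real.exp_pos x]

/-- The inverse of `excessRoot`. -/
noncomputable def excessRootHomeomorph : ℝ ≃ₜ ℝ :=
  (strictMono_excessRoot.orderIsoOfSurjective _ surjective_excessRoot).toHomeomorph

/-- The inverse of `excessRoot`. -/
noncomputable def rootExcess (S : ℝ) : ℝ := excessRootHomeomorph.symm S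

theorem excessRoot_rootExcess (S : ℝ) : excessRoot (rootExcess S) = S :=
  excessRootHomeomorph.apply_symm_apply S

theorem rootExcess_excessRoot (x : ℝ) : rootExcess (excessRoot x) = x :=
  excessRootHomeomorph.symm_apply_apply x

theorem contDiff_rootExcess {r : ℕ∞} : ContDiff ℝ r rootExcess :=
  excessRootHomeomorph.contDiff_symm_deriv (f' := deriv excessRoot)
    (fun x => (deriv_excessRoot_pos x).ne')
    (fun x => (differentiable_excessRoot x).hasDerivAt) contDiff_excessRoot

theorem rootExcess_zero : rootExcess 0 = 0 := by
  simpa [excessRoot] using rootExcess_excessRoot 0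

theorem exp_rootExcess (S : ℝ) : Real.exp (rootExcess S) - 1 - rootExcess S = S ^ 2 / 2 := by
  have := excessRoot_sq (rootExcess S)
  rw [excessRoot_rootExcess] at this
  linarith

/-- The derivative of `rootExcess`. -/
noncomputable def rootSlope (S : ℝ) : ℝ := deriv rootExcess S

theorem hasDerivAt_rootExcess (S : ℝ) : HasDerivAt rootExcess (rootSlope S) S :=
  ((contDiff_rootExcess (r := 1)).differentiable (by simp) S).hasDerivAt

theorem contDiff_rootSlope {r : ℕ∞} : ContDiff ℝ r rootSlope :=
  ((contDiff_infty_iff_deriv.1 (contDiff_rootExcess (r := ⊤))).2).of_le (by exact_mod_cast le_top)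

/-- Derivative of `exp_rootExcess`. This identity yields both the Taylor coefficients of
`rootExcess` and the cancellation of the slope in the difference of the two weights. -/
theorem rootSlope_mul_exp (S : ℝ) : (Real.exp (rootExcess S) - 1) * rootSlope S = S := by
  have h1 := (((hasDerivAt_rootExcess S).exp.sub_const 1).sub (hasDerivAt_rootExcess S))
  have h2 : HasDerivAt (fun S : ℝ => S ^ 2 / 2) S S :=
    ((hasDerivAt_pow 2 S).div_const 2).congr_deriv (by norm_num)
  have := h1.unique (h2.congr_of_eventuallyEq (Eventually.of_forall exp_rootExcess))
  linarith

theorem rootSlope_eq_inv (S : ℝ) : deriv excessRoot (rootExcess S) * rootSlope S = 1 := by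
  have h1 := (differentiable_excessRoot (rootExcess S)).hasDerivAt.comp S (hasDerivAt_rootExcess S)
  exact h1.unique ((hasDerivAt_id S).congr_of_eventuallyEq
    (Eventually.of_forall excessRoot_rootExcess))

theorem rootSlope_pos (S : ℝ) : 0 < rootSlope S := by
  have h := rootSlope_eq_inv S
  have h1 := deriv_excessRoot_pos (rootExcess S)
  exact pos_of_mul_pos_right (h ▸ one_pos) h1.le

theorem rootSlope_zero : rootSlope 0 = 1 := by
  simpa [rootExcess_zero, deriv_excessRoot_zero] using rootSlope_eq_inv 0

end ExponentialExcess

/-! ### Derivatives of the weights in `S`, and their values at the origin. -/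

section Weights

theorem contDiff_rootExcess_top : ContDiff ℝ ((⊤ : ℕ∞) : WithTop ℕ∞) rootExcess :=
  contDiff_rootExcess

theorem hasDerivAt_iteratedDeriv_rootExcess (i : ℕ) (S : ℝ) :
    HasDerivAt (iteratedDeriv i rootExcess) (iteratedDeriv (i + 1) rootExcess S) S := by
  rw [iteratedDeriv_succ]
  exact (contDiff_rootExcess_top.differentiable_iteratedDeriv i
    (by exact_mod_cast ENat.natCast_lt_top i) S).hasDerivAt

theorem iteratedDeriv_one_rootExcess : iteratedDeriv 1 rootExcess = rootSlope := by
  rw [iteratedDeriv_one]; rfl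

/-- The Taylor coefficients of `rootExcess` at the origin. -/
theorem iteratedDeriv_rootExcess_zero :
    iteratedDeriv 1 rootExcess 0 = 1 ∧ iteratedDeriv 2 rootExcess 0 = -1 / 3 ∧
    iteratedDeriv 3 rootExcess 0 = 1 / 6 ∧ iteratedDeriv 4 rootExcess 0 = -4 / 45 ∧
    iteratedDeriv 5 rootExcess 0 = 1 / 36 := by
  set x := fun i => iteratedDeriv i rootExcess with hxdef
  have hx (i : ℕ) (S : ℝ) : HasDerivAt (x i) (x (i + 1) S) S :=
    hasDerivAt_iteratedDeriv_rootExcess i S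
  have h1 : x 1 0 = 1 := by
    simp only [x, iteratedDeriv_one_rootExcess, rootSlope_zero]
  have he (S : ℝ) : HasDerivAt (fun S => Real.exp (rootExcess S))
      (Real.exp (rootExcess S) * x 1 S) S := by
    simpa only [x, iteratedDeriv_one_rootExcess] using (hasDerivAt_rootExcess S).exp
  have hp (S : ℝ) := (he S).sub_const 1
  have key {f f' : ℝ → ℝ} {c c' : ℝ → ℝ} (hf : ∀ S, HasDerivAt f (f' S) S)
      (hc : ∀ S, HasDerivAt c (c' S) S) (h : ∀ S, f S = c S) : ∀ S, f' S = c' S := fun S =>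
    (hf S).unique ((hc S).congr_of_eventuallyEq (Eventually.of_forall h))
  -- Implicit differentiation of this identity. At `S = 0` the factor `e^x - 1` kills the highest
  -- derivative, so each differentiated identity determines the derivative one order below. The
  -- first one gives only `x' ^ 2 = 1`, which is why `x' = 1` is taken from `rootSlope_zero`.
  have i0 (S : ℝ) : (Real.exp (rootExcess S) - 1) * x 1 S = S := by
    simp only [x, iteratedDeriv_one_rootExcess, rootSlope_mul_exp]
  have i1 := key (fun S => (hp S).mul (hx 1 S)) hasDerivAt_id i0
  have i1' (S : ℝ) : Real.exp (rootExcess S) * (x 1 S) ^ 2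
      + (Real.exp (rootExcess S) - 1) * x 2 S = 1 := by linear_combination i1 S
  have i2 := key (fun S => ((he S).mul ((hx 1 S).pow 2)).add ((hp S).mul (hx 2 S)))
    (fun S => hasDerivAt_const S (1 : ℝ)) i1'
  have i2' (S : ℝ) : Real.exp (rootExcess S) * (x 1 S ^ 3 + 3 * (x 1 S * x 2 S))
      + (Real.exp (rootExcess S) - 1) * x 3 S = 0 := by
    have := i2 S
    simp only [Nat.cast_ofNat, Pi.pow_apply] at this
    linear_combination this
  have i3 := key (fun S => ((he S).mul (((hx 1 S).pow 3).add
      (((hx 1 S).mul (hx 2 S)).const_mul 3))).add ((hp S).mul (hx 3 S)))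
    (fun S => hasDerivAt_const S (0 : ℝ)) i2'
  have i3' (S : ℝ) : Real.exp (rootExcess S) * (x 1 S ^ 4 + 6 * (x 1 S ^ 2 * x 2 S)
      + 3 * x 2 S ^ 2 + 4 * (x 1 S * x 3 S)) + (Real.exp (rootExcess S) - 1) * x 4 S = 0 := by
    have := i3 S
    simp only [Nat.cast_ofNat, Pi.pow_apply, Pi.add_apply, Pi.mul_apply] at this
    linear_combination this
  have i4 := key (fun S => ((he S).mul (((((hx 1 S).pow 4).add
      ((((hx 1 S).pow 2).mul (hx 2 S)).const_mul 6)).add (((hx 2 S).pow 2).const_mul 3)).add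
      (((hx 1 S).mul (hx 3 S)).const_mul 4))).add ((hp S).mul (hx 4 S)))
    (fun S => hasDerivAt_const S (0 : ℝ)) i3'
  have i4' (S : ℝ) : Real.exp (rootExcess S) * (x 1 S ^ 5 + 10 * (x 1 S ^ 3 * x 2 S)
      + 15 * (x 1 S * x 2 S ^ 2) + 10 * (x 1 S ^ 2 * x 3 S) + 10 * (x 2 S * x 3 S)
      + 5 * (x 1 S * x 4 S)) + (Real.exp (rootExcess S) - 1) * x 5 S = 0 := by
    have := i4 S
    simp only [Nat.cast_ofNat, Pi.pow_apply, Pi.add_apply, Pi.mul_apply] at this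
    linear_combination this
  have i5 := key (fun S => ((he S).mul (((((((hx 1 S).pow 5).add
      ((((hx 1 S).pow 3).mul (hx 2 S)).const_mul 10)).add
      (((hx 1 S).mul ((hx 2 S).pow 2)).const_mul 15)).add
      ((((hx 1 S).pow 2).mul (hx 3 S)).const_mul 10)).add
      (((hx 2 S).mul (hx 3 S)).const_mul 10)).add
      (((hx 1 S).mul (hx 4 S)).const_mul 5))).add ((hp S).mul (hx 5 S)))
    (fun S => hasDerivAt_const S (0 : ℝ)) i4'
  have e2 := i2' 0
  have e3 := i3' 0
  have e4 := i4' 0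
  have e5 := i5 0
  simp only [rootExcess_zero, Real.exp_zero, h1, Pi.pow_apply, Nat.cast_ofNat, Pi.add_apply,
    Pi.mul_apply] at e2 e3 e4 e5
  have h2 : x 2 0 = -1 / 3 := by linarith
  rw [h2] at e3 e4 e5
  have h3 : x 3 0 = 1 / 6 := by linarith
  rw [h3] at e4 e5
  have h4 : x 4 0 = -4 / 45 := by linarith
  rw [h4] at e5
  norm_num at e5
  exact ⟨h1, h2, h3, h4, by show x 5 0 = _; linarith⟩

/-- Iterates of `g ↦ m g - g' / 2`. -/
noncomputable def twist (m : ℝ) (G : ℝ → ℝ) : ℕ → ℝ → ℝ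
  | 0 => G
  | k + 1 => fun t => m * twist m G k t - deriv (twist m G k) t / 2

theorem contDiff_twist (m : ℝ) {G : ℝ → ℝ} (k : ℕ) : ∀ {a : ℕ}, ContDiff ℝ (a + k : ℕ) G →
    ContDiff ℝ a (twist m G k) := by
  induction k with
  | zero => intro a h; exact h
  | succ k ih =>
    intro a h
    have h1 : ContDiff ℝ (a + 1 : ℕ) (twist m G k) := ih (by convert h using 2; ring)
    refine (contDiff_const.mul (h1.of_le (by exact_mod_cast Nat.le_succ a))).sub
      (ContDiff.div_const ?_ 2)
    exact ContDiff.deriv' (by exact_mod_cast h1)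

/-- `twist m G k (j - x(S)/2) * exp (m x(S))`. -/
noncomputable def twisted (m : ℝ) (G : ℝ → ℝ) (k : ℕ) (j S : ℝ) : ℝ :=
  twist m G k (j - rootExcess S / 2) * Real.exp (m * rootExcess S)

/-- Since `τ = j - x(S) / 2` has derivative `-x' / 2`, differentiating `g(τ) e^(m x)` replaces `g`
by `m g - g' / 2` and multiplies by `x'`. The successive derivatives of the weight thus follow the
pattern of Faà di Bruno's formula, with `twist` in place of the outer derivatives. -/
theorem hasDerivAt_twisted (m : ℝ) {G : ℝ → ℝ} {k : ℕ} (hG : ContDiff ℝ (k + 1 : ℕ) G)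
    (j S : ℝ) : HasDerivAt (twisted m G k j)
      (twisted m G (k + 1) j S * iteratedDeriv 1 rootExcess S) S := by
  rw [iteratedDeriv_one_rootExcess]
  have h1 : ContDiff ℝ (1 : ℕ) (twist m G k) := contDiff_twist m k (by rwa [add_comm])
  have hx := hasDerivAt_rootExcess S
  have h2 := (h1.differentiable (by simp) (j - rootExcess S / 2)).hasDerivAt.comp S
    ((hx.div_const 2).const_sub j)
  have h3 := (hx.const_mul m).exp
  refine (h2.mul h3).congr_deriv ?_
  simp only [twisted, twist, Function.comp]
  ring

theorem continuous_twisted (m : ℝ) {G : ℝ → ℝ} {k : ℕ} (hG : ContDiff ℝ k G) :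
    Continuous fun q : ℝ × ℝ => twisted m G k q.1 q.2 := by
  have h1 : ContDiff ℝ (0 : ℕ) (twist m G k) := contDiff_twist m k (by simpa using hG)
  have hc := h1.continuous
  have hx := contDiff_rootExcess_top.continuous
  unfold twisted
  fun_prop

/-- The weight `G(τ) x'(S) exp (m x(S))` at `τ = j - x(S)/2`. -/
noncomputable def weight (m : ℝ) (G : ℝ → ℝ) (j S : ℝ) : ℝ :=
  G (j - rootExcess S / 2) * rootSlope S * Real.exp (m * rootExcess S)

theorem weight_eq (m : ℝ) (G : ℝ → ℝ) (j : ℝ) :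
    weight m G j = fun S => twisted m G 0 j S * iteratedDeriv 1 rootExcess S := by
  funext S
  rw [iteratedDeriv_one_rootExcess, weight, twisted, twist]
  ring

/-- The first derivative of `weight m G j`. -/
noncomputable def weightOne (m : ℝ) (G : ℝ → ℝ) (j S : ℝ) : ℝ :=
  twisted m G 1 j S * iteratedDeriv 1 rootExcess S ^ 2
    + twisted m G 0 j S * iteratedDeriv 2 rootExcess S

/-- The second derivative of `weight m G j`. -/
noncomputable def weightTwo (m : ℝ) (G : ℝ → ℝ) (j S : ℝ) : ℝ :=
  twisted m G 2 j S * iteratedDeriv 1 rootExcess S ^ 3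
    + 3 * (twisted m G 1 j S * (iteratedDeriv 1 rootExcess S * iteratedDeriv 2 rootExcess S))
    + twisted m G 0 j S * iteratedDeriv 3 rootExcess S

/-- The third derivative of `weight m G j`. -/
noncomputable def weightThree (m : ℝ) (G : ℝ → ℝ) (j S : ℝ) : ℝ :=
  twisted m G 3 j S * iteratedDeriv 1 rootExcess S ^ 4
    + 6 * (twisted m G 2 j S * (iteratedDeriv 1 rootExcess S ^ 2 * iteratedDeriv 2 rootExcess S))
    + twisted m G 1 j S * (3 * iteratedDeriv 2 rootExcess S ^ 2
      + 4 * (iteratedDeriv 1 rootExcess S * iteratedDeriv 3 rootExcess S))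
    + twisted m G 0 j S * iteratedDeriv 4 rootExcess S

/-- The fourth derivative of `weight m G j`. -/
noncomputable def weightFour (m : ℝ) (G : ℝ → ℝ) (j S : ℝ) : ℝ :=
  twisted m G 4 j S * iteratedDeriv 1 rootExcess S ^ 5
    + 10 * (twisted m G 3 j S * (iteratedDeriv 1 rootExcess S ^ 3 * iteratedDeriv 2 rootExcess S))
    + twisted m G 2 j S * (15 * (iteratedDeriv 1 rootExcess S * iteratedDeriv 2 rootExcess S ^ 2)
      + 10 * (iteratedDeriv 1 rootExcess S ^ 2 * iteratedDeriv 3 rootExcess S))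
    + twisted m G 1 j S * (10 * (iteratedDeriv 2 rootExcess S * iteratedDeriv 3 rootExcess S)
      + 5 * (iteratedDeriv 1 rootExcess S * iteratedDeriv 4 rootExcess S))
    + twisted m G 0 j S * iteratedDeriv 5 rootExcess S

theorem hasDerivAt_weight (m : ℝ) {G : ℝ → ℝ} (hG : ContDiff ℝ (1 : ℕ) G) (j S : ℝ) :
    HasDerivAt (weight m G j) (weightOne m G j S) S := by
  rw [weight_eq]
  refine ((hasDerivAt_twisted m hG j S).mul
    (hasDerivAt_iteratedDeriv_rootExcess 1 S)).congr_deriv ?_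
  simp only [weightOne]
  ring

theorem hasDerivAt_weightOne (m : ℝ) {G : ℝ → ℝ} (hG : ContDiff ℝ (2 : ℕ) G) (j S : ℝ) :
    HasDerivAt (weightOne m G j) (weightTwo m G j S) S := by
  have x := fun i => hasDerivAt_iteratedDeriv_rootExcess i S
  have y0 := hasDerivAt_twisted m (k := 0) (hG.of_le (by norm_cast)) j S
  have y1 := hasDerivAt_twisted m (k := 1) hG j S
  refine ((y1.mul ((x 1).pow 2)).add (y0.mul (x 2))).congr_deriv ?_
  simp only [weightTwo, Nat.cast_ofNat, Pi.pow_apply, Nat.reduceAdd]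
  ring

theorem hasDerivAt_weightTwo (m : ℝ) {G : ℝ → ℝ} (hG : ContDiff ℝ (3 : ℕ) G) (j S : ℝ) :
    HasDerivAt (weightTwo m G j) (weightThree m G j S) S := by
  have x := fun i => hasDerivAt_iteratedDeriv_rootExcess i S
  have y0 := hasDerivAt_twisted m (k := 0) (hG.of_le (by norm_cast)) j S
  have y1 := hasDerivAt_twisted m (k := 1) (hG.of_le (by norm_cast)) j S
  have y2 := hasDerivAt_twisted m (k := 2) hG j S
  refine (((y2.mul ((x 1).pow 3)).add ((y1.mul ((x 1).mul (x 2))).const_mul 3)).add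
    (y0.mul (x 3))).congr_deriv ?_
  simp only [weightThree, Nat.cast_ofNat, Pi.pow_apply, Pi.mul_apply, Nat.reduceAdd]
  ring

theorem hasDerivAt_weightThree (m : ℝ) {G : ℝ → ℝ} (hG : ContDiff ℝ (4 : ℕ) G) (j S : ℝ) :
    HasDerivAt (weightThree m G j) (weightFour m G j S) S := by
  have x := fun i => hasDerivAt_iteratedDeriv_rootExcess i S
  have y0 := hasDerivAt_twisted m (k := 0) (hG.of_le (by norm_cast)) j S
  have y1 := hasDerivAt_twisted m (k := 1) (hG.of_le (by norm_cast)) j S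
  have y2 := hasDerivAt_twisted m (k := 2) (hG.of_le (by norm_cast)) j S
  have y3 := hasDerivAt_twisted m (k := 3) hG j S
  refine ((((y3.mul ((x 1).pow 4)).add
    ((y2.mul (((x 1).pow 2).mul (x 2))).const_mul 6)).add
    (y1.mul ((((x 2).pow 2).const_mul 3).add (((x 1).mul (x 3)).const_mul 4)))).add
    (y0.mul (x 4))).congr_deriv ?_
  simp only [weightFour, Nat.cast_ofNat, Pi.pow_apply, Pi.mul_apply, Pi.add_apply, Nat.reduceAdd]
  ring

theorem continuous_iteratedDeriv_rootExcess (i : ℕ) : Continuous (iteratedDeriv i rootExcess) :=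
  continuous_iff_continuousAt.2 fun S => (hasDerivAt_iteratedDeriv_rootExcess i S).continuousAt

theorem continuous_weightTwo (m : ℝ) {G : ℝ → ℝ} (hG : ContDiff ℝ (2 : ℕ) G) :
    Continuous fun q : ℝ × ℝ => weightTwo m G q.1 q.2 := by
  have x := continuous_iteratedDeriv_rootExcess
  have x1 := x 1
  have x2 := x 2
  have x3 := x 3
  have y0 := continuous_twisted m (k := 0) (hG.of_le (by norm_cast))
  have y1 := continuous_twisted m (k := 1) (hG.of_le (by norm_cast))
  have y2 := continuous_twisted m (k := 2) hG
  unfold weightTwo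
  fun_prop

theorem continuous_weightFour (m : ℝ) {G : ℝ → ℝ} (hG : ContDiff ℝ (4 : ℕ) G) :
    Continuous fun q : ℝ × ℝ => weightFour m G q.1 q.2 := by
  have x := continuous_iteratedDeriv_rootExcess
  have x1 := x 1
  have x2 := x 2
  have x3 := x 3
  have x4 := x 4
  have x5 := x 5
  have y0 := continuous_twisted m (k := 0) (hG.of_le (by norm_cast))
  have y1 := continuous_twisted m (k := 1) (hG.of_le (by norm_cast))
  have y2 := continuous_twisted m (k := 2) (hG.of_le (by norm_cast))
  have y3 := continuous_twisted m (k := 3) (hG.of_le (by norm_cast))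
  have y4 := continuous_twisted m (k := 4) hG
  unfold weightFour
  exact ((((y4.mul ((x1.comp continuous_snd).pow 5)).add (continuous_const.mul (y3.mul
    (by fun_prop)))).add (y2.mul (by fun_prop))).add (y1.mul (by fun_prop))).add
    (y0.mul (by fun_prop))

/-- Binomial expansion of the powers of the operator `m - D / 2`. Each formula assumes only the
derivatives that occur in it. -/
theorem twist_explicit (m : ℝ) {G : ℝ → ℝ} (t : ℝ) :
    twist m G 0 t = G t ∧
    (ContDiff ℝ (1 : ℕ) G → twist m G 1 t = m * G t - iteratedDeriv 1 G t / 2) ∧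
    (ContDiff ℝ (2 : ℕ) G → twist m G 2 t =
      m ^ 2 * G t - m * iteratedDeriv 1 G t + iteratedDeriv 2 G t / 4) ∧
    (ContDiff ℝ (3 : ℕ) G → twist m G 3 t =
      m ^ 3 * G t - 3 / 2 * m ^ 2 * iteratedDeriv 1 G t + 3 / 4 * m * iteratedDeriv 2 G t
        - iteratedDeriv 3 G t / 8) ∧
    (ContDiff ℝ (4 : ℕ) G → twist m G 4 t =
      m ^ 4 * G t - 2 * m ^ 3 * iteratedDeriv 1 G t + 3 / 2 * m ^ 2 * iteratedDeriv 2 G t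
        - 1 / 2 * m * iteratedDeriv 3 G t + iteratedDeriv 4 G t / 16) := by
  have d {i N : ℕ} (h : i < N) (hG : ContDiff ℝ N G) (t : ℝ) :
      HasDerivAt (iteratedDeriv i G) (iteratedDeriv (i + 1) G t) t := by
    rw [iteratedDeriv_succ]
    exact (hG.differentiable_iteratedDeriv i (by exact_mod_cast h) t).hasDerivAt
  have d0 {N : ℕ} (h : 0 < N) (hG : ContDiff ℝ N G) (t : ℝ) :
      HasDerivAt G (iteratedDeriv 1 G t) t := by simpa using d h hG t
  have st {k : ℕ} {F : ℝ → ℝ} {f : ℝ} {t : ℝ} (hF : twist m G k = F) (hf : HasDerivAt F f t) :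
      twist m G (k + 1) t = m * F t - f / 2 := by
    subst hF
    rw [← hf.deriv]
    rfl
  have t1 {N : ℕ} (h : 1 ≤ N) (hG : ContDiff ℝ N G) :
      twist m G 1 = fun t => m * G t - iteratedDeriv 1 G t / 2 :=
    funext fun t => st rfl (d0 h hG t)
  have t2 {N : ℕ} (h : 2 ≤ N) (hG : ContDiff ℝ N G) : twist m G 2 = fun t =>
      m ^ 2 * G t - m * iteratedDeriv 1 G t + iteratedDeriv 2 G t / 4 := by
    funext t
    rw [st (t1 (by omega) hG) (((d0 (by omega) hG t).const_mul m).sub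
      ((d (i := 1) h hG t).div_const 2))]
    ring
  have t3 {N : ℕ} (h : 3 ≤ N) (hG : ContDiff ℝ N G) : twist m G 3 = fun t =>
      m ^ 3 * G t - 3 / 2 * m ^ 2 * iteratedDeriv 1 G t + 3 / 4 * m * iteratedDeriv 2 G t
        - iteratedDeriv 3 G t / 8 := by
    funext t
    rw [st (t2 (by omega) hG) ((((d0 (by omega) hG t).const_mul (m ^ 2)).sub
      ((d (i := 1) (by omega) hG t).const_mul m)).add ((d (i := 2) h hG t).div_const 4))]
    ring
  refine ⟨rfl, fun h => congrFun (t1 le_rfl h) t, fun h => congrFun (t2 le_rfl h) t,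
    fun h => congrFun (t3 le_rfl h) t, fun h => ?_⟩
  rw [st (t3 (by omega) h) (((((d0 (by omega) h t).const_mul (m ^ 3)).sub
      ((d (i := 1) (by omega) h t).const_mul (3 / 2 * m ^ 2))).add
      ((d (i := 2) (by omega) h t).const_mul (3 / 4 * m))).sub
      ((d (i := 3) (by omega) h t).div_const 8))]
  ring

theorem weight_zero (m : ℝ) (G : ℝ → ℝ) (j : ℝ) : weight m G j 0 = G j := by
  simp [weight, rootExcess_zero, rootSlope_zero]

theorem weightTwo_zero (m : ℝ) {G : ℝ → ℝ} (hG : ContDiff ℝ (2 : ℕ) G) (j : ℝ) :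
    weightTwo m G j 0 = (m ^ 2 - m + 1 / 6) * G j + (1 / 2 - m) * iteratedDeriv 1 G j
      + iteratedDeriv 2 G j / 4 := by
  obtain ⟨x1, x2, x3, x4, x5⟩ := iteratedDeriv_rootExcess_zero
  obtain ⟨t0, t1, t2, -, -⟩ := twist_explicit m (G := G) j
  simp only [weightTwo, twisted, x1, x2, x3, rootExcess_zero, zero_div, sub_zero, mul_zero,
    Real.exp_zero, t0, t1 (hG.of_le (by norm_cast)), t2 hG]
  ring

theorem weightFour_zero (m : ℝ) (G : ℝ → ℝ) (j : ℝ) :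
    weightFour m G j 0 = twist m G 4 j - 10 / 3 * twist m G 3 j + 10 / 3 * twist m G 2 j
      - twist m G 1 j + G j / 36 := by
  obtain ⟨x1, x2, x3, x4, x5⟩ := iteratedDeriv_rootExcess_zero
  simp only [weightFour, twisted, x1, x2, x3, x4, x5, rootExcess_zero, zero_div, sub_zero, mul_zero,
    Real.exp_zero, twist.eq_1]
  ring

end Weights

/-! ### Integrals of the weights over circles, and their expansion in the square of the radius. -/

section CircleIntegrals

/-- Integral of the weight along the circle of radius `s`. -/
noncomputable def circleWeight (m : ℝ) (G : ℝ → ℝ) (s j : ℝ) : ℝ :=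
  ∫ φ in (0 : ℝ)..2 * Real.pi, weight m G j (s * Real.cos φ)

/-- `s⁻¹ ∂ₛ` of `circleWeight`. -/
noncomputable def circleWeightTwo (m : ℝ) (G : ℝ → ℝ) (s j : ℝ) : ℝ :=
  ∫ φ in (0 : ℝ)..2 * Real.pi, weightTwo m G j (s * Real.cos φ) * Real.sin φ ^ 2

theorem contDiff_weight (m : ℝ) {G : ℝ → ℝ} {r : ℕ∞} (hG : ContDiff ℝ r G) :
    ContDiff ℝ r fun q : ℝ × ℝ => weight m G q.1 q.2 := by
  have hx := contDiff_rootExcess (r := r)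
  have hs := contDiff_rootSlope (r := r)
  unfold weight
  fun_prop

theorem contDiff_circleWeight (m : ℝ) {G : ℝ → ℝ} {r : ℕ∞} (hG : ContDiff ℝ r G) :
    ContDiff ℝ r fun q : ℝ × ℝ => circleWeight m G q.1 q.2 := by
  refine contDiff_intervalIntegral
    (f := fun z : (ℝ × ℝ) × ℝ => weight m G z.1.2 (z.1.1 * Real.cos z.2)) ?_ _ _
  refine (contDiff_weight m hG).comp
    (f := fun z : (ℝ × ℝ) × ℝ => (z.1.2, z.1.1 * Real.cos z.2)) ?_
  fun_prop

theorem continuous_circleWeightTwo (m : ℝ) {G : ℝ → ℝ} (hG : ContDiff ℝ (2 : ℕ) G) :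
    Continuous fun q : ℝ × ℝ => circleWeightTwo m G q.1 q.2 := by
  have hc := continuous_weightTwo m hG
  refine intervalIntegral.continuous_parametric_intervalIntegral_of_continuous'
    (f := fun (q : ℝ × ℝ) φ => weightTwo m G q.2 (q.1 * Real.cos φ) * Real.sin φ ^ 2) ?_ _ _
  exact (hc.comp (by fun_prop : Continuous fun z : (ℝ × ℝ) × ℝ =>
    (z.1.2, z.1.1 * Real.cos z.2))).mul (by fun_prop)

theorem continuous_weightOne (m : ℝ) {G : ℝ → ℝ} (hG : ContDiff ℝ (2 : ℕ) G) (j : ℝ) :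
    Continuous (weightOne m G j) :=
  continuous_iff_continuousAt.2 fun S => (hasDerivAt_weightOne m hG j S).continuousAt

/-- Differentiation under the integral gives the first derivative of the weight against `cos φ`.
Integrating by parts against `sin φ`, whose boundary terms vanish, releases a factor `s`; the
cofactor is an integral that stays continuous down to `s = 0`. -/
theorem hasDerivAt_circleWeight_radius (m : ℝ) {G : ℝ → ℝ} (hG : ContDiff ℝ (2 : ℕ) G) (s j : ℝ) :
    HasDerivAt (fun s => circleWeight m G s j) (s * circleWeightTwo m G s j) s := by
  have hG1 : ContDiff ℝ (1 : ℕ∞) G := hG.of_le (by norm_cast)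
  have h1 : HasDerivAt (fun s => circleWeight m G s j)
      (∫ φ in (0 : ℝ)..2 * Real.pi, weightOne m G j (s * Real.cos φ) * Real.cos φ) s := by
    refine hasDerivAt_intervalIntegral_of_contDiff
      (f := fun s φ => weight m G j (s * Real.cos φ))
      (f' := fun φ => weightOne m G j (s * Real.cos φ) * Real.cos φ) ?_ _ _ s fun φ => ?_
    · exact (contDiff_weight m hG1).comp (f := fun z : ℝ × ℝ => (j, z.1 * Real.cos z.2))
        (by fun_prop)
    · have h := (hasDerivAt_weight m (hG.of_le (by norm_cast)) j (s * Real.cos φ)).comp s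
        ((hasDerivAt_id s).mul_const (Real.cos φ))
      exact h.congr_deriv (by simp)
  refine h1.congr_deriv ?_
  have hc1 := continuous_weightOne m hG j
  have hc2 : Continuous fun S => weightTwo m G j S :=
    (continuous_weightTwo m hG).comp (by fun_prop : Continuous fun S : ℝ => (j, S))
  have h2 : ∀ φ ∈ uIcc (0 : ℝ) (2 * Real.pi), HasDerivAt
      (fun φ => weightOne m G j (s * Real.cos φ) * Real.sin φ)
      (weightOne m G j (s * Real.cos φ) * Real.cos φ
        - s * (weightTwo m G j (s * Real.cos φ) * Real.sin φ ^ 2)) φ := by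
    intro φ _
    refine (((hasDerivAt_weightOne m hG j (s * Real.cos φ)).comp φ
      ((Real.hasDerivAt_cos φ).const_mul s)).mul (Real.hasDerivAt_sin φ)).congr_deriv ?_
    simp only [Function.comp]
    ring
  have h3 := intervalIntegral.integral_eq_sub_of_hasDerivAt h2
    (Continuous.intervalIntegrable (by fun_prop) _ _)
  rw [intervalIntegral.integral_sub (Continuous.intervalIntegrable (by fun_prop) _ _)
    (Continuous.intervalIntegrable (by fun_prop) _ _), intervalIntegral.integral_const_mul] at h3
  simp only [Real.sin_two_pi, Real.sin_zero, mul_zero, sub_zero] at h3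
  rw [circleWeightTwo]
  linarith

theorem hasDerivAt_weight_left (m : ℝ) {G : ℝ → ℝ} (hG : Differentiable ℝ G) (j S : ℝ) :
    HasDerivAt (fun j => weight m G j S) (weight m (deriv G) j S) j := by
  unfold weight
  have h := (hG (j - rootExcess S / 2)).hasDerivAt.comp j ((hasDerivAt_id j).sub_const _)
  exact ((h.mul_const _).mul_const _).congr_deriv (by simp)

theorem hasDerivAt_circleWeight_param (m : ℝ) {G : ℝ → ℝ} (hG : ContDiff ℝ (1 : ℕ) G) (s j : ℝ) :
    HasDerivAt (fun j => circleWeight m G s j) (circleWeight m (deriv G) s j) j := by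
  refine hasDerivAt_intervalIntegral_of_contDiff
    (f := fun j φ => weight m G j (s * Real.cos φ)) ?_ _ _ j fun φ => ?_
  · have hG1 : ContDiff ℝ (1 : ℕ∞) G := hG.of_le (by norm_cast)
    exact (contDiff_weight m hG1).comp (f := fun z : ℝ × ℝ => (z.1, s * Real.cos z.2))
      (by fun_prop)
  · exact hasDerivAt_weight_left m (hG.differentiable (by simp)) j _

theorem weight_pos (m : ℝ) {G : ℝ → ℝ} (hG : ∀ t, 0 < G t) (j S : ℝ) : 0 < weight m G j S :=
  mul_pos (mul_pos (hG _) (rootSlope_pos _)) (Real.exp_pos _)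

theorem circleWeight_pos (m : ℝ) {G : ℝ → ℝ} (hc : ContDiff ℝ (0 : ℕ∞) G) (hG : ∀ t, 0 < G t)
    (s j : ℝ) : 0 < circleWeight m G s j := by
  refine intervalIntegral.intervalIntegral_pos_of_pos_on (Continuous.intervalIntegrable ?_ _ _)
    (fun φ _ => weight_pos m hG _ _) Real.two_pi_pos
  exact (contDiff_weight m hc).continuous.comp
    (by fun_prop : Continuous fun φ : ℝ => (j, s * Real.cos φ))

theorem secondOrder_remainder {ψ ψ₁ ψ₂ : ℝ → ℝ} (h1 : ∀ S, HasDerivAt ψ (ψ₁ S) S)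
    (h2 : ∀ S, HasDerivAt ψ₁ (ψ₂ S) S) (hc : Continuous ψ₂) (y : ℝ) :
    ψ y = ψ 0 + y * ψ₁ 0 + y ^ 2 * ∫ t in (0 : ℝ)..1, (1 - t) * ψ₂ (y * t) := by
  have h : ∀ t ∈ uIcc (0 : ℝ) 1, HasDerivAt (fun t => (1 - t) * (y * ψ₁ (y * t)) + ψ (y * t))
      (y ^ 2 * ((1 - t) * ψ₂ (y * t))) t := by
    intro t _
    have hl : HasDerivAt (fun t : ℝ => y * t) (y * 1) t := (hasDerivAt_id t).const_mul y
    have d1 := ((h2 (y * t)).comp t hl).const_mul y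
    have d0 := (h1 (y * t)).comp t hl
    refine ((((hasDerivAt_id t).const_sub 1).mul d1).add d0).congr_deriv ?_
    simp only [Function.comp, id]
    ring
  have h3 := intervalIntegral.integral_eq_sub_of_hasDerivAt h
    (Continuous.intervalIntegrable (by fun_prop) _ _)
  rw [intervalIntegral.integral_const_mul] at h3
  rw [h3]
  simp only [sub_self, zero_mul, mul_one, zero_add, sub_zero, one_mul, mul_zero]
  ring

/-- Expansion of circle integrals to first order in the square `u` of the radius. -/
theorem hasDerivWithinAt_circle {ψ ψ₁ ψ₂ : ℝ → ℝ} (h1 : ∀ S, HasDerivAt ψ (ψ₁ S) S)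
    (h2 : ∀ S, HasDerivAt ψ₁ (ψ₂ S) S) (hc : Continuous ψ₂) {b : ℝ → ℝ} (hb : Continuous b)
    (h0 : ∫ φ in (0 : ℝ)..2 * Real.pi, Real.cos φ * b φ = 0) :
    HasDerivWithinAt (fun u => ∫ φ in (0 : ℝ)..2 * Real.pi, ψ (√u * Real.cos φ) * b φ)
      (ψ₂ 0 / 2 * ∫ φ in (0 : ℝ)..2 * Real.pi, Real.cos φ ^ 2 * b φ) (Ici 0) 0 := by
  set η : ℝ → ℝ := fun y => ∫ t in (0 : ℝ)..1, (1 - t) * ψ₂ (y * t) with hη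
  have hηc : Continuous η :=
    intervalIntegral.continuous_parametric_intervalIntegral_of_continuous'
      (f := fun y t => (1 - t) * ψ₂ (y * t)) (by fun_prop) _ _
  have hη0 : η 0 = ψ₂ 0 / 2 := by
    have : ∫ t in (0 : ℝ)..1, (1 - t) = 1 / 2 := by
      rw [intervalIntegral.integral_sub (by simp) (by simp)]
      simp; norm_num
    simp only [hη, zero_mul, intervalIntegral.integral_mul_const, this]
    ring
  set C : ℝ → ℝ := fun u => ∫ φ in (0 : ℝ)..2 * Real.pi,
    η (√u * Real.cos φ) * (Real.cos φ ^ 2 * b φ) with hC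
  have hCc : Continuous C :=
    intervalIntegral.continuous_parametric_intervalIntegral_of_continuous'
      (f := fun u φ => η (√u * Real.cos φ) * (Real.cos φ ^ 2 * b φ)) (by fun_prop) _ _
  have hC0 : C 0 = ψ₂ 0 / 2 * ∫ φ in (0 : ℝ)..2 * Real.pi, Real.cos φ ^ 2 * b φ := by
    simp only [hC, Real.sqrt_zero, zero_mul, intervalIntegral.integral_const_mul, hη0]
  -- The term of order `√u` integrates to zero by `h0`. What remains is a constant plus `u` times a
  -- continuous function, so the one-sided derivative at `0` is the value of that function.
  have hexp : ∀ u ∈ Ici (0 : ℝ), (∫ φ in (0 : ℝ)..2 * Real.pi, ψ (√u * Real.cos φ) * b φ) =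
      (∫ φ in (0 : ℝ)..2 * Real.pi, ψ 0 * b φ) + u * C u := by
    intro u hu
    have e : ∀ φ, ψ (√u * Real.cos φ) * b φ = ψ 0 * b φ + ψ₁ 0 * √u * (Real.cos φ * b φ)
        + u * (η (√u * Real.cos φ) * (Real.cos φ ^ 2 * b φ)) := by
      intro φ
      rw [secondOrder_remainder h1 h2 hc (√u * Real.cos φ), mul_pow, Real.sq_sqrt hu]
      ring
    simp_rw [e]
    rw [intervalIntegral.integral_add (Continuous.intervalIntegrable (by fun_prop) _ _)
      (Continuous.intervalIntegrable (by fun_prop) _ _),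
      intervalIntegral.integral_add (Continuous.intervalIntegrable (by fun_prop) _ _)
      (Continuous.intervalIntegrable (by fun_prop) _ _), intervalIntegral.integral_const_mul u,
      intervalIntegral.integral_const_mul (ψ₁ 0 * √u), h0]
    ring
  rw [← hC0]
  have hmain : HasDerivWithinAt (fun u => (∫ φ in (0 : ℝ)..2 * Real.pi, ψ 0 * b φ) + u * C u)
      (C 0) (Ici 0) 0 := by
    refine HasDerivWithinAt.const_add _ ?_
    rw [hasDerivWithinAt_iff_tendsto_slope]
    refine (hCc.tendsto 0).mono_left nhdsWithin_le_nhds |>.congr' ?_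
    filter_upwards [self_mem_nhdsWithin] with u hu
    have : u ≠ 0 := hu.2
    simp only [slope_def_field, zero_mul, sub_zero]
    field_simp
  exact hmain.congr hexp (hexp 0 self_mem_Ici)

theorem hasDerivWithinAt_circleWeight_sqrt (m : ℝ) {G : ℝ → ℝ} (hG : ContDiff ℝ (2 : ℕ) G)
    (j : ℝ) : HasDerivWithinAt (fun u => circleWeight m G (√u) j)
      (Real.pi / 2 * weightTwo m G j 0) (Ici 0) 0 := by
  have hc : Continuous (weightTwo m G j) :=
    (continuous_weightTwo m hG).comp (by fun_prop : Continuous fun S : ℝ => (j, S))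
  have h := hasDerivWithinAt_circle (b := fun _ => 1)
    (ψ := weight m G j) (ψ₁ := weightOne m G j) (ψ₂ := weightTwo m G j)
    (hasDerivAt_weight m (hG.of_le (by norm_cast)) j) (hasDerivAt_weightOne m hG j) hc
    continuous_const (by simp)
  simp only [mul_one, integral_cos_sq] at h
  refine h.congr_deriv ?_
  simp
  ring

theorem hasDerivWithinAt_circleWeightTwo_sqrt (m : ℝ) {G : ℝ → ℝ} (hG : ContDiff ℝ (4 : ℕ) G)
    (j : ℝ) : HasDerivWithinAt (fun u => circleWeightTwo m G (√u) j)
      (Real.pi / 8 * weightFour m G j 0) (Ici 0) 0 := by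
  have hp : Continuous fun S : ℝ => (j, S) := by fun_prop
  have hc := (continuous_weightFour m hG).comp hp
  simp only [Function.comp_def] at hc
  have h := hasDerivWithinAt_circle (b := fun φ => Real.sin φ ^ 2)
    (ψ := weightTwo m G j) (ψ₁ := weightThree m G j) (ψ₂ := weightFour m G j)
    (fun S => hasDerivAt_weightTwo m (hG.of_le (by norm_cast)) j S)
    (fun S => hasDerivAt_weightThree m hG j S) hc (by fun_prop) (by simp_rw [mul_comm (Real.cos _)]; simp [integral_sin_sq_mul_cos])
  have e : ∫ φ in (0 : ℝ)..2 * Real.pi, Real.cos φ ^ 2 * Real.sin φ ^ 2 = Real.pi / 4 := by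
    simp_rw [mul_comm (Real.cos _ ^ 2)]
    rw [integral_sin_sq_mul_cos_sq, show 4 * (2 * Real.pi) = (8 : ℕ) * Real.pi by push_cast; ring,
      Real.sin_nat_mul_pi]
    simp
    ring
  rw [e] at h
  exact h.congr_deriv (by ring)

theorem circleWeight_zero (m : ℝ) (G : ℝ → ℝ) (j : ℝ) :
    circleWeight m G 0 j = 2 * Real.pi * G j := by
  simp [circleWeight, weight_zero]

theorem circleWeightTwo_zero (m : ℝ) (G : ℝ → ℝ) (j : ℝ) :
    circleWeightTwo m G 0 j = Real.pi * weightTwo m G j 0 := by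
  simp only [circleWeightTwo, zero_mul, intervalIntegral.integral_const_mul, integral_sin_sq]
  simp
  ring

end CircleIntegrals

/-! ### The two determinants do not vanish near the equilibria. -/

section Nondegeneracy

/-- The function of the radius `s` and of `j` whose non-vanishing is Kolmogorov non-degeneracy. -/
noncomputable def kolmogorovDet (G : ℝ → ℝ) (s j : ℝ) : ℝ :=
  circleWeightTwo 0 G s j * (circleWeight 1 (deriv G) s j - circleWeight 1 G s j)
    - circleWeight 0 (deriv G) s j * circleWeightTwo 1 G s j

/-- The function of the radius `s` and of `j` whose non-vanishing is iso-energetic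
non-degeneracy. -/
noncomputable def isoenergeticDet (G : ℝ → ℝ) (s j : ℝ) : ℝ :=
  circleWeightTwo 1 G s j - 1 / 2 * (circleWeight 1 (deriv G) s j - circleWeight 1 G s j)

theorem contDiff_deriv_of_succ {G : ℝ → ℝ} {k : ℕ} (hG : ContDiff ℝ (k + 1 : ℕ) G) :
    ContDiff ℝ k (deriv G) := ContDiff.deriv' (by exact_mod_cast hG)

theorem continuous_kolmogorovDet {G : ℝ → ℝ} (hG : ContDiff ℝ (2 : ℕ) G) :
    Continuous fun q : ℝ × ℝ => kolmogorovDet G q.1 q.2 := by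
  have h0 : ContDiff ℝ (0 : ℕ∞) G := hG.of_le (by norm_cast)
  have h1 : ContDiff ℝ (0 : ℕ∞) (deriv G) :=
    (contDiff_deriv_of_succ (k := 1) hG).of_le (by norm_cast)
  have a := continuous_circleWeightTwo 0 hG
  have b := continuous_circleWeightTwo 1 hG
  have c := (contDiff_circleWeight 1 h1).continuous
  have d := (contDiff_circleWeight 1 h0).continuous
  have e := (contDiff_circleWeight 0 h1).continuous
  exact (a.mul (c.sub d)).sub (e.mul b)

theorem continuous_isoenergeticDet {G : ℝ → ℝ} (hG : ContDiff ℝ (2 : ℕ) G) :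
    Continuous fun q : ℝ × ℝ => isoenergeticDet G q.1 q.2 := by
  have h0 : ContDiff ℝ (0 : ℕ∞) G := hG.of_le (by norm_cast)
  have h1 : ContDiff ℝ (0 : ℕ∞) (deriv G) :=
    (contDiff_deriv_of_succ (k := 1) hG).of_le (by norm_cast)
  have b := continuous_circleWeightTwo 1 hG
  have c := (contDiff_circleWeight 1 h1).continuous
  have d := (contDiff_circleWeight 1 h0).continuous
  exact b.sub (continuous_const.mul (c.sub d))

/-- Value of `kolmogorovDet` at radius `0`, in terms of the `2`-jet of `G`. -/
noncomputable def kolmogorovJet (g₀ g₁ g₂ : ℝ) : ℝ :=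
  g₁ ^ 2 - g₀ * (g₀ / 6 + g₁ / 2 + g₂ / 4)

/-- Coefficient of `s²` in `kolmogorovDet`, in terms of the `4`-jet of `G`. -/
noncomputable def kolmogorovJetTwo (g₀ g₁ g₂ g₃ g₄ : ℝ) : ℝ :=
  1 / 2 * (g₀ / 6 + g₁ / 2 + g₂ / 4) *
      ((g₁ / 6 - g₂ / 2 + g₃ / 4) - (g₀ / 6 - g₁ / 2 + g₂ / 4))
    + 1 / 4 * (g₄ / 16 + 5 / 12 * g₃ + 5 / 6 * g₂ + g₁ / 2 + g₀ / 36) * (g₁ - g₀)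
    - 1 / 4 * g₁ * (g₄ / 16 - g₃ / 12 - g₂ / 6 + g₁ / 6 + g₀ / 36)
    - 1 / 2 * (g₁ / 6 + g₂ / 2 + g₃ / 4) * (g₀ / 6 - g₁ / 2 + g₂ / 4)

/-- Value of `isoenergeticDet` at radius `0`, in terms of the `2`-jet of `G`. -/
noncomputable def isoenergeticJet (g₀ g₁ g₂ : ℝ) : ℝ :=
  7 / 6 * g₀ - 3 / 2 * g₁ + g₂ / 4

/-- Coefficient of `s²` in `isoenergeticDet`, in terms of the `4`-jet of `G`. -/
noncomputable def isoenergeticJetTwo (g₀ g₁ g₂ g₃ g₄ : ℝ) : ℝ :=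
  1 / 8 * (g₄ / 16 - g₃ / 12 - g₂ / 6 + g₁ / 6 + g₀ / 36)
    - 1 / 4 * ((g₁ / 6 - g₂ / 2 + g₃ / 4) - (g₀ / 6 - g₁ / 2 + g₂ / 4))

theorem weightFour_zero_explicit {G : ℝ → ℝ} (hG : ContDiff ℝ (4 : ℕ) G) (j : ℝ) :
    weightFour 0 G j 0 = iteratedDeriv 4 G j / 16 + 5 / 12 * iteratedDeriv 3 G j
      + 5 / 6 * iteratedDeriv 2 G j + iteratedDeriv 1 G j / 2 + G j / 36 ∧
    weightFour 1 G j 0 = iteratedDeriv 4 G j / 16 - iteratedDeriv 3 G j / 12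
      - iteratedDeriv 2 G j / 6 + iteratedDeriv 1 G j / 6 + G j / 36 := by
  have h1 : ContDiff ℝ (1 : ℕ) G := hG.of_le (by norm_cast)
  have h2 : ContDiff ℝ (2 : ℕ) G := hG.of_le (by norm_cast)
  have h3 : ContDiff ℝ (3 : ℕ) G := hG.of_le (by norm_cast)
  constructor
  · obtain ⟨-, t1, t2, t3, t4⟩ := twist_explicit 0 (G := G) j
    rw [weightFour_zero, t1 h1, t2 h2, t3 h3, t4 hG]
    ring
  · obtain ⟨-, t1, t2, t3, t4⟩ := twist_explicit 1 (G := G) j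
    rw [weightFour_zero, t1 h1, t2 h2, t3 h3, t4 hG]
    ring

/-- With `u = s ^ 2`, the circle integrals start `2 π G + (π / 2) w₂ u` and `π w₂ + (π / 8) w₄ u`,
where `w₂`, `w₄` are derivatives of the weight at the origin. The product rule then gives value and
slope of both determinants. -/
theorem hasDerivWithinAt_dets {G : ℝ → ℝ} (hG : ContDiff ℝ (4 : ℕ) G) (j : ℝ) :
    kolmogorovDet G 0 j =
      2 * Real.pi ^ 2 * kolmogorovJet (G j) (iteratedDeriv 1 G j) (iteratedDeriv 2 G j) ∧
    HasDerivWithinAt (fun u => kolmogorovDet G (√u) j)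
      (Real.pi ^ 2 * kolmogorovJetTwo (G j) (iteratedDeriv 1 G j) (iteratedDeriv 2 G j)
        (iteratedDeriv 3 G j) (iteratedDeriv 4 G j)) (Ici 0) 0 ∧
    isoenergeticDet G 0 j =
      Real.pi * isoenergeticJet (G j) (iteratedDeriv 1 G j) (iteratedDeriv 2 G j) ∧
    HasDerivWithinAt (fun u => isoenergeticDet G (√u) j)
      (Real.pi * isoenergeticJetTwo (G j) (iteratedDeriv 1 G j) (iteratedDeriv 2 G j)
        (iteratedDeriv 3 G j) (iteratedDeriv 4 G j)) (Ici 0) 0 := by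
  have h2 : ContDiff ℝ (2 : ℕ) G := hG.of_le (by norm_cast)
  have hd : ContDiff ℝ (2 : ℕ) (deriv G) := contDiff_deriv_of_succ (hG.of_le (by norm_cast))
  have e1 : deriv G j = iteratedDeriv 1 G j := by rw [iteratedDeriv_one]
  have e2 : iteratedDeriv 1 (deriv G) j = iteratedDeriv 2 G j := by rw [← iteratedDeriv_succ']
  have e3 : iteratedDeriv 2 (deriv G) j = iteratedDeriv 3 G j := by rw [← iteratedDeriv_succ']
  obtain ⟨f0, f1⟩ := weightFour_zero_explicit hG j
  have a := hasDerivWithinAt_circleWeightTwo_sqrt 0 hG j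
  have b := hasDerivWithinAt_circleWeightTwo_sqrt 1 hG j
  have c := hasDerivWithinAt_circleWeight_sqrt 1 hd j
  have d := hasDerivWithinAt_circleWeight_sqrt 1 h2 j
  have e := hasDerivWithinAt_circleWeight_sqrt 0 hd j
  refine ⟨?_, ?_, ?_, ?_⟩
  · simp only [kolmogorovDet, circleWeight_zero, circleWeightTwo_zero, weightTwo_zero _ h2,
      kolmogorovJet, e1]
    ring
  · refine ((a.mul (c.sub d)).sub (e.mul b)).congr_deriv ?_
    simp only [circleWeight_zero, circleWeightTwo_zero, weightTwo_zero _ h2, weightTwo_zero _ hd,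
      f0, f1, kolmogorovJetTwo, e1, e2, e3, Real.sqrt_zero, Pi.sub_apply]
    ring
  · simp only [isoenergeticDet, circleWeight_zero, circleWeightTwo_zero, weightTwo_zero _ h2,
      isoenergeticJet, e1]
    ring
  · refine (b.sub ((c.sub d).const_mul (1 / 2))).congr_deriv ?_
    simp only [weightTwo_zero _ h2, weightTwo_zero _ hd, f1, isoenergeticJetTwo, e1, e2, e3]
    ring

/-- A non-zero value persists by continuity; a zero with non-zero one-sided slope is isolated on the
right. -/
theorem eventually_sqrt_ne_zero {f : ℝ → ℝ} {d : ℝ} (hf : HasDerivWithinAt f d (Ici 0) 0)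
    (h : ¬(f 0 = 0 ∧ d = 0)) : ∀ᶠ u in 𝓝[>] (0 : ℝ), f u ≠ 0 := by
  have hs : Ici (0 : ℝ) \ {0} = Ioi 0 := by ext x; simp [lt_iff_le_and_ne, eq_comm]
  by_cases h0 : f 0 = 0
  · have := hf.eventually_ne (c := 0) (fun hd => h ⟨h0, hd⟩)
    rwa [hs] at this
  · exact (hf.continuousWithinAt.mono Ioi_subset_Ici_self).eventually_ne h0

theorem deriv_zero_of_eventually {f : ℝ → ℝ} {d t : ℝ} (hf : HasDerivAt f d t)
    (h : ∀ᶠ x in 𝓝 t, f x = 0) : d = 0 :=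
  hf.unique ((hasDerivAt_const t (0 : ℝ)).congr_of_eventuallyEq h)

/-- No positive solution of the two isoenergetic jet equations on an interval. -/
theorem isoenergeticJet_not_identically_zero {G : ℝ → ℝ} (hG : ContDiff ℝ (4 : ℕ) G)
    (hpos : ∀ t, 0 < G t) {O : Set ℝ} (hO : IsOpen O) (hne : O.Nonempty)
    (h0 : ∀ t ∈ O, isoenergeticJet (G t) (iteratedDeriv 1 G t) (iteratedDeriv 2 G t) = 0)
    (h1 : ∀ t ∈ O, isoenergeticJetTwo (G t) (iteratedDeriv 1 G t) (iteratedDeriv 2 G t)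
      (iteratedDeriv 3 G t) (iteratedDeriv 4 G t) = 0) : False := by
  have d (i : ℕ) (h : i < 4) (t : ℝ) :
      HasDerivAt (iteratedDeriv i G) (iteratedDeriv (i + 1) G t) t := by
    rw [iteratedDeriv_succ]
    exact (hG.differentiable_iteratedDeriv i (by exact_mod_cast h) t).hasDerivAt
  have d0 (t : ℝ) : HasDerivAt G (iteratedDeriv 1 G t) t := by simpa using d 0 (by norm_num) t
  have d1 := d 1 (by norm_num)
  have d2 := d 2 (by norm_num)
  have d3 := d 3 (by norm_num)
  simp only [isoenergeticJet, isoenergeticJetTwo] at h0 h1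
  -- The second-order linear equation holds on an open set, so it may be differentiated twice there.
  have a1 : ∀ t ∈ O, 7 / 6 * iteratedDeriv 1 G t - 3 / 2 * iteratedDeriv 2 G t
      + iteratedDeriv 3 G t / 4 = 0 := fun t ht =>
    deriv_zero_of_eventually ((((d0 t).const_mul (7 / 6)).sub ((d1 t).const_mul (3 / 2))).add
      ((d2 t).div_const 4)) (mem_of_superset (hO.mem_nhds ht) h0)
  have a2 : ∀ t ∈ O, 7 / 6 * iteratedDeriv 2 G t - 3 / 2 * iteratedDeriv 3 G t
      + iteratedDeriv 4 G t / 4 = 0 := fun t ht =>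
    deriv_zero_of_eventually ((((d1 t).const_mul (7 / 6)).sub ((d2 t).const_mul (3 / 2))).add
      ((d3 t).div_const 4)) (mem_of_superset (hO.mem_nhds ht) a1)
  -- The second-order equation and its derivatives eliminate the derivatives of order two to four
  -- from the fourth-order one, leaving `13 G' = 12 G`. An exponential of this rate does not satisfy
  -- the second-order equation.
  have b : ∀ t ∈ O, 13 * iteratedDeriv 1 G t - 12 * G t = 0 := by
    intro t ht
    have e0 := h0 t ht
    have e1 := h1 t ht
    have f1 := a1 t ht
    have f2 := a2 t ht
    linarith
  obtain ⟨t, ht⟩ := hne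
  have b1 : 13 * iteratedDeriv 2 G t - 12 * iteratedDeriv 1 G t = 0 :=
    deriv_zero_of_eventually (((d1 t).const_mul 13).sub ((d0 t).const_mul 12))
      (mem_of_superset (hO.mem_nhds ht) b)
  have e0 := h0 t ht
  have e1 := b t ht
  linarith [hpos t]

/-- No positive solution of the two Kolmogorov jet equations on an interval. -/
theorem kolmogorovJet_not_identically_zero {G : ℝ → ℝ} (hG : ContDiff ℝ (4 : ℕ) G)
    (hpos : ∀ t, 0 < G t) {O : Set ℝ} (hO : IsOpen O) (hne : O.Nonempty)
    (h0 : ∀ t ∈ O, kolmogorovJet (G t) (iteratedDeriv 1 G t) (iteratedDeriv 2 G t) = 0)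
    (h1 : ∀ t ∈ O, kolmogorovJetTwo (G t) (iteratedDeriv 1 G t) (iteratedDeriv 2 G t)
      (iteratedDeriv 3 G t) (iteratedDeriv 4 G t) = 0) : False := by
  have d (i : ℕ) (h : i < 4) (t : ℝ) :
      HasDerivAt (iteratedDeriv i G) (iteratedDeriv (i + 1) G t) t := by
    rw [iteratedDeriv_succ]
    exact (hG.differentiable_iteratedDeriv i (by exact_mod_cast h) t).hasDerivAt
  have d0 (t : ℝ) : HasDerivAt G (iteratedDeriv 1 G t) t := by simpa using d 0 (by norm_num) t
  have d1 := d 1 (by norm_num)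
  simp only [kolmogorovJet, kolmogorovJetTwo] at h0 h1
  -- the logarithmic derivative solves a Riccati equation
  set v : ℝ → ℝ := fun t => iteratedDeriv 1 G t / G t with hv
  have g1 (t : ℝ) : iteratedDeriv 1 G t = v t * G t := by
    simp only [hv]; field_simp [(hpos t).ne']
  have g2 : ∀ t ∈ O, iteratedDeriv 2 G t = (4 * v t ^ 2 - 2 * v t - 2 / 3) * G t := by
    intro t ht
    have e := h0 t ht
    rw [g1 t] at e
    have hp := (hpos t).ne'
    refine mul_left_cancel₀ hp ?_
    linarith
  have dv : ∀ t ∈ O, HasDerivAt v (3 * v t ^ 2 - 2 * v t - 2 / 3) t := by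
    intro t ht
    have hp := (hpos t).ne'
    refine ((d1 t).div (d0 t) hp).congr_deriv ?_
    rw [g2 t ht, g1 t]
    field_simp
    ring
  have tr {f c : ℝ → ℝ} {a b t : ℝ} (ht : t ∈ O) (hf : HasDerivAt f a t) (hc : HasDerivAt c b t)
      (h : ∀ t ∈ O, f t = c t) : a = b :=
    hf.unique (hc.congr_of_eventuallyEq (mem_of_superset (hO.mem_nhds ht) h))
  have g3 : ∀ t ∈ O, iteratedDeriv 3 G t =
      ((8 * v t - 2) * (3 * v t ^ 2 - 2 * v t - 2 / 3)
        + (4 * v t ^ 2 - 2 * v t - 2 / 3) * v t) * G t := by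
    intro t ht
    refine (tr ht (d 2 (by norm_num) t) ((((((dv t ht).pow 2).const_mul 4).sub
      ((dv t ht).const_mul 2)).sub_const (2 / 3)).mul (d0 t)) g2).trans ?_
    rw [g1 t]
    simp only [Nat.cast_ofNat, Pi.sub_apply, Pi.pow_apply]
    ring
  have g4 : ∀ t ∈ O, iteratedDeriv 4 G t =
      (8 * (3 * v t ^ 2 - 2 * v t - 2 / 3) ^ 2
        + (8 * v t - 2) * (6 * v t - 2) * (3 * v t ^ 2 - 2 * v t - 2 / 3)
        + (8 * v t - 2) * (3 * v t ^ 2 - 2 * v t - 2 / 3) * v t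
        + (4 * v t ^ 2 - 2 * v t - 2 / 3) * (3 * v t ^ 2 - 2 * v t - 2 / 3)
        + ((8 * v t - 2) * (3 * v t ^ 2 - 2 * v t - 2 / 3)
        + (4 * v t ^ 2 - 2 * v t - 2 / 3) * v t) * v t) * G t := by
    intro t ht
    have p := ((((dv t ht).pow 2).const_mul 3).sub ((dv t ht).const_mul 2)).sub_const (2 / 3)
    have q := ((((dv t ht).pow 2).const_mul 4).sub ((dv t ht).const_mul 2)).sub_const (2 / 3)
    refine (tr ht (d 3 (by norm_num) t) ((((((dv t ht).const_mul 8).sub_const 2).mul p).add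
      (q.mul (dv t ht))).mul (d0 t)) g3).trans ?_
    rw [g1 t]
    simp only [Nat.cast_ofNat, Pi.sub_apply, Pi.pow_apply, Pi.add_apply, Pi.mul_apply]
    ring
  -- All derivatives of `G` are now polynomials in `v` times `G`, so the second jet equation is `G ^
  -- 2` times a polynomial in `v`; the factor `-72` clears the denominators.
  have quartic : ∀ t ∈ O, -9 * v t ^ 4 + 12 * v t ^ 3 - 12 * v t ^ 2 + 6 * v t + 2 = 0 := by
    intro t ht
    have e := h1 t ht
    rw [g4 t ht, g3 t ht, g2 t ht, g1 t] at e
    have hp := (hpos t).ne'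
    refine (mul_eq_zero.1 (?_ : G t ^ 2 * _ = 0)).resolve_left (pow_ne_zero 2 hp)
    linear_combination (-72) * e
  obtain ⟨t, ht⟩ := hne
  have e := quartic t ht
  -- The quartic vanishes on an open set, hence so does its derivative along the Riccati equation.
  have e1 := deriv_zero_of_eventually ((((((dv t ht).pow 4).const_mul (-9)).add
    (((dv t ht).pow 3).const_mul 12)).sub (((dv t ht).pow 2).const_mul 12)).add
    ((dv t ht).const_mul 6) |>.add_const 2) (mem_of_superset (hO.mem_nhds ht) quartic)
  simp only [Nat.cast_ofNat, Nat.add_one_sub_one, pow_one] at e1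
  -- The quartic and its derivative along the Riccati field are coprime polynomials in `v`; the
  -- coefficients form a Bézout certificate.
  have bezout : (0 : ℝ) = 1 := by
    linear_combination -(-3863 / 4658 + 22437 / 4658 * v t - 18195 / 2329 * v t ^ 2
      + 19800 / 2329 * v t ^ 3 - 3051 / 2329 * v t ^ 4) * e
      - 3 * (-516 / 2329 + 388 / 2329 * v t - 2087 / 9316 * v t ^ 2
      + 339 / 9316 * v t ^ 3) * e1
  exact zero_ne_one bezout

/-- The order of the choices matters. The values of `j` near `j₀` at which the two Kolmogorov
coefficients do not both vanish form a non-empty open set. The iso-energetic coefficients cannot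
both vanish throughout that set, which fixes one `j` good for both determinants; then every
sufficiently small radius works. -/
theorem exists_nondegenerate_near {G : ℝ → ℝ} (hG : ContDiff ℝ (4 : ℕ) G) (hpos : ∀ t, 0 < G t)
    (j₀ : ℝ) {ε : ℝ} (hε : 0 < ε) : ∃ s j, 0 < s ∧ s < ε ∧ |j - j₀| < ε ∧
      kolmogorovDet G s j ≠ 0 ∧ isoenergeticDet G s j ≠ 0 := by
  have c (i : ℕ) (h : i ≤ 4) : Continuous (iteratedDeriv i G) :=
    hG.continuous_iteratedDeriv i (by exact_mod_cast h)
  have c0 := hG.continuous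
  have c1 := c 1 (by norm_num)
  have c2 := c 2 (by norm_num)
  have c3 := c 3 (by norm_num)
  have c4 := c 4 (by norm_num)
  set k₀ : ℝ → ℝ := fun t => kolmogorovJet (G t) (iteratedDeriv 1 G t) (iteratedDeriv 2 G t)
  set k₁ : ℝ → ℝ := fun t => kolmogorovJetTwo (G t) (iteratedDeriv 1 G t) (iteratedDeriv 2 G t)
    (iteratedDeriv 3 G t) (iteratedDeriv 4 G t)
  have hk₀ : Continuous k₀ := by simp only [k₀, kolmogorovJet]; fun_prop
  have hk₁ : Continuous k₁ := by simp only [k₁, kolmogorovJetTwo]; fun_prop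
  set O : Set ℝ := Metric.ball j₀ ε ∩ {t | k₀ t = 0 ∧ k₁ t = 0}ᶜ with hO
  have hOo : IsOpen O := Metric.isOpen_ball.inter
    ((isClosed_eq hk₀ continuous_const).inter (isClosed_eq hk₁ continuous_const)).isOpen_compl
  have hOne : O.Nonempty := by
    by_contra h
    have h' : ∀ t ∈ Metric.ball j₀ ε, k₀ t = 0 ∧ k₁ t = 0 := by
      intro t ht
      by_contra hc
      exact h ⟨t, ht, hc⟩
    exact kolmogorovJet_not_identically_zero hG hpos Metric.isOpen_ball
      ⟨j₀, Metric.mem_ball_self hε⟩ (fun t ht => (h' t ht).1) (fun t ht => (h' t ht).2)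
  obtain ⟨j, hj, hjI⟩ : ∃ j ∈ O,
      ¬(isoenergeticJet (G j) (iteratedDeriv 1 G j) (iteratedDeriv 2 G j) = 0 ∧
        isoenergeticJetTwo (G j) (iteratedDeriv 1 G j) (iteratedDeriv 2 G j)
          (iteratedDeriv 3 G j) (iteratedDeriv 4 G j) = 0) := by
    by_contra! h
    exact isoenergeticJet_not_identically_zero hG hpos hOo hOne (fun t ht => (h t ht).1)
      (fun t ht => (h t ht).2)
  obtain ⟨v1, d1, v2, d2⟩ := hasDerivWithinAt_dets hG j
  have e1 := eventually_sqrt_ne_zero d1 (by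
    simp only [Real.sqrt_zero, v1]
    intro h
    exact hj.2 ⟨(mul_eq_zero.1 h.1).resolve_left (by positivity),
      (mul_eq_zero.1 h.2).resolve_left (by positivity)⟩)
  have e2 := eventually_sqrt_ne_zero d2 (by
    simp only [Real.sqrt_zero, v2]
    intro h
    exact hjI ⟨(mul_eq_zero.1 h.1).resolve_left (by positivity),
      (mul_eq_zero.1 h.2).resolve_left (by positivity)⟩)
  have e3 : ∀ᶠ u in 𝓝[>] (0 : ℝ), u < ε ^ 2 :=
    mem_nhdsWithin_of_mem_nhds (Iio_mem_nhds (by positivity))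
  obtain ⟨u, h1, h2, h3, h4⟩ := (e1.and (e2.and (e3.and self_mem_nhdsWithin))).exists
  refine ⟨√u, j, Real.sqrt_pos.2 h4, (Real.sqrt_lt' hε).2 h3, ?_, h1, h2⟩
  simpa [Real.dist_eq] using hj.1

end Nondegeneracy

/-! ### Arc integrals and the action of a circle. -/

section AngleAction

/-- Integral of the weight along the arc `[0, φ]` of the circle of radius `s`; the arguments are
`p = (φ, s, j)`. -/
noncomputable def arcWeight (m : ℝ) (G : ℝ → ℝ) (p : ℝ × ℝ × ℝ) : ℝ :=
  ∫ t in (0 : ℝ)..p.1, weight m G p.2.2 (p.2.1 * Real.cos t)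

/-- The action of the circle of radius `s`. -/
noncomputable def circleAction (G : ℝ → ℝ) (s j : ℝ) : ℝ :=
  1 / 2 * ∫ t in (0 : ℝ)..s, t * circleWeight 0 G t j

theorem contDiff_arcWeight (m : ℝ) {G : ℝ → ℝ} {r : ℕ∞} (hG : ContDiff ℝ r G) :
    ContDiff ℝ r (arcWeight m G) := by
  refine contDiff_primitive
    (f := fun z : (ℝ × ℝ) × ℝ => weight m G z.1.2 (z.1.1 * Real.cos z.2)) ?_
  refine (contDiff_weight m hG).comp
    (f := fun z : (ℝ × ℝ) × ℝ => (z.1.2, z.1.1 * Real.cos z.2)) ?_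
  fun_prop

theorem contDiff_circleAction {G : ℝ → ℝ} {r : ℕ∞} (hG : ContDiff ℝ r G) :
    ContDiff ℝ r fun q : ℝ × ℝ => circleAction G q.1 q.2 := by
  refine contDiff_const.mul (contDiff_primitive
    (f := fun z : ℝ × ℝ => z.2 * circleWeight 0 G z.2 z.1) (contDiff_snd.mul ?_))
  exact (contDiff_circleWeight 0 hG).comp (f := fun z : ℝ × ℝ => (z.2, z.1)) (by fun_prop)

theorem arcWeight_two_pi (m : ℝ) (G : ℝ → ℝ) (s j : ℝ) :
    arcWeight m G (2 * Real.pi, s, j) = circleWeight m G s j := rfl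

theorem continuous_weight_cos (m : ℝ) {G : ℝ → ℝ} (hG : Continuous G) (s j : ℝ) :
    Continuous fun φ : ℝ => weight m G j (s * Real.cos φ) := by
  have h0 : ContDiff ℝ (0 : ℕ∞) G := contDiff_zero.2 hG
  exact (contDiff_weight m h0).continuous.comp
    (by fun_prop : Continuous fun φ : ℝ => (j, s * Real.cos φ))

theorem hasDerivAt_arcWeight_angle (m : ℝ) {G : ℝ → ℝ} (hG : Continuous G) (φ s j : ℝ) :
    HasDerivAt (fun φ => arcWeight m G (φ, s, j)) (weight m G j (s * Real.cos φ)) φ :=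
  (continuous_weight_cos m hG s j).integral_hasStrictDerivAt 0 φ |>.hasDerivAt

theorem hasDerivAt_arcWeight_param (m : ℝ) {G : ℝ → ℝ} (hG : ContDiff ℝ (1 : ℕ) G) (φ s j : ℝ) :
    HasDerivAt (fun j => arcWeight m G (φ, s, j)) (arcWeight m (deriv G) (φ, s, j)) j := by
  refine hasDerivAt_intervalIntegral_of_contDiff
    (f := fun j φ => weight m G j (s * Real.cos φ)) ?_ _ _ j fun φ => ?_
  · have hG1 : ContDiff ℝ (1 : ℕ∞) G := hG.of_le (by norm_cast)
    exact (contDiff_weight m hG1).comp (f := fun z : ℝ × ℝ => (z.1, s * Real.cos z.2))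
      (by fun_prop)
  · exact hasDerivAt_weight_left m (hG.differentiable (by simp)) j _

/-- By `rootSlope_mul_exp` the slope disappears from the difference, and the integrand of `E - M` is
simply `S G(τ)`. -/
theorem weight_one_sub_weight_zero (G : ℝ → ℝ) (j S : ℝ) :
    weight 1 G j S - weight 0 G j S = S * G (j - rootExcess S / 2) := by
  have := rootSlope_mul_exp S
  simp only [weight, one_mul, zero_mul, Real.exp_zero, mul_one]
  linear_combination G (j - rootExcess S / 2) * this

/-- The derivatives of the arc integrals along the radius and the parameter are related by the
fundamental theorem of calculus. -/
theorem hasDerivAt_arcWeight_sub_radius {G : ℝ → ℝ} (hG : ContDiff ℝ (1 : ℕ) G) (φ s j : ℝ) :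
    HasDerivAt (fun s => arcWeight 1 G (φ, s, j) - arcWeight 0 G (φ, s, j))
      (G (j - rootExcess (s * Real.cos φ) / 2) * Real.sin φ
        - s / 2 * arcWeight 0 (deriv G) (φ, s, j)) s := by
  have hx := (contDiff_rootExcess (r := 1))
  have hsl := (contDiff_rootSlope (r := 0)).continuous
  have hxc := hx.continuous
  have hGc := hG.continuous
  have hG1 : ContDiff ℝ 1 G := by exact_mod_cast hG
  have hG' : Continuous (deriv G) := hG1.continuous_deriv le_rfl
  have hdG (t : ℝ) : HasDerivAt G (deriv G t) t := (hG.differentiable (by simp) t).hasDerivAt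
  have e (s : ℝ) : arcWeight 1 G (φ, s, j) - arcWeight 0 G (φ, s, j) =
      ∫ t in (0 : ℝ)..φ, s * Real.cos t * G (j - rootExcess (s * Real.cos t) / 2) := by
    simp only [arcWeight]
    rw [← intervalIntegral.integral_sub
      ((continuous_weight_cos 1 hGc s j).intervalIntegrable _ _)
      ((continuous_weight_cos 0 hGc s j).intervalIntegrable _ _)]
    simp_rw [weight_one_sub_weight_zero]
  simp_rw [e]
  have hτ (s t : ℝ) (c : ℝ) : HasDerivAt (fun s => G (j - rootExcess (s * c) / 2))
      (deriv G (j - rootExcess (s * c) / 2) * (-(rootSlope (s * c) * c / 2))) s :=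
    (hdG _).comp s ((((hasDerivAt_rootExcess (s * c)).comp s
      ((hasDerivAt_id s).mul_const c)).div_const 2).const_sub j |>.congr_deriv (by simp))
  have h1 := hasDerivAt_intervalIntegral_of_contDiff
    (f := fun s t => s * Real.cos t * G (j - rootExcess (s * Real.cos t) / 2))
    (f' := fun t => Real.cos t * G (j - rootExcess (s * Real.cos t) / 2)
      + s * Real.cos t * (deriv G (j - rootExcess (s * Real.cos t) / 2) *
        (-(rootSlope (s * Real.cos t) * Real.cos t / 2)))) (by
      have hx' : ContDiff ℝ 1 rootExcess := by exact_mod_cast hx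
      fun_prop) 0 φ s
    (fun t => (((hasDerivAt_id s).mul_const (Real.cos t)).mul
      (hτ s t (Real.cos t))).congr_deriv (by simp))
  refine h1.congr_deriv ?_
  -- By `sin ^ 2 + cos ^ 2 = 1`, the radial derivative of `S G(τ)` plus `s / 2` times the weight of
  -- `G'` is the exact derivative of `G(τ) sin t`.
  have h2 : ∀ t ∈ uIcc (0 : ℝ) φ, HasDerivAt
      (fun t => G (j - rootExcess (s * Real.cos t) / 2) * Real.sin t)
      (Real.cos t * G (j - rootExcess (s * Real.cos t) / 2)
      + s * Real.cos t * (deriv G (j - rootExcess (s * Real.cos t) / 2) *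
        (-(rootSlope (s * Real.cos t) * Real.cos t / 2)))
      + s / 2 * weight 0 (deriv G) j (s * Real.cos t)) t := by
    intro t _
    have h : HasDerivAt (fun t => G (j - rootExcess (s * Real.cos t) / 2) * Real.sin t) _ t :=
      ((hdG (j - rootExcess (s * Real.cos t) / 2)).comp t
      ((((hasDerivAt_rootExcess (s * Real.cos t)).comp t
      ((Real.hasDerivAt_cos t).const_mul s)).div_const 2).const_sub j)).mul (Real.hasDerivAt_sin t)
    refine h.congr_deriv ?_
    simp only [weight, Function.comp_apply, zero_mul, Real.exp_zero]
    change _ + G (j - rootExcess (s * Real.cos t) / 2) * Real.cos t = _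
    linear_combination (1 / 2 * s * deriv G (j - rootExcess (s * Real.cos t) / 2) *
      rootSlope (s * Real.cos t)) * Real.sin_sq_add_cos_sq t
  have h3 := intervalIntegral.integral_eq_sub_of_hasDerivAt h2 (Continuous.intervalIntegrable
    (by have := continuous_weight_cos 0 hG' s j; fun_prop) _ _)
  rw [intervalIntegral.integral_add (Continuous.intervalIntegrable (by fun_prop) _ _)
    (((continuous_weight_cos 0 hG' s j).const_mul (s / 2)).intervalIntegrable _ _),
    intervalIntegral.integral_const_mul] at h3
  simp only [Real.sin_zero, mul_zero, sub_zero] at h3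
  simp only [arcWeight]
  linarith

theorem hasDerivAt_circleWeight_sub_radius {G : ℝ → ℝ} (hG : ContDiff ℝ (1 : ℕ) G) (s j : ℝ) :
    HasDerivAt (fun s => circleWeight 1 G s j - circleWeight 0 G s j)
      (-(s / 2 * circleWeight 0 (deriv G) s j)) s := by
  have := hasDerivAt_arcWeight_sub_radius hG (2 * Real.pi) s j
  simpa [arcWeight_two_pi] using this

theorem hasDerivAt_circleAction_radius {G : ℝ → ℝ} (hG : Continuous G) (s j : ℝ) :
    HasDerivAt (fun s => circleAction G s j) (1 / 2 * (s * circleWeight 0 G s j)) s := by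
  have h0 : ContDiff ℝ (0 : ℕ∞) G := contDiff_zero.2 hG
  have hc : Continuous fun t => t * circleWeight 0 G t j :=
    continuous_id.mul ((contDiff_circleWeight 0 h0).continuous.comp
      (by fun_prop : Continuous fun t : ℝ => (t, j)))
  exact ((hc.integral_hasStrictDerivAt 0 s).hasDerivAt).const_mul (1 / 2)

/-- Under the integral sign, `(t / 2) ∂M/∂j` is the radial derivative of `M - E` by
`hasDerivAt_circleWeight_sub_radius`, and `M = E` at radius zero. -/
theorem hasDerivAt_circleAction_param {G : ℝ → ℝ} (hG : ContDiff ℝ (1 : ℕ) G) (s j : ℝ) :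
    HasDerivAt (fun j => circleAction G s j) (circleWeight 0 G s j - circleWeight 1 G s j) j := by
  have hG1 : ContDiff ℝ (1 : ℕ∞) G := hG.of_le (by norm_cast)
  have hG1' : ContDiff ℝ 1 G := by exact_mod_cast hG
  have hG' : ContDiff ℝ (0 : ℕ∞) (deriv G) := contDiff_zero.2 (hG1'.continuous_deriv le_rfl)
  have h1 := hasDerivAt_intervalIntegral_of_contDiff
    (f := fun j t => t * circleWeight 0 G t j)
    (f' := fun t => t * circleWeight 0 (deriv G) t j)
    (contDiff_snd.mul ((contDiff_circleWeight 0 hG1).comp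
      (f := fun z : ℝ × ℝ => (z.2, z.1)) (by fun_prop))) 0 s j
    (fun t => (hasDerivAt_circleWeight_param 0 hG t j).const_mul t)
  refine (h1.const_mul (1 / 2)).congr_deriv ?_
  have hc : Continuous fun t => circleWeight 0 (deriv G) t j :=
    (contDiff_circleWeight 0 hG').continuous.comp (by fun_prop : Continuous fun t : ℝ => (t, j))
  have h2 := intervalIntegral.integral_eq_sub_of_hasDerivAt (a := 0) (b := s)
    (fun t _ => hasDerivAt_circleWeight_sub_radius hG t j)
    (Continuous.intervalIntegrable (by fun_prop) _ _)
  simp only [circleWeight_zero] at h2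
  rw [intervalIntegral.integral_neg] at h2
  have e : ∀ t, t / 2 * circleWeight 0 (deriv G) t j =
      1 / 2 * (t * circleWeight 0 (deriv G) t j) := fun t => by ring
  simp_rw [e] at h2
  rw [intervalIntegral.integral_const_mul] at h2
  linarith

theorem circleAction_strictMonoOn {G : ℝ → ℝ} (hG : Continuous G) (hpos : ∀ t, 0 < G t) (j : ℝ) :
    StrictMonoOn (fun s => circleAction G s j) (Ici 0) := by
  refine strictMonoOn_of_deriv_pos (convex_Ici 0)
    (fun s _ => (hasDerivAt_circleAction_radius hG s j).continuousAt.continuousWithinAt) ?_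
  intro s hs
  rw [interior_Ici] at hs
  rw [(hasDerivAt_circleAction_radius hG s j).deriv]
  have h1 := circleWeight_pos 0 (contDiff_zero.2 hG) hpos s j
  have h2 : 0 < s := hs
  positivity

theorem arcWeight_strictMono (m : ℝ) {G : ℝ → ℝ} (hG : Continuous G) (hpos : ∀ t, 0 < G t)
    (s j : ℝ) : StrictMono fun φ => arcWeight m G (φ, s, j) := by
  refine strictMono_of_deriv_pos fun φ => ?_
  rw [(hasDerivAt_arcWeight_angle m hG φ s j).deriv]
  exact weight_pos m hpos _ _

theorem arcWeight_add_int_mul_two_pi (m : ℝ) {G : ℝ → ℝ} (hG : Continuous G) (φ s j : ℝ) (k : ℤ) :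
    arcWeight m G (φ + k * (2 * Real.pi), s, j) =
      arcWeight m G (φ, s, j) + k * circleWeight m G s j := by
  have hper : Function.Periodic (fun φ => weight m G j (s * Real.cos φ)) (2 * Real.pi) :=
    fun φ => by simp only [Real.cos_add_two_pi]
  have hi (a b : ℝ) := (continuous_weight_cos m hG s j).intervalIntegrable
    (μ := MeasureTheory.volume) a b
  simp only [arcWeight, circleWeight]
  rw [← intervalIntegral.integral_add_adjacent_intervals (hi 0 φ) (hi φ _)]
  have := hper.intervalIntegral_add_zsmul_eq k φ (fun _ _ => hi _ _)
  simp only [zsmul_eq_mul] at this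
  rw [this]
  congr 2
  simpa using hper.intervalIntegral_add_eq φ 0

theorem arcWeight_surjective (m : ℝ) {G : ℝ → ℝ} (hG : Continuous G) (hpos : ∀ t, 0 < G t)
    (s j : ℝ) : Function.Surjective fun φ => arcWeight m G (φ, s, j) := by
  intro y
  have hM := circleWeight_pos m (contDiff_zero.2 hG) hpos s j
  obtain ⟨k, hk⟩ := exists_nat_ge (|y| / circleWeight m G s j)
  rw [div_le_iff₀ hM] at hk
  have e (k : ℤ) := arcWeight_add_int_mul_two_pi m hG 0 s j k
  have e0 : arcWeight m G (0, s, j) = 0 := by simp [arcWeight]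
  simp only [zero_add, e0] at e
  have hc : Continuous fun φ => arcWeight m G (φ, s, j) :=
    continuous_iff_continuousAt.2 fun φ => (hasDerivAt_arcWeight_angle m hG φ s j).continuousAt
  refine mem_range_of_exists_le_of_exists_ge hc ⟨(-k : ℤ) * (2 * Real.pi), ?_⟩
    ⟨(k : ℤ) * (2 * Real.pi), ?_⟩
  · rw [e]; push_cast; linarith [neg_abs_le y]
  · rw [e]; push_cast; linarith [le_abs_self y]

end AngleAction

/-! ### The thermostat area form in angle and action variables. -/

section AreaForm

theorem clm_triple_apply (L : ℝ × ℝ × ℝ →L[ℝ] ℝ) (a : ℝ × ℝ × ℝ) :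
    L a = a.1 * L (1, 0, 0) + a.2.1 * L (0, 1, 0) + a.2.2 * L (0, 0, 1) := by
  have : a = a.1 • ((1, 0, 0) : ℝ × ℝ × ℝ) + a.2.1 • ((0, 1, 0) : ℝ × ℝ × ℝ)
      + a.2.2 • ((0, 0, 1) : ℝ × ℝ × ℝ) := by
    ext <;> simp
  conv_lhs => rw [this]
  simp only [map_add, map_smul, smul_eq_mul]

theorem fderiv_triple_first {f : ℝ × ℝ × ℝ → ℝ} {φ s j d : ℝ}
    (hf : DifferentiableAt ℝ f (φ, s, j)) (h : HasDerivAt (fun φ => f (φ, s, j)) d φ) :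
    fderiv ℝ f (φ, s, j) (1, 0, 0) = d := by
  have hc : HasDerivAt (fun φ : ℝ => ((φ, s, j) : ℝ × ℝ × ℝ)) (1, 0, 0) φ :=
    (hasDerivAt_id φ).prodMk (hasDerivAt_const φ ((s, j) : ℝ × ℝ))
  exact (hf.hasFDerivAt.comp_hasDerivAt φ hc).unique h

theorem fderiv_triple_second {f : ℝ × ℝ × ℝ → ℝ} {φ s j d : ℝ}
    (hf : DifferentiableAt ℝ f (φ, s, j)) (h : HasDerivAt (fun s => f (φ, s, j)) d s) :
    fderiv ℝ f (φ, s, j) (0, 1, 0) = d := by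
  have hc : HasDerivAt (fun s : ℝ => ((φ, s, j) : ℝ × ℝ × ℝ)) (0, 1, 0) s :=
    (hasDerivAt_const s φ).prodMk ((hasDerivAt_id s).prodMk (hasDerivAt_const s j))
  exact (hf.hasFDerivAt.comp_hasDerivAt s hc).unique h

theorem fderiv_triple_third {f : ℝ × ℝ × ℝ → ℝ} {φ s j d : ℝ}
    (hf : DifferentiableAt ℝ f (φ, s, j)) (h : HasDerivAt (fun j => f (φ, s, j)) d j) :
    fderiv ℝ f (φ, s, j) (0, 0, 1) = d := by
  have hc : HasDerivAt (fun j : ℝ => ((φ, s, j) : ℝ × ℝ × ℝ)) (0, 0, 1) j :=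
    (hasDerivAt_const j φ).prodMk ((hasDerivAt_const j s).prodMk (hasDerivAt_id j))
  exact (hf.hasFDerivAt.comp_hasDerivAt j hc).unique h

/-- Logarithm (up to a constant) of the thermostat variable at `(φ, s, j)`. -/
noncomputable def logPosition (p : ℝ × ℝ × ℝ) : ℝ := p.2.2 - rootExcess (p.2.1 * Real.cos p.1) / 2

/-- The thermostat variable at `(φ, s, j)`. -/
noncomputable def thermostatPosition (ℓ : ℝ) (p : ℝ × ℝ × ℝ) : ℝ := Real.exp (logPosition p - ℓ)

/-- The momentum of the thermostat at `(φ, s, j)`, up to a constant factor. -/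
noncomputable def thermostatMomentum (ℓ : ℝ) (G : ℝ → ℝ) (p : ℝ × ℝ × ℝ) : ℝ :=
  p.2.1 * Real.sin p.1 * G (logPosition p) / thermostatPosition ℓ p

/-- The angle (of period `1`) at `(φ, s, j)`. -/
noncomputable def thermostatAngle (G : ℝ → ℝ) (p : ℝ × ℝ × ℝ) : ℝ :=
  arcWeight 0 G p / circleWeight 0 G p.2.1 p.2.2

/-- The periodic correction of the other angles at `(φ, s, j)`. -/
noncomputable def angleShift (G : ℝ → ℝ) (p : ℝ × ℝ × ℝ) : ℝ :=
  arcWeight 1 G p - thermostatAngle G p * circleWeight 1 G p.2.1 p.2.2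

/-- The action at `(φ, s, j)`, up to a constant factor. -/
noncomputable def thermostatAction (G : ℝ → ℝ) (p : ℝ × ℝ × ℝ) : ℝ := circleAction G p.2.1 p.2.2

variable {G : ℝ → ℝ} {r : ℕ∞}

theorem contDiff_logPosition : ContDiff ℝ r logPosition := by
  have := contDiff_rootExcess (r := r)
  unfold logPosition
  fun_prop

theorem contDiff_thermostatPosition (ℓ : ℝ) : ContDiff ℝ r (thermostatPosition ℓ) :=
  (contDiff_logPosition.sub contDiff_const).exp

theorem contDiff_thermostatMomentum (ℓ : ℝ) (hG : ContDiff ℝ r G) :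
    ContDiff ℝ r (thermostatMomentum ℓ G) := by
  refine ContDiff.div ?_ (contDiff_thermostatPosition ℓ) fun p => (Real.exp_pos _).ne'
  refine ContDiff.mul (by fun_prop) (hG.comp contDiff_logPosition)

theorem contDiff_circleWeight_triple (m : ℝ) (hG : ContDiff ℝ r G) :
    ContDiff ℝ r fun p : ℝ × ℝ × ℝ => circleWeight m G p.2.1 p.2.2 :=
  (contDiff_circleWeight m hG).comp (f := fun p : ℝ × ℝ × ℝ => p.2) contDiff_snd

theorem contDiff_thermostatAngle (hG : ContDiff ℝ r G) (hpos : ∀ t, 0 < G t) :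
    ContDiff ℝ r (thermostatAngle G) :=
  (contDiff_arcWeight 0 hG).div (contDiff_circleWeight_triple 0 hG) fun p =>
    (circleWeight_pos 0 (contDiff_zero.2 hG.continuous) hpos p.2.1 p.2.2).ne'

theorem contDiff_angleShift (hG : ContDiff ℝ r G) (hpos : ∀ t, 0 < G t) :
    ContDiff ℝ r (angleShift G) :=
  (contDiff_arcWeight 1 hG).sub ((contDiff_thermostatAngle hG hpos).mul
    (contDiff_circleWeight_triple 1 hG))

theorem contDiff_thermostatAction (hG : ContDiff ℝ r G) : ContDiff ℝ r (thermostatAction G) :=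
  (contDiff_circleAction hG).comp (f := fun p : ℝ × ℝ × ℝ => p.2) contDiff_snd

/-- The differential of the action. -/
theorem fderiv_thermostatAction (hG : ContDiff ℝ (1 : ℕ∞) G) (p a : ℝ × ℝ × ℝ) :
    fderiv ℝ (thermostatAction G) p a =
      1 / 2 * (p.2.1 * circleWeight 0 G p.2.1 p.2.2) * a.2.1
        + (circleWeight 0 G p.2.1 p.2.2 - circleWeight 1 G p.2.1 p.2.2) * a.2.2 := by
  obtain ⟨φ, s, j⟩ := p
  have hA : DifferentiableAt ℝ (thermostatAction G) (φ, s, j) :=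
    (contDiff_thermostatAction hG).differentiable (by simp) _
  rw [clm_triple_apply, fderiv_triple_first hA (hasDerivAt_const φ (circleAction G s j)),
    fderiv_triple_second hA (hasDerivAt_circleAction_radius hG.continuous s j),
    fderiv_triple_third hA (hasDerivAt_circleAction_param hG s j)]
  ring

/-- The angular derivative of the angle is positive. -/
theorem fderiv_thermostatAngle_angular (hG : ContDiff ℝ (1 : ℕ∞) G) (hpos : ∀ t, 0 < G t)
    (p : ℝ × ℝ × ℝ) : 0 < fderiv ℝ (thermostatAngle G) p (1, 0, 0) := by
  obtain ⟨φ, s, j⟩ := p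
  have hA : DifferentiableAt ℝ (thermostatAngle G) (φ, s, j) :=
    (contDiff_thermostatAngle hG hpos).differentiable (by simp) _
  rw [fderiv_triple_first hA ((hasDerivAt_arcWeight_angle 0 hG.continuous φ s j).div_const
    (circleWeight 0 G s j))]
  exact div_pos (weight_pos 0 hpos _ _)
    (circleWeight_pos 0 (contDiff_zero.2 hG.continuous) hpos _ _)

/-- The area form in terms of the angle, the action and the shift. -/
theorem thermostat_areaForm (hG : ContDiff ℝ (1 : ℕ∞) G) (hpos : ∀ t, 0 < G t) (ℓ : ℝ)
    (p a b : ℝ × ℝ × ℝ) :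
    fderiv ℝ (thermostatPosition ℓ) p a * fderiv ℝ (thermostatMomentum ℓ G) p b
      - fderiv ℝ (thermostatMomentum ℓ G) p a * fderiv ℝ (thermostatPosition ℓ) p b =
    fderiv ℝ (thermostatAngle G) p a * fderiv ℝ (thermostatAction G) p b
      - fderiv ℝ (thermostatAction G) p a * fderiv ℝ (thermostatAngle G) p b
      - (fderiv ℝ (angleShift G) p a * b.2.2 - a.2.2 * fderiv ℝ (angleShift G) p b) := by
  obtain ⟨φ, s, j⟩ := p
  have hGc := hG.continuous
  have one : ((1 : ℕ∞) : WithTop ℕ∞) ≠ 0 := by simp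
  have hM0 : circleWeight 0 G s j ≠ 0 := (circleWeight_pos 0 (contDiff_zero.2 hGc) hpos s j).ne'
  have hL0 := (contDiff_arcWeight 0 hG).differentiable one (φ, s, j)
  have hL1 := (contDiff_arcWeight 1 hG).differentiable one (φ, s, j)
  have hM := (contDiff_circleWeight_triple 0 hG).differentiable one (φ, s, j)
  have hE := (contDiff_circleWeight_triple 1 hG).differentiable one (φ, s, j)
  have hθ := (contDiff_thermostatAngle hG hpos).differentiable one (φ, s, j)
  have hτ := (contDiff_logPosition (r := 1)).differentiable one (φ, s, j)
  have hm := (contDiff_thermostatMomentum ℓ hG).differentiable one (φ, s, j)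
  have hp := (contDiff_thermostatPosition (r := 1) ℓ).differentiable one (φ, s, j)
  -- the angle
  have eθ (v : ℝ × ℝ × ℝ) : fderiv ℝ (arcWeight 0 G) (φ, s, j) v =
      thermostatAngle G (φ, s, j) *
        fderiv ℝ (fun p : ℝ × ℝ × ℝ => circleWeight 0 G p.2.1 p.2.2) (φ, s, j) v
      + circleWeight 0 G s j * fderiv ℝ (thermostatAngle G) (φ, s, j) v := by
    have h1 := hθ.hasFDerivAt.mul hM.hasFDerivAt
    have h2 : (thermostatAngle G * fun p : ℝ × ℝ × ℝ => circleWeight 0 G p.2.1 p.2.2) =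
        arcWeight 0 G := by
      funext p
      exact div_mul_cancel₀ _ (circleWeight_pos 0 (contDiff_zero.2 hGc) hpos p.2.1 p.2.2).ne'
    rw [h2] at h1
    rw [h1.fderiv]
    simp
  have eξ (v : ℝ × ℝ × ℝ) : fderiv ℝ (angleShift G) (φ, s, j) v =
      fderiv ℝ (arcWeight 1 G) (φ, s, j) v - (thermostatAngle G (φ, s, j) *
        fderiv ℝ (fun p : ℝ × ℝ × ℝ => circleWeight 1 G p.2.1 p.2.2) (φ, s, j) v
      + circleWeight 1 G s j * fderiv ℝ (thermostatAngle G) (φ, s, j) v) := by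
    have h1 : HasFDerivAt (angleShift G) _ (φ, s, j) :=
      hL1.hasFDerivAt.sub (hθ.hasFDerivAt.mul hE.hasFDerivAt)
    rw [h1.fderiv]
    simp
  -- position and momentum
  have ep (v : ℝ × ℝ × ℝ) : fderiv ℝ (thermostatPosition ℓ) (φ, s, j) v =
      thermostatPosition ℓ (φ, s, j) * fderiv ℝ logPosition (φ, s, j) v := by
    have h1 : HasFDerivAt (thermostatPosition ℓ) _ (φ, s, j) :=
      (hτ.hasFDerivAt.sub_const ℓ).exp
    rw [h1.fderiv]
    simp [thermostatPosition]
  have hGτ := ((hG.differentiable one (logPosition (φ, s, j))).hasDerivAt.comp_hasFDerivAt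
    (φ, s, j) hτ.hasFDerivAt)
  have hY1 : HasFDerivAt (fun p : ℝ × ℝ × ℝ => p.2.1 * Real.sin p.1) _ (φ, s, j) :=
    (hasFDerivAt_snd.fst).mul (hasFDerivAt_fst.sin)
  -- Position times momentum is `s sin φ G(τ)`; differentiating this product avoids the quotient in
  -- `thermostatMomentum`.
  have em (v : ℝ × ℝ × ℝ) : thermostatPosition ℓ (φ, s, j) *
      fderiv ℝ (thermostatMomentum ℓ G) (φ, s, j) v + thermostatMomentum ℓ G (φ, s, j) *
        fderiv ℝ (thermostatPosition ℓ) (φ, s, j) v =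
      G (logPosition (φ, s, j)) * (Real.sin φ * v.2.1 + s * Real.cos φ * v.1)
      + s * Real.sin φ * (deriv G (logPosition (φ, s, j)) *
        fderiv ℝ logPosition (φ, s, j) v) := by
    have h1 := hm.hasFDerivAt.mul hp.hasFDerivAt
    have h2 : (thermostatMomentum ℓ G * thermostatPosition ℓ) =
        (fun p : ℝ × ℝ × ℝ => p.2.1 * Real.sin p.1) * (G ∘ logPosition) := by
      funext p
      exact div_mul_cancel₀ _ (Real.exp_pos _).ne'
    rw [h2] at h1
    have h3 := congrArg (fun L => L v) (h1.unique (hY1.mul hGτ))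
    simp at h3
    linarith
  have eτ (v : ℝ × ℝ × ℝ) : fderiv ℝ logPosition (φ, s, j) v =
      v.2.2 - rootSlope (s * Real.cos φ) / 2 * (Real.cos φ * v.2.1 - s * Real.sin φ * v.1) := by
    have h1 : HasFDerivAt (fun p : ℝ × ℝ × ℝ => p.2.1 * Real.cos p.1) _ (φ, s, j) :=
      (hasFDerivAt_snd.fst).mul (hasFDerivAt_fst.cos)
    have h2 : HasFDerivAt logPosition _ (φ, s, j) := (hasFDerivAt_snd.snd).sub
      (((hasDerivAt_rootExcess (s * Real.cos φ)).comp_hasFDerivAt (φ, s, j) h1).mul_const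
        (1 / 2 : ℝ)) |>.congr_of_eventuallyEq (Eventually.of_forall fun p => by
          simp only [logPosition, Pi.sub_apply, Function.comp_apply]; ring)
    rw [h2.fderiv]
    simp
    ring
  -- partial derivatives
  have p1 := fderiv_triple_first hL0 (hasDerivAt_arcWeight_angle 0 hGc φ s j)
  have p2 := fderiv_triple_first hL1 (hasDerivAt_arcWeight_angle 1 hGc φ s j)
  have p3 := fderiv_triple_first hM (hasDerivAt_const φ (circleWeight 0 G s j))
  have p4 := fderiv_triple_first hE (hasDerivAt_const φ (circleWeight 1 G s j))
  have p5 : fderiv ℝ (arcWeight 1 G) (φ, s, j) (0, 1, 0) - fderiv ℝ (arcWeight 0 G) (φ, s, j)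
      (0, 1, 0) = G (logPosition (φ, s, j)) * Real.sin φ
        - s / 2 * fderiv ℝ (arcWeight 0 G) (φ, s, j) (0, 0, 1) := by
    have h1 := fderiv_triple_second (hL1.sub hL0) (hasDerivAt_arcWeight_sub_radius hG φ s j)
    rw [fderiv_sub hL1 hL0, ← fderiv_triple_third hL0 (hasDerivAt_arcWeight_param 0 hG φ s j)] at h1
    exact h1
  have p6 : fderiv ℝ (fun p : ℝ × ℝ × ℝ => circleWeight 1 G p.2.1 p.2.2) (φ, s, j) (0, 1, 0)
      - fderiv ℝ (fun p : ℝ × ℝ × ℝ => circleWeight 0 G p.2.1 p.2.2) (φ, s, j) (0, 1, 0) =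
        -(s / 2 * fderiv ℝ (fun p : ℝ × ℝ × ℝ => circleWeight 0 G p.2.1 p.2.2) (φ, s, j)
          (0, 0, 1)) := by
    have h1 := fderiv_triple_second (hE.sub hM) (hasDerivAt_circleWeight_sub_radius hG s j)
    rw [fderiv_sub hE hM, ← fderiv_triple_third hM (hasDerivAt_circleWeight_param 0 hG s j)] at h1
    exact h1
  have p7 := weight_one_sub_weight_zero G j (s * Real.cos φ)
  have p8 : weight 0 G j (s * Real.cos φ) = G (logPosition (φ, s, j)) *
      rootSlope (s * Real.cos φ) := by simp [weight, logPosition]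
  change _ = _ * G (logPosition (φ, s, j)) at p7
  -- left side
  have hP : thermostatPosition ℓ (φ, s, j) ≠ 0 := (Real.exp_pos _).ne'
  -- The form equals `dτ ∧ d(s sin φ G(τ))`, in which the `G'(τ)` terms drop out because `dτ ∧ dτ =
  -- 0`.
  have lhs : fderiv ℝ (thermostatPosition ℓ) (φ, s, j) a *
        fderiv ℝ (thermostatMomentum ℓ G) (φ, s, j) b
      - fderiv ℝ (thermostatMomentum ℓ G) (φ, s, j) a *
        fderiv ℝ (thermostatPosition ℓ) (φ, s, j) b =
      G (logPosition (φ, s, j)) * (fderiv ℝ logPosition (φ, s, j) a *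
        (Real.sin φ * b.2.1 + s * Real.cos φ * b.1) - fderiv ℝ logPosition (φ, s, j) b *
        (Real.sin φ * a.2.1 + s * Real.cos φ * a.1)) := by
    have ea := em a
    have eb := em b
    rw [ep a] at ea ⊢
    rw [ep b] at eb ⊢
    linear_combination fderiv ℝ logPosition (φ, s, j) a * eb
      - fderiv ℝ logPosition (φ, s, j) b * ea
  have θa := eθ a
  have θb := eθ b
  rw [lhs, fderiv_thermostatAction hG, fderiv_thermostatAction hG, eξ, eξ, eτ, eτ]
  rw [clm_triple_apply (fderiv ℝ (arcWeight 0 G) _) a,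
    clm_triple_apply (fderiv ℝ (fun p : ℝ × ℝ × ℝ => circleWeight 0 G p.2.1 p.2.2) _) a] at θa
  rw [clm_triple_apply (fderiv ℝ (arcWeight 0 G) _) b,
    clm_triple_apply (fderiv ℝ (fun p : ℝ × ℝ × ℝ => circleWeight 0 G p.2.1 p.2.2) _) b] at θb
  rw [clm_triple_apply (fderiv ℝ (arcWeight 1 G) _) a,
    clm_triple_apply (fderiv ℝ (fun p : ℝ × ℝ × ℝ => circleWeight 1 G p.2.1 p.2.2) _) a,
    clm_triple_apply (fderiv ℝ (arcWeight 1 G) _) b,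
    clm_triple_apply (fderiv ℝ (fun p : ℝ × ℝ × ℝ => circleWeight 1 G p.2.1 p.2.2) _) b, p2, p4]
  rw [p1, p3] at θa θb
  have sc := Real.sin_sq_add_cos_sq φ
  generalize fderiv ℝ (fun p : ℝ × ℝ × ℝ => circleWeight 0 G p.2.1 p.2.2) (φ, s, j) (0, 1, 0) = Ms at *
  generalize fderiv ℝ (fun p : ℝ × ℝ × ℝ => circleWeight 0 G p.2.1 p.2.2) (φ, s, j) (0, 0, 1) = Mj at *
  generalize fderiv ℝ (fun p : ℝ × ℝ × ℝ => circleWeight 1 G p.2.1 p.2.2) (φ, s, j) (0, 1, 0) = Es at *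
  generalize fderiv ℝ (fun p : ℝ × ℝ × ℝ => circleWeight 1 G p.2.1 p.2.2) (φ, s, j) (0, 0, 1) = Ej at *
  generalize fderiv ℝ (arcWeight 0 G) (φ, s, j) (0, 1, 0) = L0s at *
  generalize fderiv ℝ (arcWeight 0 G) (φ, s, j) (0, 0, 1) = L0j at *
  generalize fderiv ℝ (arcWeight 1 G) (φ, s, j) (0, 1, 0) = L1s at *
  generalize fderiv ℝ (arcWeight 1 G) (φ, s, j) (0, 0, 1) = L1j at *
  generalize fderiv ℝ (thermostatAngle G) (φ, s, j) a = ta at *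
  generalize fderiv ℝ (thermostatAngle G) (φ, s, j) b = tb at *
  generalize thermostatAngle G (φ, s, j) = θ at *
  generalize weight 0 G j (s * Real.cos φ) = w0 at *
  generalize weight 1 G j (s * Real.cos φ) = w1 at *
  generalize circleWeight 0 G s j = M at *
  generalize circleWeight 1 G s j = E at *
  generalize G (logPosition (φ, s, j)) = g at *
  generalize rootSlope (s * Real.cos φ) = x at *
  generalize Real.sin φ = S at *
  generalize Real.cos φ = C at *
  obtain ⟨a1, a2, a3⟩ := a
  obtain ⟨b1, b2, b3⟩ := b
  simp only at *
  -- `θa` and `θb` exchange the differential of the angle for those of the arc integrals. After that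
  -- `p8` and `sc` match the coefficients of `dφ ∧ ds`, `p7` those of `dφ ∧ dj`, and `p5`, `p6`
  -- those of `ds ∧ dj`.
  linear_combination (s / 2 * b2 + b3) * θa - (s / 2 * a2 + a3) * θb
    + (a2 * b3 - a3 * b2) * p5 - θ * (a2 * b3 - a3 * b2) * p6 + (a1 * b3 - a3 * b1) * p7
    - s / 2 * (a1 * b2 - a2 * b1) * p8 + g * x * s / 2 * (a1 * b2 - a2 * b1) * sc

end AreaForm

/-! ### A global inverse on an open set. -/

section InverseFunction

/-- An injective differential in finite dimension is invertible, so local inverses exist. Near `f x`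
a local inverse takes values in `B`, hence by injectivity of `f` agrees with the set-theoretic
inverse, which inherits its smoothness. -/
theorem exists_contDiffOn_inverse {E : Type*} [NormedAddCommGroup E] [NormedSpace ℝ E]
    [FiniteDimensional ℝ E] {r : ℕ∞} (hr : 1 ≤ r) {f : E → E} {B : Set E} (hB : IsOpen B)
    (hf : ContDiffOn ℝ r f B) (hinj : InjOn f B)
    (hd : ∀ x ∈ B, Function.Injective (fderiv ℝ f x)) :
    IsOpen (f '' B) ∧ ∃ g : E → E, ContDiffOn ℝ r g (f '' B) ∧ ∀ x ∈ B, g (f x) = x := by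
  have hr0 : ((r : ℕ∞) : WithTop ℕ∞) ≠ 0 := by
    intro h
    have h' : r = 0 := by exact_mod_cast h
    simp [h'] at hr
  have : CompleteSpace E := FiniteDimensional.complete ℝ E
  have equiv : ∀ x ∈ B, ∃ e : E ≃L[ℝ] E, HasFDerivAt f (e : E →L[ℝ] E) x := by
    intro x hx
    let e := (LinearEquiv.ofInjectiveEndo (fderiv ℝ f x : E →ₗ[ℝ] E) (hd x hx)).toContinuousLinearEquiv
    refine ⟨e, ?_⟩
    have he : (e : E →L[ℝ] E) = fderiv ℝ f x := by ext v; rfl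
    rw [he]
    exact ((hf.contDiffAt (hB.mem_nhds hx)).differentiableAt hr0).hasFDerivAt
  have loc : ∀ x ∈ B, ∃ g : E → E, ContDiffAt ℝ r g (f x) ∧ g (f x) = x ∧
      ∀ᶠ y in 𝓝 (f x), f (g y) = y := by
    intro x hx
    obtain ⟨e, he⟩ := equiv x hx
    have hc := hf.contDiffAt (hB.mem_nhds hx)
    refine ⟨hc.localInverse he hr0, hc.to_localInverse he hr0, ?_, ?_⟩
    · exact (hc.hasStrictFDerivAt' he hr0).localInverse_apply_image
    · exact (hc.hasStrictFDerivAt' he hr0).eventually_right_inverse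
  have hnhds : ∀ x ∈ B, ∀ g : E → E, ContDiffAt ℝ r g (f x) → g (f x) = x →
      (∀ᶠ y in 𝓝 (f x), f (g y) = y) → ∀ᶠ y in 𝓝 (f x), g y ∈ B ∧ f (g y) = y := by
    intro x hx g hg hgx hfg
    have : ∀ᶠ y in 𝓝 (f x), g y ∈ B :=
      hg.continuousAt.eventually_mem (by rw [hgx]; exact hB.mem_nhds hx)
    exact this.and hfg
  have hinv : ∀ x ∈ B, Function.invFunOn f B (f x) = x := fun x hx =>
    hinj (Function.invFunOn_mem ⟨x, hx, rfl⟩) hx (Function.invFunOn_eq ⟨x, hx, rfl⟩)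
  refine ⟨?_, Function.invFunOn f B, ?_, hinv⟩
  · rw [isOpen_iff_mem_nhds]
    rintro _ ⟨x, hx, rfl⟩
    obtain ⟨g, hg, hgx, hfg⟩ := loc x hx
    filter_upwards [hnhds x hx g hg hgx hfg] with y hy
    exact ⟨g y, hy.1, hy.2⟩
  · rintro _ ⟨x, hx, rfl⟩
    obtain ⟨g, hg, hgx, hfg⟩ := loc x hx
    refine (hg.congr_of_eventuallyEq ?_).contDiffWithinAt
    filter_upwards [hnhds x hx g hg hgx hfg] with y hy
    conv_lhs => rw [← hy.2]
    exact hinv _ hy.1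

end InverseFunction

/-! ### The logarithm of the norm of a covector and its gradient. -/

section LogNorm

variable {n : ℕ} (m : Matrix (Fin n) (Fin n) ℝ)

/-- The quadratic form of a matrix. -/
noncomputable def quad (W : Fin n → ℝ) : ℝ := W ⬝ᵥ m.mulVec W

/-- The logarithm of the norm. -/
noncomputable def logNorm (W : Fin n → ℝ) : ℝ := 1 / 2 * Real.log (quad m W)

/-- The gradient of the logarithm of the norm. -/
noncomputable def logGrad (W : Fin n → ℝ) : Fin n → ℝ := (quad m W)⁻¹ • m.mulVec W

variable {m}

theorem quad_pos (hm : m.PosDef) {W : Fin n → ℝ} (hW : W ≠ 0) : 0 < quad m W := by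
  simpa [quad] using hm.dotProduct_mulVec_pos hW

theorem contDiff_mulVec (m : Matrix (Fin n) (Fin n) ℝ) {r : ℕ∞} :
    ContDiff ℝ r fun W : Fin n → ℝ => m.mulVec W :=
  m.mulVecLin.toContinuousLinearMap.contDiff

theorem contDiff_quad (m : Matrix (Fin n) (Fin n) ℝ) {r : ℕ∞} : ContDiff ℝ r (quad m) := by
  have h : ∀ i, ContDiff ℝ r fun W : Fin n → ℝ => m.mulVec W i :=
    contDiff_pi.1 (contDiff_mulVec m)
  unfold quad dotProduct
  fun_prop

theorem hasFDerivAt_mulVec (m : Matrix (Fin n) (Fin n) ℝ) (W : Fin n → ℝ) :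
    HasFDerivAt (fun W : Fin n → ℝ => m.mulVec W) m.mulVecLin.toContinuousLinearMap W :=
  m.mulVecLin.toContinuousLinearMap.hasFDerivAt

theorem dotProduct_mulVec_comm (hm : m.PosDef) (U W : Fin n → ℝ) :
    U ⬝ᵥ m.mulVec W = m.mulVec U ⬝ᵥ W := by
  have hs : m.transpose = m := by simpa using hm.isHermitian.eq
  rw [Matrix.dotProduct_mulVec, ← Matrix.mulVec_transpose, hs]

theorem fderiv_quad (hm : m.PosDef) (W U : Fin n → ℝ) :
    fderiv ℝ (quad m) W U = 2 * (m.mulVec W ⬝ᵥ U) := by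
  have hl : HasDerivAt (fun t : ℝ => W + t • U) U 0 := by
    simpa using ((hasDerivAt_id (0 : ℝ)).smul_const U).const_add W
  have hq : HasFDerivAt (quad m) (fderiv ℝ (quad m) W) (W + (0 : ℝ) • U) := by
    simpa using ((contDiff_quad m (r := 1)).differentiable (by simp) W).hasFDerivAt
  have h1 := hq.comp_hasDerivAt (0 : ℝ) hl
  have e : quad m ∘ (fun t : ℝ => W + t • U) = fun t =>
      quad m W + t * (2 * (m.mulVec W ⬝ᵥ U)) + t ^ 2 * quad m U := by
    funext t
    simp only [Function.comp, quad, Matrix.mulVec_add, Matrix.mulVec_smul, add_dotProduct,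
      dotProduct_add, smul_dotProduct, dotProduct_smul, smul_eq_mul]
    rw [dotProduct_mulVec_comm hm W U, dotProduct_comm U (m.mulVec W)]
    ring
  rw [e] at h1
  have h2 : HasDerivAt (fun t : ℝ => quad m W + t * (2 * (m.mulVec W ⬝ᵥ U)) + t ^ 2 * quad m U)
      (2 * (m.mulVec W ⬝ᵥ U)) 0 := by
    refine ((((hasDerivAt_id (0 : ℝ)).mul_const _).const_add _).add
      ((hasDerivAt_pow 2 (0 : ℝ)).mul_const _)).congr_deriv ?_
    simp
  exact h1.unique h2

theorem contDiffAt_logNorm (hm : m.PosDef) {r : ℕ∞} {W : Fin n → ℝ} (hW : W ≠ 0) :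
    ContDiffAt ℝ r (logNorm m) W :=
  contDiffAt_const.mul ((contDiff_quad m).contDiffAt.log (quad_pos hm hW).ne')

theorem contDiffAt_logGrad (hm : m.PosDef) {r : ℕ∞} {W : Fin n → ℝ} (hW : W ≠ 0) :
    ContDiffAt ℝ r (logGrad m) W :=
  ((contDiff_quad m).contDiffAt.inv (quad_pos hm hW).ne').smul (contDiff_mulVec m).contDiffAt

theorem fderiv_logNorm (hm : m.PosDef) {W : Fin n → ℝ} (hW : W ≠ 0) (U : Fin n → ℝ) :
    fderiv ℝ (logNorm m) W U = logGrad m W ⬝ᵥ U := by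
  have hq := ((contDiff_quad m (r := 1)).differentiable (by simp) W).hasFDerivAt
  have h : HasFDerivAt (logNorm m) _ W := (hq.log (quad_pos hm hW).ne').const_mul (1 / 2)
  rw [h.fderiv]
  simp [fderiv_quad hm, logGrad]
  ring

theorem fderiv_logGrad (hm : m.PosDef) {W : Fin n → ℝ} (hW : W ≠ 0) (U : Fin n → ℝ) :
    fderiv ℝ (logGrad m) W U =
      (quad m W)⁻¹ • m.mulVec U - (2 * (logGrad m W ⬝ᵥ U)) • logGrad m W := by
  have hq := ((contDiff_quad m (r := 1)).differentiable (by simp) W).hasFDerivAt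
  have h0 := (quad_pos hm hW).ne'
  have h : HasFDerivAt (logGrad m) _ W :=
    ((hasDerivAt_inv h0).comp_hasFDerivAt W hq).smul (hasFDerivAt_mulVec m W)
  rw [h.fderiv]
  ext i
  simp [fderiv_quad hm, logGrad]
  field_simp
  ring

theorem dotProduct_logGrad (hm : m.PosDef) {W : Fin n → ℝ} (hW : W ≠ 0) :
    logGrad m W ⬝ᵥ W = 1 := by
  rw [logGrad, smul_dotProduct, dotProduct_comm, smul_eq_mul]
  exact inv_mul_cancel₀ (quad_pos hm hW).ne'

end LogNorm

/-! ### Phase points and angle-action variables as functions of `((φ, w), (s, W))`. -/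

section PhaseChart

/-- The domain `s > 0`, `W ≠ 0` of the coordinates `((φ, w), (s, W))`. -/
def chartDomain (n : ℕ) : Set (Phase n) := {b | 0 < b.2 0 ∧ Fin.tail b.2 ≠ 0}

/-- `Fin.tail` as a continuous linear map. -/
def tailCLM (n : ℕ) : (Fin (n + 1) → ℝ) →L[ℝ] (Fin n → ℝ) :=
  ContinuousLinearMap.pi fun i => ContinuousLinearMap.proj i.succ

theorem tailCLM_apply {n : ℕ} (v : Fin (n + 1) → ℝ) : tailCLM n v = Fin.tail v := rfl

variable {n : ℕ}

/-- The arguments `(φ, s, log ‖W‖)` of the scalar functions. -/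
noncomputable def chartPoint (m : Matrix (Fin n) (Fin n) ℝ) (b : Phase n) : ℝ × ℝ × ℝ :=
  (b.1 0, b.2 0, logNorm m (Fin.tail b.2))

/-- The tangent map of `chartPoint`. -/
noncomputable def chartVector (m : Matrix (Fin n) (Fin n) ℝ) (b u : Phase n) : ℝ × ℝ × ℝ :=
  (u.1 0, u.2 0, logGrad m (Fin.tail b.2) ⬝ᵥ Fin.tail u.2)

/-- The phase point with coordinates `((φ, w), (s, W))`. -/
noncomputable def positionMap (c ℓ : ℝ) (G : ℝ → ℝ) (m : Matrix (Fin n) (Fin n) ℝ) (b : Phase n) :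
    Phase n :=
  (Fin.cons (thermostatPosition ℓ (chartPoint m b)) (Fin.tail b.1),
    Fin.cons (c * thermostatMomentum ℓ G (chartPoint m b)) (Fin.tail b.2))

/-- The angles and actions at the coordinates `((φ, w), (s, W))`. -/
noncomputable def angleActionMap (c : ℝ) (G : ℝ → ℝ) (m : Matrix (Fin n) (Fin n) ℝ) (b : Phase n) :
    Phase n :=
  (Fin.cons (thermostatAngle G (chartPoint m b))
      (Fin.tail b.1 - (c * angleShift G (chartPoint m b)) • logGrad m (Fin.tail b.2)),
    Fin.cons (c * thermostatAction G (chartPoint m b)) (Fin.tail b.2))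

theorem isOpen_chartDomain : IsOpen (chartDomain n) := by
  have h1 : Continuous fun b : Phase n => b.2 0 := by fun_prop
  have h2 : Continuous fun b : Phase n => Fin.tail b.2 := (tailCLM n).continuous.comp continuous_snd
  exact (isOpen_lt continuous_const h1).inter (isOpen_ne_fun h2 continuous_const)

theorem contDiff_finCons {E : Type*} [NormedAddCommGroup E] [NormedSpace ℝ E] {r : WithTop ℕ∞}
    {f : E → ℝ} {g : E → Fin n → ℝ} {s : Set E} (hf : ContDiffOn ℝ r f s) (hg : ContDiffOn ℝ r g s) :
    ContDiffOn ℝ r (fun x => (Fin.cons (f x) (g x) : Fin (n + 1) → ℝ)) s := by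
  rw [contDiffOn_pi]
  intro i
  refine Fin.cases ?_ (fun i => ?_) i
  · simpa using hf
  · simpa using (contDiffOn_pi.1 hg) i

variable {m : Matrix (Fin n) (Fin n) ℝ} {G : ℝ → ℝ} {r : ℕ∞} {c ℓ : ℝ}

theorem contDiff_tail_fst : ContDiff ℝ r fun b : Phase n => Fin.tail b.1 :=
  (tailCLM n).contDiff.comp contDiff_fst

theorem contDiff_tail_snd : ContDiff ℝ r fun b : Phase n => Fin.tail b.2 :=
  (tailCLM n).contDiff.comp contDiff_snd

theorem contDiffOn_chartPoint (hm : m.PosDef) : ContDiffOn ℝ r (chartPoint m) (chartDomain n) := by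
  intro b hb
  have h : ContDiffAt ℝ r (fun b : Phase n => logNorm m (Fin.tail b.2)) b :=
    ContDiffAt.comp (g := logNorm m) (f := fun b : Phase n => Fin.tail b.2) b
      (contDiffAt_logNorm hm hb.2) contDiff_tail_snd.contDiffAt
  have h1 : ContDiffAt ℝ r (fun b : Phase n => b.1 0) b := by fun_prop
  have h2 : ContDiffAt ℝ r (fun b : Phase n => b.2 0) b := by fun_prop
  exact (h1.prodMk (h2.prodMk h)).contDiffWithinAt

theorem contDiffOn_logGrad_tail (hm : m.PosDef) :
    ContDiffOn ℝ r (fun b : Phase n => logGrad m (Fin.tail b.2)) (chartDomain n) := fun b hb =>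
  ((contDiffAt_logGrad hm hb.2).comp b contDiff_tail_snd.contDiffAt).contDiffWithinAt

theorem contDiffOn_positionMap (hm : m.PosDef) (hG : ContDiff ℝ r G) :
    ContDiffOn ℝ r (positionMap c ℓ G m) (chartDomain n) :=
  (contDiff_finCons ((contDiff_thermostatPosition ℓ).comp_contDiffOn (contDiffOn_chartPoint hm))
    contDiff_tail_fst.contDiffOn).prodMk
  (contDiff_finCons (contDiffOn_const.mul
    ((contDiff_thermostatMomentum ℓ hG).comp_contDiffOn (contDiffOn_chartPoint hm)))
    contDiff_tail_snd.contDiffOn)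

theorem contDiffOn_angleActionMap (hm : m.PosDef) (hG : ContDiff ℝ r G) (hpos : ∀ t, 0 < G t) :
    ContDiffOn ℝ r (angleActionMap c G m) (chartDomain n) :=
  (contDiff_finCons ((contDiff_thermostatAngle hG hpos).comp_contDiffOn (contDiffOn_chartPoint hm))
    (contDiff_tail_fst.contDiffOn.sub ((contDiffOn_const.mul
      ((contDiff_angleShift hG hpos).comp_contDiffOn (contDiffOn_chartPoint hm))).smul
      (contDiffOn_logGrad_tail hm)))).prodMk
  (contDiff_finCons (contDiffOn_const.mul
    ((contDiff_thermostatAction hG).comp_contDiffOn (contDiffOn_chartPoint hm)))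
    contDiff_tail_snd.contDiffOn)

theorem exists_hasFDerivAt_chartPoint (hm : m.PosDef) {b : Phase n} (hb : b ∈ chartDomain n) :
    ∃ L : Phase n →L[ℝ] ℝ × ℝ × ℝ, HasFDerivAt (chartPoint m) L b ∧ ∀ u, L u = chartVector m b u := by
  have h1 := ((ContinuousLinearMap.proj (R := ℝ) (φ := fun _ : Fin (n + 1) => ℝ) 0).comp
    (ContinuousLinearMap.fst ℝ _ (Fin (n + 1) → ℝ))).hasFDerivAt (x := b)
  have h2 := ((ContinuousLinearMap.proj (R := ℝ) (φ := fun _ : Fin (n + 1) => ℝ) 0).comp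
    (ContinuousLinearMap.snd ℝ (Fin (n + 1) → ℝ) _)).hasFDerivAt (x := b)
  have h3 := ((contDiffAt_logNorm (r := 1) hm hb.2).differentiableAt (by simp)).hasFDerivAt.comp b
    ((tailCLM n).comp (ContinuousLinearMap.snd ℝ (Fin (n + 1) → ℝ) _)).hasFDerivAt
  refine ⟨_, h1.prodMk (h2.prodMk h3), fun u => ?_⟩
  simp [chartVector, tailCLM_apply, fderiv_logNorm hm hb.2]

theorem fderiv_positionMap (hm : m.PosDef) (hG : ContDiff ℝ (1 : ℕ∞) G) {b : Phase n}
    (hb : b ∈ chartDomain n) (u : Phase n) :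
    fderiv ℝ (positionMap c ℓ G m) b u =
      (Fin.cons (fderiv ℝ (thermostatPosition ℓ) (chartPoint m b) (chartVector m b u))
        (Fin.tail u.1),
      Fin.cons (c * fderiv ℝ (thermostatMomentum ℓ G) (chartPoint m b) (chartVector m b u))
        (Fin.tail u.2)) := by
  obtain ⟨L, hL, hLu⟩ := exists_hasFDerivAt_chartPoint hm hb
  have one : ((1 : ℕ∞) : WithTop ℕ∞) ≠ 0 := by simp
  have p := ((contDiff_thermostatPosition (r := 1) ℓ).differentiable one
    (chartPoint m b)).hasFDerivAt.comp b hL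
  have q := (((contDiff_thermostatMomentum ℓ hG).differentiable one
    (chartPoint m b)).hasFDerivAt.comp b hL).const_mul c
  have t1 := ((tailCLM n).comp (ContinuousLinearMap.fst ℝ (Fin (n + 1) → ℝ)
    (Fin (n + 1) → ℝ))).hasFDerivAt (x := b)
  have t2 := ((tailCLM n).comp (ContinuousLinearMap.snd ℝ (Fin (n + 1) → ℝ)
    (Fin (n + 1) → ℝ))).hasFDerivAt (x := b)
  have h : HasFDerivAt (positionMap c ℓ G m) _ b := (p.finCons (F' := fun _ => ℝ) t1).prodMk
    (q.finCons (F' := fun _ => ℝ) t2)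
  rw [h.fderiv]
  ext i <;> refine Fin.cases ?_ (fun i => ?_) i <;> simp [hLu, tailCLM_apply]

theorem fderiv_angleActionMap (hm : m.PosDef) (hG : ContDiff ℝ (1 : ℕ∞) G) (hpos : ∀ t, 0 < G t)
    {b : Phase n} (hb : b ∈ chartDomain n) (u : Phase n) :
    fderiv ℝ (angleActionMap c G m) b u =
      (Fin.cons (fderiv ℝ (thermostatAngle G) (chartPoint m b) (chartVector m b u))
        (Fin.tail u.1 -
          ((c * fderiv ℝ (angleShift G) (chartPoint m b) (chartVector m b u)) •
            logGrad m (Fin.tail b.2)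
          + (c * angleShift G (chartPoint m b)) • ((quad m (Fin.tail b.2))⁻¹ •
            m.mulVec (Fin.tail u.2) - (2 * (logGrad m (Fin.tail b.2) ⬝ᵥ Fin.tail u.2)) •
            logGrad m (Fin.tail b.2)))),
      Fin.cons (c * fderiv ℝ (thermostatAction G) (chartPoint m b) (chartVector m b u))
        (Fin.tail u.2)) := by
  obtain ⟨L, hL, hLu⟩ := exists_hasFDerivAt_chartPoint hm hb
  have one : ((1 : ℕ∞) : WithTop ℕ∞) ≠ 0 := by simp
  have p := ((contDiff_thermostatAngle hG hpos).differentiable one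
    (chartPoint m b)).hasFDerivAt.comp b hL
  have q := (((contDiff_thermostatAction hG).differentiable one
    (chartPoint m b)).hasFDerivAt.comp b hL).const_mul c
  have ξ := (((contDiff_angleShift hG hpos).differentiable one
    (chartPoint m b)).hasFDerivAt.comp b hL).const_mul c
  have t1 := ((tailCLM n).comp (ContinuousLinearMap.fst ℝ (Fin (n + 1) → ℝ)
    (Fin (n + 1) → ℝ))).hasFDerivAt (x := b)
  have t2 := ((tailCLM n).comp (ContinuousLinearMap.snd ℝ (Fin (n + 1) → ℝ)
    (Fin (n + 1) → ℝ))).hasFDerivAt (x := b)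
  have g := ((contDiffAt_logGrad (r := 1) hm hb.2).differentiableAt one).hasFDerivAt.comp b t2
  have h : HasFDerivAt (angleActionMap c G m) _ b :=
    (p.finCons (F' := fun _ => ℝ) (t1.sub (ξ.smul g))).prodMk (q.finCons (F' := fun _ => ℝ) t2)
  rw [h.fderiv]
  ext i <;> refine Fin.cases ?_ (fun i => ?_) i <;>
    simp [hLu, tailCLM_apply, fderiv_logGrad hm hb.2]
  ring

theorem canonicalForm_cons (x y x' y' : ℝ) (a b a' b' : Fin n → ℝ) :
    canonicalForm n (Fin.cons x a, Fin.cons y b) (Fin.cons x' a', Fin.cons y' b') =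
      (x * y' - y * x') + (a ⬝ᵥ b' - b ⬝ᵥ a') := by
  simp [canonicalForm, Fin.sum_univ_succ, dotProduct, Finset.sum_sub_distrib]
  ring

/-- Both maps pull the canonical form back to the same form. -/
theorem canonicalForm_angleActionMap (hm : m.PosDef) (hG : ContDiff ℝ (1 : ℕ∞) G)
    (hpos : ∀ t, 0 < G t) {b : Phase n} (hb : b ∈ chartDomain n) (u v : Phase n) :
    canonicalForm n (fderiv ℝ (positionMap c ℓ G m) b u) (fderiv ℝ (positionMap c ℓ G m) b v) =
    canonicalForm n (fderiv ℝ (angleActionMap c G m) b u)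
      (fderiv ℝ (angleActionMap c G m) b v) := by
  rw [fderiv_positionMap hm hG hb, fderiv_positionMap hm hG hb,
    fderiv_angleActionMap hm hG hpos hb, fderiv_angleActionMap hm hG hpos hb,
    canonicalForm_cons, canonicalForm_cons]
  have key := thermostat_areaForm hG hpos ℓ (chartPoint m b) (chartVector m b u)
    (chartVector m b v)
  have hu : (chartVector m b u).2.2 = logGrad m (Fin.tail b.2) ⬝ᵥ Fin.tail u.2 := rfl
  have hv : (chartVector m b v).2.2 = logGrad m (Fin.tail b.2) ⬝ᵥ Fin.tail v.2 := rfl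
  rw [hu, hv] at key
  -- The terms carrying `angleShift` pair the two vectors through the Hessian of `logNorm`. It is
  -- symmetric, so they cancel, and `c` times the area identity remains.
  simp only [sub_dotProduct, add_dotProduct, smul_dotProduct, dotProduct_sub, dotProduct_add,
    dotProduct_smul, smul_eq_mul]
  rw [dotProduct_comm (Fin.tail u.2) (logGrad m (Fin.tail b.2)),
    dotProduct_mulVec_comm hm (Fin.tail u.2) (Fin.tail v.2)]
  linear_combination c * key

/-- The differential is triangular. The last actions give the `W` part; then the radial derivative
of the action, the angular derivative of the angle and finally the identity in `w` are
non-degenerate in turn. -/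
theorem injective_fderiv_angleActionMap (hm : m.PosDef) (hG : ContDiff ℝ (1 : ℕ∞) G)
    (hpos : ∀ t, 0 < G t) (hc : c ≠ 0) {b : Phase n} (hb : b ∈ chartDomain n) :
    Function.Injective (fderiv ℝ (angleActionMap c G m) b) := by
  rw [injective_iff_map_eq_zero]
  intro u hu
  rw [fderiv_angleActionMap hm hG hpos hb, Prod.mk_eq_zero] at hu
  obtain ⟨h1, h2⟩ := hu
  have hW : Fin.tail u.2 = 0 := by
    funext i
    simpa using congrFun h2 i.succ
  have h20 := congrFun h2 0
  have hM := circleWeight_pos 0 (contDiff_zero.2 hG.continuous) hpos (chartPoint m b).2.1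
    (chartPoint m b).2.2
  have hs0 : 0 < (chartPoint m b).2.1 := hb.1
  have hv : chartVector m b u = (u.1 0, u.2 0, 0) := by simp [chartVector, hW]
  rw [Fin.cons_zero, fderiv_thermostatAction hG, hv] at h20
  have hs : u.2 0 = 0 := by
    simp only [mul_zero, add_zero, Pi.zero_apply, mul_eq_zero, hc, false_or] at h20
    rcases h20 with h | h
    · rcases h with h | h | h
      · norm_num at h
      · exact absurd h hs0.ne'
      · exact absurd h hM.ne'
    · exact h
  have h10 := congrFun h1 0
  have hv' : chartVector m b u = (u.1 0) • ((1, 0, 0) : ℝ × ℝ × ℝ) := by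
    rw [hv, hs]; simp
  have hφ : u.1 0 = 0 := by
    rw [Fin.cons_zero, hv', map_smul, smul_eq_mul, Pi.zero_apply] at h10
    exact (mul_eq_zero.1 h10).resolve_right (fderiv_thermostatAngle_angular hG hpos _).ne'
  have hw : Fin.tail u.1 = 0 := by
    funext i
    have := congrFun h1 i.succ
    simpa [hv', hφ, hW] using this
  have split : ∀ v : Fin (n + 1) → ℝ, v 0 = 0 → Fin.tail v = 0 → v = 0 := by
    intro v h0 ht
    rw [← Fin.cons_self_tail v, h0, ht]
    ext i
    refine Fin.cases ?_ (fun i => ?_) i <;> simp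
  exact Prod.ext (split _ hφ hw) (split _ hs hW)

end PhaseChart

/-! ### Construction of the angle-action chart. -/

section ActionAngleChart

variable {n : ℕ} {m : Matrix (Fin n) (Fin n) ℝ} {G : ℝ → ℝ} {r : ℕ∞} {c ℓ : ℝ}

/-- The domain `s > 0`, `W ≠ 0`. -/
def actionDomain (n : ℕ) : Set (Fin (n + 1) → ℝ) := {y | 0 < y 0 ∧ Fin.tail y ≠ 0}

/-- The actions as functions of `(s, W)`. -/
noncomputable def actionMap (c : ℝ) (G : ℝ → ℝ) (m : Matrix (Fin n) (Fin n) ℝ)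
    (y : Fin (n + 1) → ℝ) : Fin (n + 1) → ℝ :=
  Fin.cons (c * circleAction G (y 0) (logNorm m (Fin.tail y))) (Fin.tail y)

theorem angleActionMap_snd (b : Phase n) : (angleActionMap c G m b).2 = actionMap c G m b.2 := rfl

theorem actionMap_injOn (hG : Continuous G) (hpos : ∀ t, 0 < G t) (hc : c ≠ 0) :
    InjOn (actionMap c G m) (actionDomain n) := by
  intro y hy z hz h
  have ht : Fin.tail y = Fin.tail z := by
    have := congrArg Fin.tail h
    simpa [actionMap] using this
  have h0 : y 0 = z 0 := by
    have := congrFun h 0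
    simp only [actionMap, Fin.cons_zero, ht] at this
    exact (circleAction_strictMonoOn hG hpos _).injOn hy.1.le hz.1.le (mul_left_cancel₀ hc this)
  rw [← Fin.cons_self_tail y, ← Fin.cons_self_tail z, h0, ht]

theorem thermostatAngle_add (hG : Continuous G) (hpos : ∀ t, 0 < G t) (φ s j : ℝ) (k : ℤ) :
    thermostatAngle G (φ + k * (2 * Real.pi), s, j) = thermostatAngle G (φ, s, j) + k := by
  have hM := (circleWeight_pos 0 (contDiff_zero.2 hG) hpos s j).ne'
  simp only [thermostatAngle, arcWeight_add_int_mul_two_pi 0 hG]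
  field_simp

/-- One turn adds `E` to the arc integral of weight one and `1` to the angle, so the correction `θ
E` restores periodicity. This is what lets the shifted angles descend to the torus. -/
theorem angleShift_add (hG : Continuous G) (hpos : ∀ t, 0 < G t) (φ s j : ℝ) (k : ℤ) :
    angleShift G (φ + k * (2 * Real.pi), s, j) = angleShift G (φ, s, j) := by
  simp only [angleShift, thermostatAngle_add hG hpos, arcWeight_add_int_mul_two_pi 1 hG]
  ring

theorem thermostatAngle_injective (hG : Continuous G) (hpos : ∀ t, 0 < G t) (s j : ℝ) :
    Function.Injective fun φ => thermostatAngle G (φ, s, j) := by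
  intro φ ψ h
  have hM := (circleWeight_pos 0 (contDiff_zero.2 hG) hpos s j).ne'
  refine (arcWeight_strictMono 0 hG hpos s j).injective ?_
  simpa [thermostatAngle, div_left_inj' hM] using h

theorem angle_eq_of_polar {s t φ ψ : ℝ} (hs : 0 < s) (ht : 0 < t)
    (hc : s * Real.cos φ = t * Real.cos ψ) (hs' : s * Real.sin φ = t * Real.sin ψ) :
    s = t ∧ ∃ k : ℤ, ψ = φ + k * (2 * Real.pi) := by
  have h1 : s ^ 2 = t ^ 2 := by
    linear_combination (s * Real.cos φ + t * Real.cos ψ) * hc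
      + (s * Real.sin φ + t * Real.sin ψ) * hs' - s ^ 2 * Real.sin_sq_add_cos_sq φ
      + t ^ 2 * Real.sin_sq_add_cos_sq ψ
  have h2 : s = t := (sq_eq_sq₀ hs.le ht.le).1 h1
  subst h2
  have h3 := Real.Angle.cos_sin_inj (mul_left_cancel₀ hs.ne' hc).symm
    (mul_left_cancel₀ hs.ne' hs').symm
  obtain ⟨k, hk⟩ := Real.Angle.angle_eq_iff_two_pi_dvd_sub.1 h3
  exact ⟨rfl, k, by linear_combination hk⟩

theorem rootExcess_injective : Function.Injective rootExcess := excessRootHomeomorph.symm.injective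

/-- The position map and the angle-action map have the same fibres modulo the lattices. -/
theorem samePhasePoint_iff (hG : Continuous G) (hpos : ∀ t, 0 < G t) (hc : c ≠ 0) {a b : Phase n}
    (ha : a ∈ chartDomain n) (hb : b ∈ chartDomain n) :
    SamePhasePoint (positionMap c ℓ G m a) (positionMap c ℓ G m b) ↔
      SameAngleAction (angleActionMap c G m a) (angleActionMap c G m b) := by
  constructor
  · rintro ⟨h1, h2, h3⟩
    have hW : Fin.tail b.2 = Fin.tail a.2 := by
      have := congrArg Fin.tail h3
      simpa [positionMap] using this
    have hS := congrFun h3 0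
    simp only [positionMap, chartPoint, Fin.cons_zero, hW] at h1 hS
    set j := logNorm m (Fin.tail a.2)
    have hlog : logPosition (b.1 0, b.2 0, j) = logPosition (a.1 0, a.2 0, j) := by
      have := Real.exp_injective h1
      linarith
    -- At fixed `W` the position determines `s cos φ`, the momentum then determines `s sin φ`, and
    -- polar coordinates with `s > 0` are unique up to full turns.
    have hcos : a.2 0 * Real.cos (a.1 0) = b.2 0 * Real.cos (b.1 0) := by
      refine rootExcess_injective ?_
      simp only [logPosition] at hlog
      linarith
    have hsin : a.2 0 * Real.sin (a.1 0) = b.2 0 * Real.sin (b.1 0) := by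
      have h := mul_left_cancel₀ hc hS
      simp only [thermostatMomentum, hlog, h1] at h
      have h' := (div_left_inj' (Real.exp_pos _).ne').1 h
      exact (mul_right_cancel₀ (hpos _).ne' h').symm
    obtain ⟨hs, k, hk⟩ := angle_eq_of_polar ha.1 hb.1 hcos hsin
    have h2' : b.2 = a.2 := by
      rw [← Fin.cons_self_tail b.2, ← Fin.cons_self_tail a.2, hs, hW]
    refine ⟨fun i => ?_, ?_⟩
    · refine Fin.cases ⟨k, ?_⟩ (fun i => ?_) i
      · simp only [angleActionMap, chartPoint, Fin.cons_zero, hk, h2',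
          thermostatAngle_add hG hpos]
      · obtain ⟨l, hl⟩ := h2 i
        refine ⟨l, ?_⟩
        simp only [positionMap, Fin.cons_succ, Fin.tail] at hl
        simp only [angleActionMap, chartPoint, Fin.cons_succ, hk, h2', angleShift_add hG hpos,
          Pi.sub_apply, Fin.tail, hl]
        ring
    · rw [angleActionMap_snd, angleActionMap_snd, h2']
  · rintro ⟨h1, h2⟩
    have h2' : b.2 = a.2 := actionMap_injOn (m := m) hG hpos hc hb ha h2
    obtain ⟨k, hk⟩ := h1 0
    have hφ : b.1 0 = a.1 0 + k * (2 * Real.pi) := by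
      refine thermostatAngle_injective hG hpos (a.2 0) (logNorm m (Fin.tail a.2)) ?_
      simp only [angleActionMap, chartPoint, Fin.cons_zero, h2'] at hk
      simp only [thermostatAngle_add hG hpos, hk]
    refine ⟨?_, fun i => ?_, ?_⟩
    · simp only [positionMap, chartPoint, Fin.cons_zero, hφ, h2', thermostatPosition, logPosition,
        Real.cos_add_int_mul_two_pi]
    · obtain ⟨l, hl⟩ := h1 i.succ
      refine ⟨l, ?_⟩
      simp only [angleActionMap, chartPoint, Fin.cons_succ, hφ, h2', angleShift_add hG hpos,
          Pi.sub_apply, Fin.tail] at hl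
      simp only [positionMap, Fin.cons_succ, Fin.tail]
      linarith
    · simp only [positionMap, chartPoint, hφ, h2', thermostatMomentum, thermostatPosition,
        logPosition, Real.cos_add_int_mul_two_pi, Real.sin_add_int_mul_two_pi]

theorem angleActionMap_injOn (hG : Continuous G) (hpos : ∀ t, 0 < G t) (hc : c ≠ 0) :
    InjOn (angleActionMap c G m) (chartDomain n) := by
  intro a ha b hb h
  have h2 : a.2 = b.2 := actionMap_injOn (m := m) hG hpos hc ha hb (congrArg Prod.snd h)
  have h1 := congrArg Prod.fst h
  have hφ : a.1 0 = b.1 0 := by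
    refine thermostatAngle_injective hG hpos (a.2 0) (logNorm m (Fin.tail a.2)) ?_
    have := congrFun h1 0
    simpa only [angleActionMap, chartPoint, Fin.cons_zero, ← h2] using this
  refine Prod.ext (funext fun i => ?_) h2
  refine Fin.cases hφ (fun i => ?_) i
  have := congrFun h1 i.succ
  simp only [angleActionMap, chartPoint, Fin.cons_succ, ← h2, hφ, Pi.sub_apply, Fin.tail] at this
  linarith

/-- At fixed `(s, W)` the arc integral maps the line onto itself, so every value of the first angle
occurs; the others are adjusted by translating `w`. The image is therefore a full product over the
set of actions. -/
theorem angleActionMap_image (hG : Continuous G) (hpos : ∀ t, 0 < G t) :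
    angleActionMap c G m '' chartDomain n = univ ×ˢ (actionMap c G m '' actionDomain n) := by
  ext ⟨θ, I⟩
  constructor
  · rintro ⟨b, hb, h⟩
    exact ⟨mem_univ _, b.2, hb, congrArg Prod.snd h⟩
  · rintro ⟨-, y, hy, h⟩
    have hM := (circleWeight_pos 0 (contDiff_zero.2 hG) hpos (y 0) (logNorm m (Fin.tail y))).ne'
    obtain ⟨φ, hφ⟩ := arcWeight_surjective 0 hG hpos (y 0) (logNorm m (Fin.tail y))
      (θ 0 * circleWeight 0 G (y 0) (logNorm m (Fin.tail y)))
    refine ⟨(Fin.cons φ (Fin.tail θ + (c * angleShift G (φ, y 0, logNorm m (Fin.tail y))) •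
      logGrad m (Fin.tail y)), y), hy, Prod.ext ?_ h⟩
    simp only at hφ
    simp only [angleActionMap, chartPoint, Fin.cons_zero, Fin.tail_cons, add_sub_cancel_right,
      thermostatAngle, hφ, mul_div_cancel_right₀ _ hM, Fin.cons_self_tail]

/-- A Hamiltonian that depends only on `(s, W)` in the coordinates `((φ, w), (s, W))` has an
angle-action chart. -/
theorem exists_isActionAngleChart (hr : 1 ≤ r) (hm : m.PosDef) (hG : ContDiff ℝ r G)
    (hpos : ∀ t, 0 < G t) (hc : c ≠ 0) {F : Phase n → ℝ} {η : (Fin (n + 1) → ℝ) → ℝ}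
    (hη : ContDiffOn ℝ r η (actionDomain n))
    (hF : ∀ b ∈ chartDomain n, F (positionMap c ℓ G m b) = η b.2) :
    ∃ Φ h, IsActionAngleChart r F (actionMap c G m '' actionDomain n) Φ h ∧
      (∀ b ∈ chartDomain n, Φ (angleActionMap c G m b) = positionMap c ℓ G m b) ∧
      ∀ y ∈ actionDomain n, h (actionMap c G m y) = η y := by
  have hGc := hG.continuous
  have hG1 : ContDiff ℝ (1 : ℕ∞) G := hG.of_le (by exact_mod_cast hr)
  obtain ⟨hopen, g, hg, hgΨ⟩ := exists_contDiffOn_inverse hr isOpen_chartDomain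
    (contDiffOn_angleActionMap (c := c) hm hG hpos) (angleActionMap_injOn hGc hpos hc)
    (fun b hb => injective_fderiv_angleActionMap hm hG1 hpos hc hb)
  have himg := angleActionMap_image (c := c) (m := m) hGc hpos
  have hsurj : ∀ a ∈ (univ ×ˢ (actionMap c G m '' actionDomain n) : Set (Phase n)),
      ∃ b ∈ chartDomain n, angleActionMap c G m b = a := fun a ha => by rwa [← himg] at ha
  have hmaps : MapsTo g (univ ×ˢ (actionMap c G m '' actionDomain n)) (chartDomain n) := by
    intro a ha
    obtain ⟨b, hb, rfl⟩ := hsurj a ha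
    rwa [hgΨ b hb]
  have hpm := contDiffOn_positionMap (c := c) (ℓ := ℓ) hm hG
  have hline : ContDiff ℝ r fun I : Fin (n + 1) → ℝ => ((0, I) : Phase n) := by fun_prop
  have hlm : MapsTo (fun I : Fin (n + 1) → ℝ => ((0, I) : Phase n))
      (actionMap c G m '' actionDomain n) (univ ×ˢ (actionMap c G m '' actionDomain n)) :=
    fun I hI => ⟨mem_univ _, hI⟩
  rw [himg] at hg hopen
  have hD : IsOpen (actionMap c G m '' actionDomain n) := by
    have he : (fun I : Fin (n + 1) → ℝ => ((0, I) : Phase n)) ⁻¹'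
        (univ ×ˢ (actionMap c G m '' actionDomain n)) = actionMap c G m '' actionDomain n :=
      Set.ext fun I => ⟨fun h => h.2, fun h => ⟨mem_univ _, h⟩⟩
    exact he ▸ hopen.preimage hline.continuous
  -- The coordinates `(s, W)` of a preimage depend only on the actions, so the Hamiltonian can be
  -- read off along the slice of zero angles.
  have hh : ∀ a ∈ (univ ×ˢ (actionMap c G m '' actionDomain n) : Set (Phase n)),
      (g (0, a.2)).2 = (g a).2 := by
    intro a ha
    obtain ⟨b, hb, rfl⟩ := hsurj a ha
    obtain ⟨b', hb', h'⟩ := hsurj _ (hlm ha.2)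
    simp only at h'
    rw [← h', hgΨ b hb, hgΨ b' hb']
    refine actionMap_injOn (m := m) hGc hpos hc hb' hb ?_
    exact congrArg Prod.snd h'
  refine ⟨positionMap c ℓ G m ∘ g, fun I => η (g (0, I)).2, ?_, ?_, ?_⟩
  · refine ⟨hD, hpm.comp hg hmaps, ?_, ?_, ?_, ?_, ?_⟩
    · intro a ha
      exact Real.exp_pos _
    · intro a ha b hb
      obtain ⟨a, ha', rfl⟩ := hsurj a ha
      obtain ⟨b, hb', rfl⟩ := hsurj b hb
      simp only [Function.comp_apply, hgΨ a ha', hgΨ b hb']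
      exact samePhasePoint_iff hGc hpos hc ha' hb'
    · intro a ha u v
      obtain ⟨b, hb, rfl⟩ := hsurj a ha
      have one : ((r : ℕ∞) : WithTop ℕ∞) ≠ 0 := by
        intro h
        have h' : r = 0 := by exact_mod_cast h
        simp [h'] at hr
      have hΨd := ((contDiffOn_angleActionMap (c := c) hm hG hpos).contDiffAt
        (isOpen_chartDomain.mem_nhds hb)).differentiableAt one
      have hΦd := ((hpm.comp hg hmaps).contDiffAt (hopen.mem_nhds ha)).differentiableAt one
      -- The chart composed with `angleActionMap` is `positionMap`. As the differential of
      -- `angleActionMap` is onto, equality of the two pulled-back forms implies that the chart is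
      -- symplectic.
      have hcomp : fderiv ℝ (positionMap c ℓ G m) b =
          (fderiv ℝ (positionMap c ℓ G m ∘ g) (angleActionMap c G m b)).comp
            (fderiv ℝ (angleActionMap c G m) b) := by
        rw [← fderiv_comp b hΦd hΨd]
        refine Filter.EventuallyEq.fderiv_eq ?_
        filter_upwards [isOpen_chartDomain.mem_nhds hb] with x hx
        simp only [Function.comp_apply, hgΨ x hx]
      have hinj := injective_fderiv_angleActionMap hm hG1 hpos hc hb
      have hs : Function.Surjective (fderiv ℝ (angleActionMap c G m) b) :=
        LinearMap.injective_iff_surjective.1 hinj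
      obtain ⟨u, rfl⟩ := hs u
      obtain ⟨v, rfl⟩ := hs v
      have := canonicalForm_angleActionMap (c := c) (ℓ := ℓ) hm hG1 hpos hb u v
      rw [hcomp] at this
      exact this
    · refine hη.comp (contDiff_snd.comp_contDiffOn (hg.comp hline.contDiffOn hlm)) ?_
      exact fun I hI => hmaps (hlm hI)
    · intro a ha
      rw [hh a ha]
      exact hF _ (hmaps ha)
  · intro b hb
    simp only [Function.comp_apply, hgΨ b hb]
  · intro y hy
    have hmem : ((0 : Fin (n + 1) → ℝ), actionMap c G m y) ∈
        (univ ×ˢ (actionMap c G m '' actionDomain n) : Set (Phase n)) := hlm ⟨y, hy, rfl⟩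
    obtain ⟨b, hb, h⟩ := hsurj _ hmem
    have hby : b.2 = y := actionMap_injOn (m := m) hGc hpos hc hb hy (congrArg Prod.snd h)
    simp only [← h, hgΨ b hb, hby]

end ActionAngleChart

/-! ### Frequencies and energy as functions of `(s, W)`. -/

section Frequencies

variable {n : ℕ} {m : Matrix (Fin n) (Fin n) ℝ} {G : ℝ → ℝ} {r : ℕ∞} {c N C : ℝ}

theorem clm_eq_sum_single {N : ℕ} (L : (Fin N → ℝ) →L[ℝ] ℝ) (b : Fin N → ℝ) :
    L b = ∑ i, L (Pi.single i 1) * b i := by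
  conv_lhs => rw [pi_eq_sum_univ' b]
  simp only [map_sum, map_smul, smul_eq_mul]
  refine Finset.sum_congr rfl fun i _ => ?_
  rw [mul_comm]

theorem hessianMatrix_mulVec {N : ℕ} (h : (Fin N → ℝ) → ℝ) (I b : Fin N → ℝ) (i : Fin N) :
    (hessianMatrix h I).mulVec b i = fderiv ℝ (fun y => frequency h y i) I b := by
  rw [clm_eq_sum_single]
  rfl

theorem frequency_dotProduct {N : ℕ} (h : (Fin N → ℝ) → ℝ) (I b : Fin N → ℝ) :
    frequency h I ⬝ᵥ b = fderiv ℝ h I b := by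
  rw [clm_eq_sum_single]
  rfl

/-- Chain rule for functions of `s` and of the logarithm of the norm. -/
theorem fderiv_comp_radius_logNorm (hm : m.PosDef) {f : ℝ × ℝ → ℝ} (hf : Differentiable ℝ f)
    {y : Fin (n + 1) → ℝ} (hy : y ∈ actionDomain n) {fs fj : ℝ}
    (hs : HasDerivAt (fun s => f (s, logNorm m (Fin.tail y))) fs (y 0))
    (hj : HasDerivAt (fun j => f (y 0, j)) fj (logNorm m (Fin.tail y))) :
    DifferentiableAt ℝ (fun y : Fin (n + 1) → ℝ => f (y 0, logNorm m (Fin.tail y))) y ∧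
    ∀ u, fderiv ℝ (fun y : Fin (n + 1) → ℝ => f (y 0, logNorm m (Fin.tail y))) y u =
      fs * u 0 + fj * (logGrad m (Fin.tail y) ⬝ᵥ Fin.tail u) := by
  have h1 := (ContinuousLinearMap.proj (R := ℝ) (φ := fun _ : Fin (n + 1) => ℝ) 0).hasFDerivAt
    (x := y)
  have h2 := ((contDiffAt_logNorm (r := 1) hm hy.2).differentiableAt (by simp)).hasFDerivAt.comp y
    (tailCLM n).hasFDerivAt
  have hL := (hf (y 0, logNorm m (Fin.tail y))).hasFDerivAt
  have h3 : HasFDerivAt (fun y : Fin (n + 1) → ℝ => f (y 0, logNorm m (Fin.tail y))) _ y :=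
    hL.comp y (h1.prodMk h2)
  refine ⟨h3.differentiableAt, fun u => ?_⟩
  have e1 : fderiv ℝ f (y 0, logNorm m (Fin.tail y)) (1, 0) = fs :=
    (hL.comp_hasDerivAt (y 0) ((hasDerivAt_id (y 0)).prodMk
      (hasDerivAt_const _ (logNorm m (Fin.tail y))))).unique hs
  have e2 : fderiv ℝ f (y 0, logNorm m (Fin.tail y)) (0, 1) = fj :=
    (hL.comp_hasDerivAt (logNorm m (Fin.tail y)) ((hasDerivAt_const _ (y 0)).prodMk
      (hasDerivAt_id (logNorm m (Fin.tail y))))).unique hj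
  rw [h3.fderiv]
  have e3 : ((u 0, logGrad m (Fin.tail y) ⬝ᵥ Fin.tail u) : ℝ × ℝ) =
      u 0 • ((1, 0) : ℝ × ℝ) + (logGrad m (Fin.tail y) ⬝ᵥ Fin.tail u) • ((0, 1) : ℝ × ℝ) := by
    simp
  have e4 : ((ContinuousLinearMap.proj (R := ℝ) (φ := fun _ : Fin (n + 1) => ℝ) 0).prod
      ((fderiv ℝ (logNorm m) (Fin.tail y)).comp (tailCLM n))) u =
      (u 0, logGrad m (Fin.tail y) ⬝ᵥ Fin.tail u) := by
    simp [tailCLM_apply, fderiv_logNorm hm hy.2]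
  rw [ContinuousLinearMap.comp_apply, e4, e3, map_add, map_smul, map_smul, e1, e2]
  simp [mul_comm]

/-- The frequencies as functions of `(s, W)`. -/
noncomputable def frequencyMap (N c : ℝ) (G : ℝ → ℝ) (m : Matrix (Fin n) (Fin n) ℝ)
    (y : Fin (n + 1) → ℝ) : Fin (n + 1) → ℝ :=
  Fin.cons (N / (c * circleWeight 0 G (y 0) (logNorm m (Fin.tail y))))
    ((N * circleWeight 1 G (y 0) (logNorm m (Fin.tail y)) /
      circleWeight 0 G (y 0) (logNorm m (Fin.tail y))) • logGrad m (Fin.tail y))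

/-- The energy as a function of `(s, W)`. -/
noncomputable def energyMap (N C : ℝ) (m : Matrix (Fin n) (Fin n) ℝ) (y : Fin (n + 1) → ℝ) : ℝ :=
  N * (logNorm m (Fin.tail y) + y 0 ^ 2 / 4) + C

theorem isOpen_actionDomain : IsOpen (actionDomain n) := by
  have h1 : Continuous fun y : Fin (n + 1) → ℝ => y 0 := by fun_prop
  exact (isOpen_lt continuous_const h1).inter
    (isOpen_ne_fun (tailCLM n).continuous continuous_const)

theorem fderiv_circleWeight_comp (hm : m.PosDef) (k : ℝ) (hG : ContDiff ℝ (2 : ℕ) G)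
    {y : Fin (n + 1) → ℝ} (hy : y ∈ actionDomain n) :
    DifferentiableAt ℝ (fun y : Fin (n + 1) → ℝ =>
      circleWeight k G (y 0) (logNorm m (Fin.tail y))) y ∧
    ∀ u, fderiv ℝ (fun y : Fin (n + 1) → ℝ =>
      circleWeight k G (y 0) (logNorm m (Fin.tail y))) y u =
      y 0 * circleWeightTwo k G (y 0) (logNorm m (Fin.tail y)) * u 0
      + circleWeight k (deriv G) (y 0) (logNorm m (Fin.tail y)) *
        (logGrad m (Fin.tail y) ⬝ᵥ Fin.tail u) := by
  have hG1 : ContDiff ℝ (1 : ℕ∞) G := hG.of_le (by norm_cast)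
  exact fderiv_comp_radius_logNorm hm (f := fun q => circleWeight k G q.1 q.2)
    ((contDiff_circleWeight k hG1).differentiable (by simp)) hy
    (hasDerivAt_circleWeight_radius k hG (y 0) (logNorm m (Fin.tail y)))
    (hasDerivAt_circleWeight_param k (hG.of_le (by norm_cast)) (y 0) (logNorm m (Fin.tail y)))

theorem fderiv_actionMap (hm : m.PosDef) (hG : ContDiff ℝ (1 : ℕ∞) G)
    {y : Fin (n + 1) → ℝ} (hy : y ∈ actionDomain n) :
    DifferentiableAt ℝ (actionMap c G m) y ∧ ∀ u, fderiv ℝ (actionMap c G m) y u =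
      Fin.cons (c * (1 / 2 * (y 0 * circleWeight 0 G (y 0) (logNorm m (Fin.tail y))) * u 0
        + (circleWeight 0 G (y 0) (logNorm m (Fin.tail y))
          - circleWeight 1 G (y 0) (logNorm m (Fin.tail y))) *
          (logGrad m (Fin.tail y) ⬝ᵥ Fin.tail u))) (Fin.tail u) := by
  have hG' : ContDiff ℝ (1 : ℕ) G := hG.of_le (by norm_cast)
  obtain ⟨h1, h2⟩ := fderiv_comp_radius_logNorm hm (f := fun q => circleAction G q.1 q.2)
    ((contDiff_circleAction hG).differentiable (by simp)) hy
    (hasDerivAt_circleAction_radius hG.continuous (y 0) (logNorm m (Fin.tail y)))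
    (hasDerivAt_circleAction_param hG' (y 0) (logNorm m (Fin.tail y)))
  have h3 : HasFDerivAt (actionMap c G m) _ y :=
    (h1.hasFDerivAt.const_mul c).finCons (F' := fun _ => ℝ) (tailCLM n).hasFDerivAt
  refine ⟨h3.differentiableAt, fun u => ?_⟩
  rw [h3.fderiv]
  ext i
  refine Fin.cases ?_ (fun i => ?_) i <;> simp [h2, tailCLM_apply]

theorem fderiv_energyMap (hm : m.PosDef) {y : Fin (n + 1) → ℝ} (hy : y ∈ actionDomain n) :
    DifferentiableAt ℝ (energyMap N C m) y ∧ ∀ u, fderiv ℝ (energyMap N C m) y u =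
      N * (y 0 / 2) * u 0 + N * (logGrad m (Fin.tail y) ⬝ᵥ Fin.tail u) := by
  refine fderiv_comp_radius_logNorm hm (f := fun q => N * (q.2 + q.1 ^ 2 / 4) + C) (by fun_prop)
    hy (fs := N * (y 0 / 2)) (fj := N) ?_ ?_
  · refine (((((hasDerivAt_pow 2 (y 0)).div_const 4).const_add _).const_mul N).add_const
      C).congr_deriv ?_
    norm_num
    left
    ring
  · have h := (((hasDerivAt_id (logNorm m (Fin.tail y))).add_const
      (y 0 ^ 2 / 4)).const_mul N).add_const C
    exact h.congr_deriv (mul_one N)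

/-- The circle integrals and their directional derivatives enter through equations, so that the
expanded derivatives can be substituted directly when the kernels are computed. -/
theorem fderiv_frequencyMap (hm : m.PosDef) (hG : ContDiff ℝ (2 : ℕ) G) (hpos : ∀ t, 0 < G t)
    (hc : c ≠ 0) {y : Fin (n + 1) → ℝ} (hy : y ∈ actionDomain n) (u : Fin (n + 1) → ℝ) {M E M' E' : ℝ}
    (hM : M = circleWeight 0 G (y 0) (logNorm m (Fin.tail y)))
    (hE : E = circleWeight 1 G (y 0) (logNorm m (Fin.tail y)))
    (hM' : M' = fderiv ℝ (fun y : Fin (n + 1) → ℝ =>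
      circleWeight 0 G (y 0) (logNorm m (Fin.tail y))) y u)
    (hE' : E' = fderiv ℝ (fun y : Fin (n + 1) → ℝ =>
      circleWeight 1 G (y 0) (logNorm m (Fin.tail y))) y u) :
    fderiv ℝ (frequencyMap N c G m) y u = Fin.cons (-(N / (c * M ^ 2)) * M')
      ((N * (E' * M - E * M') / M ^ 2) • logGrad m (Fin.tail y) + (N * E / M) •
        ((quad m (Fin.tail y))⁻¹ • m.mulVec (Fin.tail u)
          - (2 * (logGrad m (Fin.tail y) ⬝ᵥ Fin.tail u)) • logGrad m (Fin.tail y))) ∧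
    DifferentiableAt ℝ (frequencyMap N c G m) y := by
  have hM0 : M ≠ 0 := hM ▸
    (circleWeight_pos 0 (contDiff_zero.2 hG.continuous) hpos (y 0) (logNorm m (Fin.tail y))).ne'
  obtain ⟨dM, -⟩ := fderiv_circleWeight_comp hm 0 hG hy
  obtain ⟨dE, -⟩ := fderiv_circleWeight_comp hm 1 hG hy
  have dg := ((contDiffAt_logGrad (r := 1) hm hy.2).differentiableAt (by simp)).hasFDerivAt.comp y
    (tailCLM n).hasFDerivAt
  have hcM : c * circleWeight 0 G (y 0) (logNorm m (Fin.tail y)) ≠ 0 := mul_ne_zero hc (hM ▸ hM0)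
  have hinv := (hasDerivAt_inv (show circleWeight 0 G (y 0) (logNorm m (Fin.tail y)) ≠ 0 from
    hM ▸ hM0)).comp_hasFDerivAt y dM.hasFDerivAt
  have h0 := hinv.const_mul (N / c)
  have h1 := ((dE.hasFDerivAt.const_mul N).mul hinv).smul dg
  have hcons := h0.finCons (F' := fun _ => ℝ) h1
  have h := hcons.congr_of_eventuallyEq (f₁ := frequencyMap N c G m) (by
    refine Eventually.of_forall fun z => ?_
    simp only [frequencyMap, div_eq_mul_inv, mul_inv, Function.comp_apply, Pi.mul_apply,
      Pi.smul_apply']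
    congr 1
    ring)
  refine ⟨?_, h.differentiableAt⟩
  rw [h.fderiv]
  ext i
  refine Fin.cases ?_ (fun i => ?_) i
  · simp [← hM', ← hM]
    field_simp
  · simp [← hM', ← hM, ← hE, ← hE', fderiv_logGrad hm hy.2, tailCLM_apply]
    field_simp
    ring

end Frequencies

/-! ### Kernels of the Hessian and of the bordered Hessian. -/

section Determinants

variable {n : ℕ} {m : Matrix (Fin n) (Fin n) ℝ} {G : ℝ → ℝ} {r : ℕ∞} {c N C : ℝ}

theorem eq_zero_of_tail {v : Fin (n + 1) → ℝ} (h0 : v 0 = 0) (ht : Fin.tail v = 0) : v = 0 := by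
  rw [← Fin.cons_self_tail v, h0, ht]
  ext i
  refine Fin.cases ?_ (fun i => ?_) i <;> simp

theorem mulVec_eq_zero_of_posDef (hm : m.PosDef) {U : Fin n → ℝ} (h : m.mulVec U = 0) : U = 0 := by
  by_contra hU
  have := quad_pos hm hU
  rw [quad, h, dotProduct_zero] at this
  exact lt_irrefl _ this

theorem fderiv_actionMap_surjective (hm : m.PosDef) (hG : ContDiff ℝ (1 : ℕ∞) G)
    (hpos : ∀ t, 0 < G t) (hc : c ≠ 0) {y : Fin (n + 1) → ℝ} (hy : y ∈ actionDomain n) :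
    Function.Surjective (fderiv ℝ (actionMap c G m) y) := by
  refine (LinearMap.injective_iff_surjective (f :=
    (fderiv ℝ (actionMap c G m) y : (Fin (n + 1) → ℝ) →ₗ[ℝ] (Fin (n + 1) → ℝ)))).1 ?_
  rw [injective_iff_map_eq_zero]
  intro u hu
  rw [ContinuousLinearMap.coe_coe, (fderiv_actionMap hm hG hy).2] at hu
  have hM := circleWeight_pos 0 (contDiff_zero.2 hG.continuous) hpos (y 0)
    (logNorm m (Fin.tail y))
  have ht : Fin.tail u = 0 := by
    have := congrArg Fin.tail hu
    have e : Fin.tail u = Fin.tail (0 : Fin (n + 1) → ℝ) := by simpa using this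
    exact e.trans rfl
  refine eq_zero_of_tail ?_ ht
  have h0 := congrFun hu 0
  simpa [ht, hc, hM.ne', hy.1.ne'] using h0

/-- The frequencies of a Hamiltonian in the angle-action chart. -/
theorem frequency_eq (hr : 1 ≤ r) (hm : m.PosDef) (hG : ContDiff ℝ (1 : ℕ∞) G)
    (hpos : ∀ t, 0 < G t) (hc : c ≠ 0) {h : (Fin (n + 1) → ℝ) → ℝ}
    (hD : IsOpen (actionMap c G m '' actionDomain n))
    (hh : ContDiffOn ℝ r h (actionMap c G m '' actionDomain n))
    (he : ∀ y ∈ actionDomain n, h (actionMap c G m y) = energyMap N C m y)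
    {y : Fin (n + 1) → ℝ} (hy : y ∈ actionDomain n) :
    (∀ u, fderiv ℝ h (actionMap c G m y) (fderiv ℝ (actionMap c G m) y u) =
      fderiv ℝ (energyMap N C m) y u) ∧
    frequency h (actionMap c G m y) = frequencyMap N c G m y := by
  have one : ((r : ℕ∞) : WithTop ℕ∞) ≠ 0 := by
    intro h
    have h' : r = 0 := by exact_mod_cast h
    simp [h'] at hr
  have hA := fderiv_actionMap (c := c) hm hG hy
  have hη := fderiv_energyMap (N := N) (C := C) hm hy
  have hM := circleWeight_pos 0 (contDiff_zero.2 hG.continuous) hpos (y 0)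
    (logNorm m (Fin.tail y))
  have hd := (hh.contDiffAt (hD.mem_nhds ⟨y, hy, rfl⟩)).differentiableAt one
  have hchain : ∀ u, fderiv ℝ h (actionMap c G m y) (fderiv ℝ (actionMap c G m) y u) =
      fderiv ℝ (energyMap N C m) y u := by
    intro u
    rw [← ContinuousLinearMap.comp_apply, ← fderiv_comp y hd hA.1]
    refine congrArg (fun L : (Fin (n + 1) → ℝ) →L[ℝ] ℝ => L u) (Filter.EventuallyEq.fderiv_eq ?_)
    filter_upwards [isOpen_actionDomain.mem_nhds hy] with z hz
    exact he z hz
  refine ⟨hchain, ?_⟩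
  -- It suffices to test on vectors in the image of the differential of `actionMap`, which is
  -- everything.
  have key : ∀ v, fderiv ℝ h (actionMap c G m y) v = frequencyMap N c G m y ⬝ᵥ v := by
    intro v
    obtain ⟨u, rfl⟩ := fderiv_actionMap_surjective hm hG hpos hc hy v
    rw [hchain, hη.2, hA.2]
    simp only [frequencyMap, dotProduct, Fin.sum_univ_succ, Fin.cons_zero, Fin.cons_succ,
      Pi.smul_apply, smul_eq_mul]
    have e : ∑ i, N * circleWeight 1 G (y 0) (logNorm m (Fin.tail y)) /
        circleWeight 0 G (y 0) (logNorm m (Fin.tail y)) * logGrad m (Fin.tail y) i * Fin.tail u i =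
        N * circleWeight 1 G (y 0) (logNorm m (Fin.tail y)) /
        circleWeight 0 G (y 0) (logNorm m (Fin.tail y)) *
          ∑ i, logGrad m (Fin.tail y) i * Fin.tail u i := by
      rw [Finset.mul_sum]
      exact Finset.sum_congr rfl fun i _ => by ring
    rw [e]
    field_simp
    ring
  funext i
  rw [frequency, key]
  simp

/-- The chain rule lets the Hessian be tested in the variables `(s, W)`, so `actionMap` never has to
be inverted explicitly. -/
theorem fderiv_frequency (hr : 2 ≤ r) (hm : m.PosDef) (hG : ContDiff ℝ (2 : ℕ) G)
    (hpos : ∀ t, 0 < G t) (hc : c ≠ 0) {h : (Fin (n + 1) → ℝ) → ℝ}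
    (hD : IsOpen (actionMap c G m '' actionDomain n))
    (hh : ContDiffOn ℝ r h (actionMap c G m '' actionDomain n))
    (he : ∀ y ∈ actionDomain n, h (actionMap c G m y) = energyMap N C m y)
    {y : Fin (n + 1) → ℝ} (hy : y ∈ actionDomain n) (u : Fin (n + 1) → ℝ) (i : Fin (n + 1)) :
    fderiv ℝ (fun I => frequency h I i) (actionMap c G m y) (fderiv ℝ (actionMap c G m) y u) =
      fderiv ℝ (frequencyMap N c G m) y u i := by
  have hG1 : ContDiff ℝ (1 : ℕ∞) G := hG.of_le (by norm_cast)
  have hA := fderiv_actionMap (c := c) hm hG1 hy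
  have hω := (fderiv_frequencyMap (N := N) hm hG hpos hc hy u rfl rfl rfl rfl).2
  have hr' : ((2 : ℕ∞) : WithTop ℕ∞) ≤ r := by exact_mod_cast hr
  have hc2 : ContDiffAt ℝ (2 : ℕ∞) h (actionMap c G m y) :=
    (hh.contDiffAt (hD.mem_nhds ⟨y, hy, rfl⟩)).of_le hr'
  have hfd : DifferentiableAt ℝ (fderiv ℝ h) (actionMap c G m y) :=
    (hc2.fderiv_right (m := 1) (by norm_cast)).differentiableAt (by simp)
  have hfr : DifferentiableAt ℝ (fun I => frequency h I i) (actionMap c G m y) :=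
    hfd.clm_apply (differentiableAt_const _)
  rw [← ContinuousLinearMap.comp_apply, ← fderiv_comp y hfr hA.1]
  have e : ((fun I => frequency h I i) ∘ actionMap c G m) =ᶠ[𝓝 y]
      fun z => frequencyMap N c G m z i := by
    filter_upwards [isOpen_actionDomain.mem_nhds hy] with z hz
    have hr1 : 1 ≤ r := le_trans (by norm_num) hr
    exact congrFun (frequency_eq hr1 hm hG1 hpos hc hD hh he hz).2 i
  rw [e.fderiv_eq, fderiv_apply hω]
  rfl

/-- The equations for the part of a kernel vector along `W` and across it. -/
theorem kernel_equations (hm : m.PosDef) {W U : Fin n → ℝ} (hW : W ≠ 0) {a b : ℝ} (hb : b ≠ 0)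
    (h : a • logGrad m W + b • ((quad m W)⁻¹ • m.mulVec U
      - (2 * (logGrad m W ⬝ᵥ U)) • logGrad m W) = 0) :
    a - b * (logGrad m W ⬝ᵥ U) = 0 ∧ (logGrad m W ⬝ᵥ U = 0 → U = 0) := by
  have hq := (quad_pos hm hW).ne'
  have hmu : (quad m W)⁻¹ * (m.mulVec U ⬝ᵥ W) = logGrad m W ⬝ᵥ U := by
    rw [← dotProduct_mulVec_comm hm, logGrad, smul_dotProduct, smul_eq_mul, dotProduct_comm U]
  -- Since `∇j · W = 1`, pairing the derivative of `logGrad` along `U` with `W` leaves `-(∇j · U)`.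
  have h2 := congrArg (fun v => v ⬝ᵥ W) h
  simp only [add_dotProduct, sub_dotProduct, smul_dotProduct, smul_eq_mul,
    dotProduct_logGrad hm hW, hmu, zero_dotProduct, mul_one] at h2
  have h3 : a - b * (logGrad m W ⬝ᵥ U) = 0 := by linarith
  -- If `∇j · U = 0` then also `a = 0`, and the equation reduces to `m U = 0`.
  refine ⟨h3, fun hj => ?_⟩
  rw [hj, mul_zero, sub_zero] at h3
  rw [hj, h3, zero_smul, zero_add, mul_zero, zero_smul, sub_zero] at h
  have h4 := (smul_eq_zero.1 h).resolve_left hb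
  exact mulVec_eq_zero_of_posDef hm ((smul_eq_zero.1 h4).resolve_left (inv_ne_zero hq))

variable {h : (Fin (n + 1) → ℝ) → ℝ}

/-- Along a kernel vector the first frequency gives `M' = 0`. The component of the other frequencies
along `W` then gives `E' = E j'`, with `j' = ∇j · U`. These are two linear equations in the
variations of `s` and `j`, with determinant `s * kolmogorovDet`; once `j' = 0`, the component across
`W` vanishes by `kernel_equations`. -/
theorem det_hessianMatrix_ne_zero (hr : 2 ≤ r) (hm : m.PosDef) (hG : ContDiff ℝ (2 : ℕ) G)
    (hpos : ∀ t, 0 < G t) (hc : c ≠ 0) (hN : N ≠ 0)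
    (hD : IsOpen (actionMap c G m '' actionDomain n))
    (hh : ContDiffOn ℝ r h (actionMap c G m '' actionDomain n))
    (he : ∀ y ∈ actionDomain n, h (actionMap c G m y) = energyMap N C m y)
    {y : Fin (n + 1) → ℝ} (hy : y ∈ actionDomain n)
    (hk : kolmogorovDet G (y 0) (logNorm m (Fin.tail y)) ≠ 0) :
    (hessianMatrix h (actionMap c G m y)).det ≠ 0 := by
  have hG1 : ContDiff ℝ (1 : ℕ∞) G := hG.of_le (by norm_cast)
  intro hdet
  obtain ⟨b, hb0, hb⟩ := Matrix.exists_mulVec_eq_zero_iff.2 hdet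
  obtain ⟨u, rfl⟩ := fderiv_actionMap_surjective hm hG1 hpos hc hy b
  refine hb0 ?_
  suffices u = 0 by rw [this, map_zero]
  have hω : fderiv ℝ (frequencyMap N c G m) y u = 0 := by
    funext i
    rw [← fderiv_frequency hr hm hG hpos hc hD hh he hy u i, ← hessianMatrix_mulVec, hb]
  have hs := (fderiv_circleWeight_comp hm 0 hG hy).2 u
  have hj := (fderiv_circleWeight_comp hm 1 hG hy).2 u
  rw [(fderiv_frequencyMap (N := N) hm hG hpos hc hy u rfl rfl hs.symm hj.symm).1] at hω
  have hM := (circleWeight_pos 0 (contDiff_zero.2 hG.continuous) hpos (y 0)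
    (logNorm m (Fin.tail y))).ne'
  have hE := (circleWeight_pos 1 (contDiff_zero.2 hG.continuous) hpos (y 0)
    (logNorm m (Fin.tail y))).ne'
  have h0 := congrFun hω 0
  have h1 : _ = (0 : Fin n → ℝ) := (Fin.tail_cons _ _).symm.trans (congrArg Fin.tail hω)
  obtain ⟨h2, h3⟩ := kernel_equations hm hy.2 (div_ne_zero (mul_ne_zero hN hE) hM) h1
  simp only [Fin.cons_zero, Pi.zero_apply, mul_eq_zero, neg_eq_zero, div_eq_zero_iff, hN, hc,
    pow_eq_zero_iff, hM, ne_eq, OfNat.ofNat_ne_zero, not_false_eq_true, or_self, false_or] at h0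
  rw [h0, mul_zero, sub_zero] at h2
  unfold kolmogorovDet at hk
  generalize logGrad m (Fin.tail y) ⬝ᵥ Fin.tail u = j' at *
  have h4 : y 0 * circleWeightTwo 1 G (y 0) (logNorm m (Fin.tail y)) * u 0
      + circleWeight 1 (deriv G) (y 0) (logNorm m (Fin.tail y)) * j'
      = circleWeight 1 G (y 0) (logNorm m (Fin.tail y)) * j' := by
    field_simp at h2
    have := (mul_eq_zero.1 (h2.trans (mul_zero _))).resolve_left hN
    linarith
  -- Cramer's rule for the system `h0`, `h4` in the unknowns `u 0` and `j'`.
  have hu : u 0 = 0 := by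
    refine (mul_eq_zero.1 (?_ : (y 0 * _) * u 0 = 0)).resolve_left (mul_ne_zero hy.1.ne' hk)
    linear_combination (circleWeight 1 (deriv G) (y 0) (logNorm m (Fin.tail y))
      - circleWeight 1 G (y 0) (logNorm m (Fin.tail y))) * h0
      - circleWeight 0 (deriv G) (y 0) (logNorm m (Fin.tail y)) * h4
  have hj' : j' = 0 := by
    refine (mul_eq_zero.1 (?_ : _ * j' = 0)).resolve_left hk
    linear_combination circleWeightTwo 0 G (y 0) (logNorm m (Fin.tail y)) * h4
      - circleWeightTwo 1 G (y 0) (logNorm m (Fin.tail y)) * h0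
  exact eq_zero_of_tail hu (h3 hj')

/-- The last row of a kernel equation says that the energy is stationary, which is `j' = -(s / 2)
u₀`. The multiplier `γ` satisfies `γ M = M'` by the first frequency, and this cancels `M'` from the
equation along `W`, leaving again `E' = E j'`. Substituting `j'` gives `s * isoenergeticDet * u₀ =
0`. -/
theorem det_borderedHessian_ne_zero (hr : 2 ≤ r) (hm : m.PosDef) (hG : ContDiff ℝ (2 : ℕ) G)
    (hpos : ∀ t, 0 < G t) (hc : c ≠ 0) (hN : N ≠ 0)
    (hD : IsOpen (actionMap c G m '' actionDomain n))
    (hh : ContDiffOn ℝ r h (actionMap c G m '' actionDomain n))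
    (he : ∀ y ∈ actionDomain n, h (actionMap c G m y) = energyMap N C m y)
    {y : Fin (n + 1) → ℝ} (hy : y ∈ actionDomain n)
    (hk : isoenergeticDet G (y 0) (logNorm m (Fin.tail y)) ≠ 0) :
    (borderedHessian h (actionMap c G m y)).det ≠ 0 := by
  have hG1 : ContDiff ℝ (1 : ℕ∞) G := hG.of_le (by norm_cast)
  have hr1 : 1 ≤ r := le_trans (by norm_num) hr
  intro hdet
  obtain ⟨b, hb0, hb⟩ := Matrix.exists_mulVec_eq_zero_iff.2 hdet
  obtain ⟨hchain, hfreq⟩ := frequency_eq hr1 hm hG1 hpos hc hD hh he hy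
  obtain ⟨u, hu⟩ := fderiv_actionMap_surjective hm hG1 hpos hc hy (b ∘ Sum.inl)
  set γ := b (Sum.inr ()) with hγ
  have hη := (fderiv_energyMap (N := N) (C := C) hm hy).2 u
  have hrow : fderiv ℝ (energyMap N C m) y u = 0 := by
    rw [← hchain, hu, ← frequency_dotProduct]
    have := congrFun hb (Sum.inr ())
    rw [borderedHessian, Matrix.fromBlocks_mulVec, Sum.elim_inr, Pi.add_apply] at this
    simpa [Matrix.mulVec, dotProduct, Matrix.replicateRow] using this
  have hω : fderiv ℝ (frequencyMap N c G m) y u + γ • frequencyMap N c G m y = 0 := by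
    funext i
    have := congrFun hb (Sum.inl i)
    rw [borderedHessian, Matrix.fromBlocks_mulVec, Sum.elim_inl, Pi.add_apply,
      hessianMatrix_mulVec, ← hu, fderiv_frequency hr hm hG hpos hc hD hh he hy u i, hfreq] at this
    simpa [Matrix.mulVec, dotProduct, Matrix.replicateCol, mul_comm] using this
  have hs := (fderiv_circleWeight_comp hm 0 hG hy).2 u
  have hj := (fderiv_circleWeight_comp hm 1 hG hy).2 u
  rw [(fderiv_frequencyMap (N := N) hm hG hpos hc hy u rfl rfl hs.symm hj.symm).1] at hω
  have hM := (circleWeight_pos 0 (contDiff_zero.2 hG.continuous) hpos (y 0)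
    (logNorm m (Fin.tail y))).ne'
  have hE := (circleWeight_pos 1 (contDiff_zero.2 hG.continuous) hpos (y 0)
    (logNorm m (Fin.tail y))).ne'
  have h0 := congrFun hω 0
  have h1 : ∀ i, _ = (0 : ℝ) := fun i => congrFun hω (Fin.succ i)
  simp only [frequencyMap, Pi.add_apply, Pi.smul_apply, Fin.cons_succ, Fin.cons_zero,
    smul_eq_mul, Pi.sub_apply, Pi.zero_apply] at h0 h1
  rw [hη] at hrow
  obtain ⟨h2, h3⟩ := kernel_equations hm hy.2 (U := Fin.tail u)
    (a := N * ((y 0 * circleWeightTwo 1 G (y 0) (logNorm m (Fin.tail y)) * u 0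
        + circleWeight 1 (deriv G) (y 0) (logNorm m (Fin.tail y)) *
          (logGrad m (Fin.tail y) ⬝ᵥ Fin.tail u)) *
        circleWeight 0 G (y 0) (logNorm m (Fin.tail y))
      - circleWeight 1 G (y 0) (logNorm m (Fin.tail y)) *
        (y 0 * circleWeightTwo 0 G (y 0) (logNorm m (Fin.tail y)) * u 0
        + circleWeight 0 (deriv G) (y 0) (logNorm m (Fin.tail y)) *
          (logGrad m (Fin.tail y) ⬝ᵥ Fin.tail u))) /
        circleWeight 0 G (y 0) (logNorm m (Fin.tail y)) ^ 2
      + γ * (N * circleWeight 1 G (y 0) (logNorm m (Fin.tail y)) /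
        circleWeight 0 G (y 0) (logNorm m (Fin.tail y))))
    (div_ne_zero (mul_ne_zero hN hE) hM) (by
      funext i
      simp only [Pi.add_apply, Pi.smul_apply, smul_eq_mul, Pi.sub_apply, Pi.zero_apply]
      linear_combination h1 i)
  unfold isoenergeticDet at hk
  generalize logGrad m (Fin.tail y) ⬝ᵥ Fin.tail u = j' at *
  generalize circleWeight 0 G (y 0) (logNorm m (Fin.tail y)) = M at *
  generalize circleWeight 1 G (y 0) (logNorm m (Fin.tail y)) = E at *
  generalize circleWeight 0 (deriv G) (y 0) (logNorm m (Fin.tail y)) = Mj at *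
  generalize circleWeight 1 (deriv G) (y 0) (logNorm m (Fin.tail y)) = Ej at *
  generalize circleWeightTwo 0 G (y 0) (logNorm m (Fin.tail y)) = Ms at *
  generalize circleWeightTwo 1 G (y 0) (logNorm m (Fin.tail y)) = Es at *
  have hj1 : j' = -(y 0 / 2 * u 0) := by
    have : N * (y 0 / 2 * u 0 + j') = 0 := by linear_combination hrow
    have := (mul_eq_zero.1 this).resolve_left hN
    linarith
  have hγ1 : γ * M = y 0 * Ms * u 0 + Mj * j' := by
    have : N * (γ * M - (y 0 * Ms * u 0 + Mj * j')) = 0 := by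
      have e := congrArg (fun z => c * M ^ 2 * z) h0
      simp only [mul_zero] at e
      rw [← e]
      field_simp
      ring
    have := (mul_eq_zero.1 this).resolve_left hN
    linarith
  have h4 : y 0 * Es * u 0 + Ej * j' - E * j' = 0 := by
    have : N * M * (y 0 * Es * u 0 + Ej * j' - E * j') = 0 := by
      have e := congrArg (fun z => M ^ 2 * z) h2
      simp only [mul_zero] at e
      have e2 : M ^ 2 * (N * ((y 0 * Es * u 0 + Ej * j') * M - E * (y 0 * Ms * u 0 + Mj * j')) /
          M ^ 2 + γ * (N * E / M) - N * E / M * j') =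
          N * ((y 0 * Es * u 0 + Ej * j') * M - E * (y 0 * Ms * u 0 + Mj * j'))
          + N * E * (γ * M) - N * E * M * j' := by
        field_simp
      rw [e2, hγ1] at e
      linear_combination e
    exact (mul_eq_zero.1 this).resolve_left (mul_ne_zero hN hM)
  have hu0 : u 0 = 0 := by
    refine (mul_eq_zero.1 (?_ : (y 0 * _) * u 0 = 0)).resolve_left (mul_ne_zero hy.1.ne' hk)
    rw [hj1] at h4
    linear_combination h4
  have hj0 : j' = 0 := by rw [hj1, hu0]; ring
  have hu' : u = 0 := eq_zero_of_tail hu0 (h3 hj0)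
  have hγ0 : γ = 0 := by
    rw [hu0, hj0] at hγ1
    simpa [hM] using hγ1
  refine hb0 (funext fun i => ?_)
  rcases i with i | i
  · rw [hu', map_zero] at hu
    exact (congrFun hu i).symm
  · exact hγ0

end Determinants

/-! ### Calculus for locally uniform convergence of derivatives. -/

section ConvergenceOfDerivatives

variable {E E' : Type*} [NormedAddCommGroup E] [NormedSpace ℝ E] [NormedAddCommGroup E']
  [NormedSpace ℝ E'] {r : ℕ∞}

/-- On an open set, locally uniform convergence is a limit along the product of `atTop` with a
neighbourhood filter, so sums and products can be treated by ordinary limit rules. -/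
theorem tendstoInCr_iff {S : Set E} (hS : IsOpen S) {f : ℝ → E → ℝ} {fInf : E → ℝ} :
    TendstoInCr r f fInf S ↔ ∀ j : ℕ, (j : ℕ∞) ≤ r → ∀ x ∈ S,
      Tendsto (fun p : ℝ × E => ‖iteratedFDeriv ℝ j (f p.1) p.2 - iteratedFDeriv ℝ j fInf p.2‖)
        (atTop ×ˢ 𝓝 x) (𝓝 0) := by
  refine forall_congr' fun j => imp_congr_right fun _ => ?_
  rw [tendstoLocallyUniformlyOn_iff_filter]
  refine forall_congr' fun x => forall_congr' fun hx => ?_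
  rw [hS.nhdsWithin_eq hx, tendstoUniformlyOnFilter_iff_tendsto, Metric.uniformity_eq_comap_nhds_zero,
    tendsto_comap_iff]
  simp [Function.comp_def, dist_eq_norm, norm_sub_rev]

/-- It is enough to bound the derivatives of the differences. -/
theorem tendstoInCr_of_add {S : Set E} (hS : IsOpen S) {f d : ℝ → E → ℝ} {fInf : E → ℝ}
    (hfd : ∀ᶠ T in atTop, ∀ x ∈ S, f T x = fInf x + d T x) (hf : ContDiffOn ℝ r fInf S)
    (hdr : ∀ᶠ T in atTop, ContDiffOn ℝ r (d T) S)
    (hd : ∀ j : ℕ, (j : ℕ∞) ≤ r → ∀ x ∈ S,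
      Tendsto (fun p : ℝ × E => ‖iteratedFDeriv ℝ j (d p.1) p.2‖) (atTop ×ˢ 𝓝 x) (𝓝 0)) :
    TendstoInCr r f fInf S := by
  rw [tendstoInCr_iff hS]
  intro j hj x hx
  have hj' : (j : WithTop ℕ∞) ≤ r := by exact_mod_cast hj
  refine (hd j hj x hx).congr' ?_
  filter_upwards [(hfd.and hdr).prod_mk (hS.mem_nhds hx)] with p hp
  obtain ⟨⟨h1, h2⟩, h3⟩ := hp
  have e : f p.1 =ᶠ[𝓝 p.2] fInf + d p.1 := by
    filter_upwards [hS.mem_nhds h3] with y hy using h1 y hy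
  rw [(e.iteratedFDeriv ℝ j).eq_of_nhds, iteratedFDeriv_add_apply
    ((hf.contDiffAt (hS.mem_nhds h3)).of_le hj') ((h2.contDiffAt (hS.mem_nhds h3)).of_le hj'),
    add_sub_cancel_left]

/-- Leibniz's bound: the derivatives of `a` have finite limits at `x` by continuity, while those of
`d` tend to zero. -/
theorem tendsto_norm_iteratedFDeriv_mul {S : Set E} (hS : IsOpen S) {a : E → ℝ} {d : ℝ → E → ℝ}
    (ha : ContDiffOn ℝ r a S) (hdr : ∀ᶠ T in atTop, ContDiffOn ℝ r (d T) S)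
    (hd : ∀ j : ℕ, (j : ℕ∞) ≤ r → ∀ x ∈ S,
      Tendsto (fun p : ℝ × E => ‖iteratedFDeriv ℝ j (d p.1) p.2‖) (atTop ×ˢ 𝓝 x) (𝓝 0))
    {j : ℕ} (hj : (j : ℕ∞) ≤ r) {x : E} (hx : x ∈ S) :
    Tendsto (fun p : ℝ × E => ‖iteratedFDeriv ℝ j (fun y => a y * d p.1 y) p.2‖)
      (atTop ×ˢ 𝓝 x) (𝓝 0) := by
  have hj' : (j : WithTop ℕ∞) ≤ r := by exact_mod_cast hj
  have h0 : Tendsto (fun p : ℝ × E => ∑ i ∈ Finset.range (j + 1), (j.choose i : ℝ) *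
      ‖iteratedFDeriv ℝ i a p.2‖ * ‖iteratedFDeriv ℝ (j - i) (d p.1) p.2‖)
      (atTop ×ˢ 𝓝 x) (𝓝 (∑ i ∈ Finset.range (j + 1), (j.choose i : ℝ) *
        ‖iteratedFDeriv ℝ i a x‖ * 0)) := by
    refine tendsto_finsetSum _ fun i hi => ?_
    have hi' : i ≤ j := Nat.lt_succ_iff.1 (Finset.mem_range.1 hi)
    have hir : (i : ℕ∞) ≤ r := le_trans (by exact_mod_cast hi') hj
    have hir' : (i : WithTop ℕ∞) ≤ r := by exact_mod_cast hir
    refine (tendsto_const_nhds.mul ?_).mul (hd (j - i) (le_trans (by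
      exact_mod_cast Nat.sub_le j i) hj) x hx)
    exact (((ha.contDiffAt (hS.mem_nhds hx)).continuousAt_iteratedFDeriv hir').norm.tendsto).comp
      tendsto_snd
  simp only [mul_zero, Finset.sum_const_zero] at h0
  refine squeeze_zero' (Eventually.of_forall fun p => norm_nonneg _) ?_ h0
  filter_upwards [hdr.prod_mk (hS.mem_nhds hx)] with p hp
  have := norm_iteratedFDerivWithin_mul_le ha hp.1 hS.uniqueDiffOn hp.2 hj'
  rw [iteratedFDerivWithin_of_isOpen _ hS hp.2] at this
  refine this.trans (le_of_eq (Finset.sum_congr rfl fun i _ => ?_))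
  rw [iteratedFDerivWithin_of_isOpen _ hS hp.2, iteratedFDerivWithin_of_isOpen _ hS hp.2]

theorem tendsto_norm_iteratedFDeriv_comp (L : E →L[ℝ] E') {S : Set E'} (hS : IsOpen S)
    {d : ℝ → E' → ℝ} (hdr : ∀ᶠ T in atTop, ContDiffOn ℝ r (d T) S)
    (hd : ∀ j : ℕ, (j : ℕ∞) ≤ r → ∀ x ∈ S,
      Tendsto (fun p : ℝ × E' => ‖iteratedFDeriv ℝ j (d p.1) p.2‖) (atTop ×ˢ 𝓝 x) (𝓝 0))
    {j : ℕ} (hj : (j : ℕ∞) ≤ r) {x : E} (hx : L x ∈ S) :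
    Tendsto (fun p : ℝ × E => ‖iteratedFDeriv ℝ j (fun y => d p.1 (L y)) p.2‖)
      (atTop ×ˢ 𝓝 x) (𝓝 0) := by
  have hj' : (j : WithTop ℕ∞) ≤ r := by exact_mod_cast hj
  have hSL : IsOpen (L ⁻¹' S) := hS.preimage L.continuous
  have h0 : Tendsto (fun p : ℝ × E => ‖iteratedFDeriv ℝ j (d p.1) (L p.2)‖ * ∏ _i : Fin j, ‖L‖)
      (atTop ×ˢ 𝓝 x) (𝓝 0) := by
    have := ((hd j hj (L x) hx).comp (tendsto_fst.prodMk (L.continuous.continuousAt.tendsto.comp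
      (tendsto_snd (f := atTop (α := ℝ)) (g := 𝓝 x))))).mul_const (∏ _i : Fin j, ‖L‖)
    rwa [zero_mul] at this
  refine squeeze_zero' (Eventually.of_forall fun p => norm_nonneg _) ?_ h0
  filter_upwards [hdr.prod_mk (hSL.mem_nhds hx)] with p hp
  have h1 := L.iteratedFDerivWithin_comp_right hp.1 hS.uniqueDiffOn hSL.uniqueDiffOn hp.2 hj'
  rw [iteratedFDerivWithin_of_isOpen _ hSL hp.2, iteratedFDerivWithin_of_isOpen _ hS hp.2] at h1
  change ‖iteratedFDeriv ℝ j (d p.1 ∘ L) p.2‖ ≤ _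
  rw [h1]
  exact ContinuousMultilinearMap.norm_compContinuousLinearMap_le _ _

theorem tendsto_norm_iteratedFDeriv_inv_mul {f : E → ℝ} (hf : ContDiff ℝ r f)
    {j : ℕ} (hj : (j : ℕ∞) ≤ r) (x : E) :
    Tendsto (fun p : ℝ × E => ‖iteratedFDeriv ℝ j (fun y => p.1⁻¹ * f y) p.2‖)
      (atTop ×ˢ 𝓝 x) (𝓝 0) := by
  have hj' : (j : WithTop ℕ∞) ≤ r := by exact_mod_cast hj
  have h0 : Tendsto (fun p : ℝ × E => ‖p.1⁻¹‖ * ‖iteratedFDeriv ℝ j f p.2‖) (atTop ×ˢ 𝓝 x)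
      (𝓝 (‖(0 : ℝ)‖ * ‖iteratedFDeriv ℝ j f x‖)) :=
    ((tendsto_inv_atTop_zero.comp tendsto_fst).norm).mul
      ((hf.contDiffAt.continuousAt_iteratedFDeriv hj').norm.tendsto.comp tendsto_snd)
  rw [norm_zero, zero_mul] at h0
  refine h0.congr fun p => ?_
  have : iteratedFDeriv ℝ j (fun y => p.1⁻¹ * f y) p.2 = p.1⁻¹ • iteratedFDeriv ℝ j f p.2 :=
    iteratedFDeriv_const_smul_apply' (a := p.1⁻¹) (f := f) (hf.contDiffAt.of_le hj')
  rw [this, norm_smul]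

end ConvergenceOfDerivatives

/-! ### Convergence of the rescaled Hamiltonians. -/

section LimitHamiltonian

variable {n : ℕ} {k : ℝ} {g : Matrix (Fin n) (Fin n) ℝ} {V : (Fin n → ℝ) → ℝ}

theorem isOpen_thermostatPhaseSpace : IsOpen (thermostatPhaseSpace n) :=
  isOpen_lt continuous_const (by fun_prop)

theorem limitHamiltonian_eq (Ω : ℝ → ℝ) (x : Phase n) :
    limitHamiltonian k g Ω x = 1 / 2 * (((x.1 0) ^ 2)⁻¹ * quad g⁻¹ (Fin.tail x.2))
      + 1 / 2 * Ω (x.1 0) * x.2 0 ^ 2 + n * k * Real.log (x.1 0) := by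
  simp only [limitHamiltonian, thermostatedHamiltonian, mechanicalHamiltonian, quad,
    Matrix.mulVec_smul, smul_dotProduct, dotProduct_smul, smul_eq_mul]
  rw [← inv_pow]
  ring

/-- The rescaling multiplies the particle's kinetic energy and the square of the thermostat momentum
by `T`, and the logarithm contributes `-(log T) / 2`, cancelled by the added constant. After
division by `T` only the mass function and the potential differ from the limit. -/
theorem rescaledHamiltonian_eq (Ω : ℝ → ℝ) (Ω' : ℝ → ℝ) {T : ℝ} (hT : 0 < T) {x : Phase n}
    (hx : x ∈ thermostatPhaseSpace n) :
    rescaledHamiltonian k g V Ω' T x = limitHamiltonian k g Ω x +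
      (1 / 2 * x.2 0 ^ 2 * (Ω' (x.1 0 / √T) - Ω (x.1 0)) + T⁻¹ * V (Fin.tail x.1)) := by
  have hs : 0 < √T := Real.sqrt_pos.2 hT
  have hx0 : 0 < x.1 0 := hx
  rw [limitHamiltonian_eq]
  simp only [rescaledHamiltonian, rescaling, thermostatedHamiltonian, mechanicalHamiltonian, quad,
    Matrix.mulVec_smul, smul_dotProduct, dotProduct_smul, smul_eq_mul, Fin.cons_zero,
    Fin.tail_cons]
  rw [Real.log_div hx0.ne' hs.ne', Real.log_sqrt hT.le, inv_div, mul_pow, Real.sq_sqrt hT.le]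
  have e : √T / x.1 0 * (√T / x.1 0 * (Fin.tail x.2 ⬝ᵥ g⁻¹.mulVec (Fin.tail x.2))) =
      T * (((x.1 0) ^ 2)⁻¹ * (Fin.tail x.2 ⬝ᵥ g⁻¹.mulVec (Fin.tail x.2))) := by
    conv_rhs => rw [← Real.sq_sqrt hT.le]
    field_simp
  rw [e]
  field_simp
  ring

theorem contDiffOn_limitHamiltonian {r : ℕ∞} {Ω : ℝ → ℝ} (hΩ : ContDiffOn ℝ r Ω (Ioi 0)) :
    ContDiffOn ℝ r (limitHamiltonian k g Ω) (thermostatPhaseSpace n) := by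
  have e : limitHamiltonian k g Ω = fun x : Phase n =>
      1 / 2 * (((x.1 0) ^ 2)⁻¹ * quad g⁻¹ (Fin.tail x.2))
      + 1 / 2 * Ω (x.1 0) * x.2 0 ^ 2 + n * k * Real.log (x.1 0) :=
    funext fun x => limitHamiltonian_eq Ω x
  rw [e]
  have h0 : ContDiffOn ℝ r (fun x : Phase n => x.1 0) (thermostatPhaseSpace n) := by fun_prop
  have h1 : ContDiffOn ℝ r (fun x : Phase n => x.2 0) (thermostatPhaseSpace n) := by fun_prop
  have hne : ∀ x ∈ thermostatPhaseSpace n, x.1 0 ≠ 0 := fun x hx => (show 0 < x.1 0 from hx).ne'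
  have hq : ContDiffOn ℝ r (fun x : Phase n => quad g⁻¹ (Fin.tail x.2)) (thermostatPhaseSpace n) :=
    ((contDiff_quad g⁻¹).comp contDiff_tail_snd).contDiffOn
  refine ((contDiffOn_const.mul (((h0.pow 2).inv fun x hx => pow_ne_zero 2 (hne x hx)).mul hq)).add
    ((contDiffOn_const.mul (hΩ.comp h0 fun x hx => hx)).mul (h1.pow 2))).add
    (contDiffOn_const.mul (h0.log hne))

/-- The rescaled Hamiltonians converge to the limit Hamiltonian. -/
theorem tendstoInCr_rescaledHamiltonian {r : ℕ∞} (hV : ContDiff ℝ r V) {ΩT : ℝ → ℝ → ℝ}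
    (hΩT : ∀ T, 0 < T → ContDiffOn ℝ r (ΩT T) (Ioi 0)) {Ω : ℝ → ℝ}
    (hΩ : ContDiffOn ℝ r Ω (Ioi 0))
    (hlim : TendstoInCr r (fun T s => ΩT T (s / √T)) Ω (Ioi 0)) :
    TendstoInCr r (fun T => rescaledHamiltonian k g V (ΩT T) T) (limitHamiltonian k g Ω)
      (thermostatPhaseSpace n) := by
  set d : ℝ → ℝ → ℝ := fun T s => ΩT T (s / √T) - Ω s with hd
  set L : Phase n →L[ℝ] ℝ := (ContinuousLinearMap.proj (R := ℝ) (φ := fun _ : Fin (n + 1) => ℝ)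
    0).comp (ContinuousLinearMap.fst ℝ _ (Fin (n + 1) → ℝ)) with hL
  have hR : ∀ T, 0 < T → ContDiffOn ℝ r (fun s => ΩT T (s / √T)) (Ioi 0) := fun T hT =>
    (hΩT T hT).comp (by fun_prop) fun s hs => div_pos hs (Real.sqrt_pos.2 hT)
  have hdr : ∀ᶠ T in atTop, ContDiffOn ℝ r (d T) (Ioi 0) := by
    filter_upwards [eventually_gt_atTop 0] with T hT using (hR T hT).sub hΩ
  have hd0 : ∀ j : ℕ, (j : ℕ∞) ≤ r → ∀ x ∈ Ioi (0 : ℝ),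
      Tendsto (fun p : ℝ × ℝ => ‖iteratedFDeriv ℝ j (d p.1) p.2‖) (atTop ×ˢ 𝓝 x) (𝓝 0) := by
    intro j hj x hx
    have hj' : (j : WithTop ℕ∞) ≤ r := by exact_mod_cast hj
    refine ((tendstoInCr_iff isOpen_Ioi).1 hlim j hj x hx).congr' ?_
    filter_upwards [(eventually_gt_atTop 0).prod_mk (isOpen_Ioi.mem_nhds hx)] with p hp
    exact congrArg norm (fun_iteratedFDeriv_sub_apply
      (((hR p.1 hp.1).contDiffAt (isOpen_Ioi.mem_nhds hp.2)).of_le hj')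
      ((hΩ.contDiffAt (isOpen_Ioi.mem_nhds hp.2)).of_le hj')).symm
  have hdL : ∀ᶠ T in atTop, ContDiffOn ℝ r (fun x : Phase n => d T (L x))
      (thermostatPhaseSpace n) := by
    filter_upwards [hdr] with T hT
    exact hT.comp L.contDiff.contDiffOn fun x hx => hx
  have ha : ContDiffOn ℝ r (fun x : Phase n => 1 / 2 * x.2 0 ^ 2) (thermostatPhaseSpace n) := by
    fun_prop
  have hVt : ContDiff ℝ r fun x : Phase n => V (Fin.tail x.1) := hV.comp contDiff_tail_fst
  have hmul : ∀ᶠ T in atTop, ContDiffOn ℝ r (fun x : Phase n => 1 / 2 * x.2 0 ^ 2 * d T (L x))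
      (thermostatPhaseSpace n) := by
    filter_upwards [hdL] with T hT using ha.mul hT
  have hinv : ∀ T : ℝ, ContDiff ℝ r fun x : Phase n => T⁻¹ * V (Fin.tail x.1) := fun T =>
    contDiff_const.mul hVt
  refine tendstoInCr_of_add isOpen_thermostatPhaseSpace
    (d := fun T x => 1 / 2 * x.2 0 ^ 2 * d T (L x) + T⁻¹ * V (Fin.tail x.1)) ?_
    (contDiffOn_limitHamiltonian hΩ) ?_ fun j hj x hx => ?_
  · filter_upwards [eventually_gt_atTop 0] with T hT x hx using rescaledHamiltonian_eq Ω _ hT hx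
  · filter_upwards [hmul] with T hT using hT.add (hinv T).contDiffOn
  · have hj' : (j : WithTop ℕ∞) ≤ r := by exact_mod_cast hj
    have h1 := tendsto_norm_iteratedFDeriv_mul isOpen_thermostatPhaseSpace ha hdL
      (fun j hj x hx => tendsto_norm_iteratedFDeriv_comp L isOpen_Ioi hdr hd0 hj hx) hj hx
    have h2 := h1.add (tendsto_norm_iteratedFDeriv_inv_mul hVt hj x)
    rw [add_zero] at h2
    refine squeeze_zero' (Eventually.of_forall fun p => norm_nonneg _) ?_ h2
    filter_upwards [hmul.prod_mk (isOpen_thermostatPhaseSpace.mem_nhds hx)] with p hp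
    rw [fun_iteratedFDeriv_add_apply
      ((hp.1.contDiffAt (isOpen_thermostatPhaseSpace.mem_nhds hp.2)).of_le hj')
      ((hinv p.1).contDiffAt.of_le hj')]
    exact norm_add_le _ _

end LimitHamiltonian

/-! ### The open set of non-degenerate points and its closure. -/

section NondegenerateSet

variable {n : ℕ} {k : ℝ} {g : Matrix (Fin n) (Fin n) ℝ} {r : ℕ∞} {Ω : ℝ → ℝ} {c N ℓ : ℝ}

theorem natCast_le_coe {d : ℕ} (h : (d : ℕ∞) ≤ r) : (d : WithTop ℕ∞) ≤ r := by
  exact_mod_cast h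

/-- The quotient `σ / √Ω(σ)` as a function of the logarithm of `σ`. -/
noncomputable def massQuotient (Ω : ℝ → ℝ) (ℓ t : ℝ) : ℝ :=
  Real.exp (t - ℓ) / √(Ω (Real.exp (t - ℓ)))

theorem massQuotient_pos (hΩpos : ∀ s, 0 < s → 0 < Ω s) (t : ℝ) : 0 < massQuotient Ω ℓ t :=
  div_pos (Real.exp_pos _) (Real.sqrt_pos.2 (hΩpos _ (Real.exp_pos _)))

theorem contDiff_massQuotient (hΩ : ContDiffOn ℝ r Ω (Ioi 0)) (hΩpos : ∀ s, 0 < s → 0 < Ω s) :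
    ContDiff ℝ r (massQuotient Ω ℓ) := by
  have he : ContDiff ℝ r fun t : ℝ => Real.exp (t - ℓ) := by fun_prop
  have h1 : ContDiff ℝ r fun t : ℝ => Ω (Real.exp (t - ℓ)) := by
    rw [← contDiffOn_univ]
    exact hΩ.comp he.contDiffOn fun t _ => Real.exp_pos _
  exact he.div (h1.sqrt fun t => (hΩpos _ (Real.exp_pos _)).ne') fun t =>
    (Real.sqrt_pos.2 (hΩpos _ (Real.exp_pos _))).ne'

theorem exp_two_mul_logNorm {m : Matrix (Fin n) (Fin n) ℝ} (hm : m.PosDef) {W : Fin n → ℝ}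
    (hW : W ≠ 0) : Real.exp (2 * logNorm m W) = quad m W := by
  rw [logNorm, ← mul_assoc, show (2 : ℝ) * (1 / 2) = 1 by norm_num, one_mul,
    Real.exp_log (quad_pos hm hW)]

/-- The limit Hamiltonian in the coordinates `((φ, w), (s, W))`. -/
theorem limitHamiltonian_positionMap (hm : (g⁻¹).PosDef) (hΩpos : ∀ s, 0 < s → 0 < Ω s)
    (hN : N = n * k) (hN0 : 0 < N) (hc : c ^ 2 = N / 2) (hℓ : ℓ = 1 / 2 * Real.log N)
    {b : Phase n} (hb : Fin.tail b.2 ≠ 0) :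
    limitHamiltonian k g Ω (positionMap c ℓ (massQuotient Ω ℓ) g⁻¹ b) =
      energyMap N (N / 2 - N * ℓ) g⁻¹ b.2 := by
  rw [limitHamiltonian_eq]
  simp only [positionMap, Fin.cons_zero, Fin.tail_cons, ← exp_two_mul_logNorm hm hb, ← hN]
  unfold energyMap thermostatMomentum thermostatPosition logPosition massQuotient chartPoint
  simp only
  set j := logNorm g⁻¹ (Fin.tail b.2)
  have hS := exp_rootExcess (b.2 0 * Real.cos (b.1 0))
  set x := rootExcess (b.2 0 * Real.cos (b.1 0))
  have hσ := Real.exp_pos (j - x / 2 - ℓ)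
  -- The exponent is `x + 2 ℓ`, and `ℓ` is chosen so that `e^(2 ℓ) = N`.
  have e1 : (Real.exp (j - x / 2 - ℓ) ^ 2)⁻¹ * Real.exp (2 * j) = N * Real.exp x := by
    conv_rhs => rw [← Real.exp_log hN0]
    rw [← Real.exp_nat_mul, ← Real.exp_neg, ← Real.exp_add, ← Real.exp_add]
    congr 1
    rw [hℓ]
    push_cast
    ring
  -- The constant `c ^ 2 = N / 2` gives the two squares `s cos φ` and `s sin φ` the same coefficient
  -- `N / 4` in the energy.
  have hΩσ := hΩpos _ hσ
  have e2 : Ω (Real.exp (j - x / 2 - ℓ)) * (c * (b.2 0 * Real.sin (b.1 0) *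
      (Real.exp (j - x / 2 - ℓ) / √(Ω (Real.exp (j - x / 2 - ℓ)))) /
        Real.exp (j - x / 2 - ℓ))) ^ 2 = N / 2 * (b.2 0 * Real.sin (b.1 0)) ^ 2 := by
    rw [← hc]
    have hs := Real.sqrt_pos.2 hΩσ
    nth_rewrite 1 [← Real.sq_sqrt hΩσ.le]
    generalize Real.exp (j - x / 2 - ℓ) = σ at *
    field_simp
  rw [e1, mul_assoc (1 / 2 : ℝ), e2, Real.log_exp]
  have sc := Real.sin_sq_add_cos_sq (b.1 0)
  linear_combination N / 2 * hS + N / 4 * b.2 0 ^ 2 * sc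

/-- The square of the coordinate `s`, as a function of the phase point. -/
noncomputable def radiusSq (k : ℝ) (g : Matrix (Fin n) (Fin n) ℝ) (Ω : ℝ → ℝ) (N ℓ : ℝ)
    (P : Phase n) : ℝ :=
  4 / N * (limitHamiltonian k g Ω P - (N / 2 - N * ℓ)) - 4 * logNorm g⁻¹ (Fin.tail P.2)

theorem radiusSq_positionMap (hm : (g⁻¹).PosDef) (hΩpos : ∀ s, 0 < s → 0 < Ω s)
    (hN : N = n * k) (hN0 : 0 < N) (hc : c ^ 2 = N / 2) (hℓ : ℓ = 1 / 2 * Real.log N)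
    {b : Phase n} (hb : Fin.tail b.2 ≠ 0) :
    radiusSq k g Ω N ℓ (positionMap c ℓ (massQuotient Ω ℓ) g⁻¹ b) = b.2 0 ^ 2 := by
  rw [radiusSq, limitHamiltonian_positionMap hm hΩpos hN hN0 hc hℓ hb, energyMap]
  simp only [positionMap, Fin.tail_cons]
  field_simp
  ring

theorem exists_positionMap_eq (hΩpos : ∀ s, 0 < s → 0 < Ω s) (hc : c ≠ 0)
    {P : Phase n} (hP : P ∈ thermostatPhaseSpace n) :
    ∃ b : Phase n, positionMap c ℓ (massQuotient Ω ℓ) g⁻¹ b = P ∧ 0 ≤ b.2 0 ∧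
      Fin.tail b.2 = Fin.tail P.2 := by
  have hσ : 0 < P.1 0 := hP
  set j := logNorm g⁻¹ (Fin.tail P.2) with hj
  -- The real part solves `log σ = j - x / 2 - ℓ` for `S`, and the imaginary part solves the
  -- momentum formula for `Y`. Modulus and argument are then valid polar coordinates even at `s =
  -- 0`.
  set z : ℂ := ⟨excessRoot (2 * (j - ℓ - Real.log (P.1 0))), P.2 0 * √(Ω (P.1 0)) / c⟩ with hz
  refine ⟨(Fin.cons z.arg (Fin.tail P.1), Fin.cons ‖z‖ (Fin.tail P.2)), ?_, by simp, by simp⟩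
  have hτ : logPosition (z.arg, ‖z‖, j) = ℓ + Real.log (P.1 0) := by
    simp only [logPosition, Complex.norm_mul_cos_arg, hz, rootExcess_excessRoot]
    ring
  have hpos : thermostatPosition ℓ (z.arg, ‖z‖, j) = P.1 0 := by
    rw [thermostatPosition, hτ, add_sub_cancel_left, Real.exp_log hσ]
  have hmom : c * thermostatMomentum ℓ (massQuotient Ω ℓ) (z.arg, ‖z‖, j) = P.2 0 := by
    have hs := Real.sqrt_pos.2 (hΩpos _ hσ)
    rw [thermostatMomentum, hpos, hτ, massQuotient, add_sub_cancel_left, Real.exp_log hσ]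
    simp only [Complex.norm_mul_sin_arg, hz]
    field_simp
  simp only [positionMap, chartPoint, Fin.cons_zero, Fin.tail_cons, ← hj, hpos, hmom]
  rw [Fin.cons_self_tail, Fin.cons_self_tail]

/-- The points at which the chart exists and both determinants do not vanish. -/
def nondegenerateSet (k : ℝ) (g : Matrix (Fin n) (Fin n) ℝ) (Ω : ℝ → ℝ) (N ℓ : ℝ) :
    Set (Phase n) :=
  {P | P ∈ thermostatPhaseSpace n ∧ Fin.tail P.2 ≠ 0} ∩
    (fun P => (√(radiusSq k g Ω N ℓ P), logNorm g⁻¹ (Fin.tail P.2))) ⁻¹'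
      {q | 0 < q.1 ∧ kolmogorovDet (massQuotient Ω ℓ) q.1 q.2 ≠ 0 ∧
        isoenergeticDet (massQuotient Ω ℓ) q.1 q.2 ≠ 0}

theorem isOpen_nondegenerateSet (hm : (g⁻¹).PosDef) (hr : 2 ≤ r)
    (hΩ : ContDiffOn ℝ r Ω (Ioi 0)) (hΩpos : ∀ s, 0 < s → 0 < Ω s) :
    IsOpen (nondegenerateSet k g Ω N ℓ) := by
  have hG : ContDiff ℝ (2 : ℕ) (massQuotient Ω ℓ) :=
    (contDiff_massQuotient hΩ hΩpos).of_le (natCast_le_coe (d := 2) hr)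
  have htail : Continuous fun P : Phase n => Fin.tail P.2 :=
    (tailCLM n).continuous.comp continuous_snd
  have hj : ContinuousOn (fun P : Phase n => logNorm g⁻¹ (Fin.tail P.2))
      {P | P ∈ thermostatPhaseSpace n ∧ Fin.tail P.2 ≠ 0} := fun P hP =>
    (ContinuousAt.comp (g := logNorm g⁻¹) (f := fun P : Phase n => Fin.tail P.2)
      (contDiffAt_logNorm (r := 0) hm hP.2).continuousAt htail.continuousAt).continuousWithinAt
  have hF : ContinuousOn (limitHamiltonian k g Ω)
      {P | P ∈ thermostatPhaseSpace n ∧ Fin.tail P.2 ≠ 0} :=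
    (contDiffOn_limitHamiltonian hΩ).continuousOn.mono fun P hP => hP.1
  refine ContinuousOn.isOpen_inter_preimage ?_ (isOpen_thermostatPhaseSpace.inter
    (isOpen_ne_fun htail continuous_const)) ?_
  -- The real square root is continuous everywhere, and its positivity on the set forces `radiusSq`
  -- to be positive there.
  · exact (((hF.sub continuousOn_const).const_mul _).sub (hj.const_mul _)).sqrt.prodMk hj
  · exact (isOpen_lt continuous_const continuous_fst).inter
      ((isOpen_ne_fun (continuous_kolmogorovDet hG) continuous_const).inter
        (isOpen_ne_fun (continuous_isoenergeticDet hG) continuous_const))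

theorem nondegenerate_of_mem (hm : (g⁻¹).PosDef) (hr : 2 ≤ r)
    (hΩ : ContDiffOn ℝ r Ω (Ioi 0)) (hΩpos : ∀ s, 0 < s → 0 < Ω s)
    (hN : N = n * k) (hN0 : 0 < N) (hℓ : ℓ = 1 / 2 * Real.log N)
    {P : Phase n} (hP : P ∈ nondegenerateSet k g Ω N ℓ) :
    KolmogorovNondegenerateAt r (limitHamiltonian k g Ω) P ∧
      IsoenergeticallyNondegenerateAt r (limitHamiltonian k g Ω) P := by
  obtain ⟨⟨hP1, hP2⟩, hP3, hP4, hP5⟩ := hP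
  have hc0 : 0 < √(N / 2) := Real.sqrt_pos.2 (by positivity)
  have hc : √(N / 2) ^ 2 = N / 2 := Real.sq_sqrt (by positivity)
  have hGr := contDiff_massQuotient (ℓ := ℓ) hΩ hΩpos
  have hG : ContDiff ℝ (2 : ℕ) (massQuotient Ω ℓ) := hGr.of_le (natCast_le_coe (d := 2) hr)
  have hpos := massQuotient_pos (ℓ := ℓ) hΩpos
  have hr1 : 1 ≤ r := le_trans (by norm_num) hr
  obtain ⟨b, rfl, hb0, hb⟩ := exists_positionMap_eq (g := g) (ℓ := ℓ) hΩpos hc0.ne' hP1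
  rw [← hb] at hP2
  simp only [radiusSq_positionMap hm hΩpos hN hN0 hc hℓ hP2, ← hb, Real.sqrt_sq hb0] at hP3 hP4 hP5
  have hη : ContDiffOn ℝ r (energyMap N (N / 2 - N * ℓ) g⁻¹) (actionDomain n) := by
    intro y hy
    have h1 : ContDiffAt ℝ r (fun y : Fin (n + 1) → ℝ => logNorm g⁻¹ (Fin.tail y)) y :=
      ContDiffAt.comp (g := logNorm g⁻¹) (f := Fin.tail) y (contDiffAt_logNorm hm hy.2)
        (tailCLM n).contDiff.contDiffAt
    have h2 : ContDiffAt ℝ r (fun y : Fin (n + 1) → ℝ => y 0 ^ 2 / 4) y := by fun_prop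
    exact ((contDiffAt_const.mul (h1.add h2)).add contDiffAt_const).contDiffWithinAt
  obtain ⟨Φ, h, hchart, hΦ, he⟩ := exists_isActionAngleChart (ℓ := ℓ) hr1 hm hGr hpos hc0.ne' hη
    fun b hb => limitHamiltonian_positionMap hm hΩpos hN hN0 hc hℓ hb.2
  have hmem : b ∈ chartDomain n := ⟨hP3, hP2⟩
  have hy : b.2 ∈ actionDomain n := hmem
  refine ⟨⟨_, Φ, h, (angleActionMap √(N / 2) (massQuotient Ω ℓ) g⁻¹ b).1, _, hchart,
    ⟨b.2, hy, rfl⟩, hΦ b hmem, ?_⟩, ⟨_, Φ, h,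
    (angleActionMap √(N / 2) (massQuotient Ω ℓ) g⁻¹ b).1, _, hchart,
    ⟨b.2, hy, rfl⟩, hΦ b hmem, ?_⟩⟩
  · exact det_hessianMatrix_ne_zero hr hm hG hpos hc0.ne' hN0.ne' hchart.isOpen
      hchart.contDiffOn_h he hy hP4
  · exact det_borderedHessian_ne_zero hr hm hG hpos hc0.ne' hN0.ne' hchart.isOpen
      hchart.contDiffOn_h he hy hP5

theorem fderiv_eq_of_hasDerivAt_line {E : Type*} [NormedAddCommGroup E] [NormedSpace ℝ E]
    {F : E → ℝ} {P v : E} {d : ℝ} (hF : DifferentiableAt ℝ F P)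
    (h : HasDerivAt (fun t : ℝ => F (P + t • v)) d 0) : fderiv ℝ F P v = d := by
  have h1 : HasFDerivAt F (fderiv ℝ F P) (P + (0 : ℝ) • v) := by simpa using hF.hasFDerivAt
  have h2 : HasDerivAt (fun t : ℝ => P + t • v) v 0 := by
    simpa using ((hasDerivAt_id (0 : ℝ)).smul_const v).const_add P
  exact (h1.comp_hasDerivAt 0 h2).unique h

theorem thermostaticEquilibria_limitHamiltonian (hr : 1 ≤ r)
    (hΩ : ContDiffOn ℝ r Ω (Ioi 0)) (hΩpos : ∀ s, 0 < s → 0 < Ω s) {P : Phase n}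
    (hP : P ∈ thermostaticEquilibria (limitHamiltonian k g Ω)) :
    0 < P.1 0 ∧ P.2 0 = 0 ∧ quad g⁻¹ (Fin.tail P.2) = n * k * P.1 0 ^ 2 := by
  obtain ⟨hP0, h1, h2⟩ := hP
  have hσ : 0 < P.1 0 := hP0
  have one : ((r : ℕ∞) : WithTop ℕ∞) ≠ 0 := by
    intro h
    have h' : r = 0 := by exact_mod_cast h
    simp [h'] at hr
  have hF : DifferentiableAt ℝ (limitHamiltonian k g Ω) P :=
    ((contDiffOn_limitHamiltonian hΩ).contDiffAt
      (isOpen_thermostatPhaseSpace.mem_nhds hP0)).differentiableAt one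
  have htail : ∀ t : ℝ, Fin.tail (t • (Pi.single 0 1 : Fin (n + 1) → ℝ)) = 0 := fun t => by
    ext i
    simp [Fin.tail]
  have hsum : ∀ (u v : Fin (n + 1) → ℝ), Fin.tail (u + v) = Fin.tail u + Fin.tail v :=
    fun u v => rfl
  have e1 : fderiv ℝ (limitHamiltonian k g Ω) P (0, Pi.single 0 1) = Ω (P.1 0) * P.2 0 := by
    refine fderiv_eq_of_hasDerivAt_line hF ?_
    simp only [limitHamiltonian_eq, Prod.fst_add, Prod.snd_add, Prod.smul_fst, Prod.smul_snd,
      smul_zero, add_zero, hsum, htail, Pi.add_apply, Pi.zero_apply, Pi.smul_apply, Pi.single_eq_same,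
      smul_eq_mul, mul_one]
    have := ((((hasDerivAt_id (0 : ℝ)).const_add (P.2 0)).pow 2).const_mul
      (1 / 2 * Ω (P.1 0))).const_add (1 / 2 * (((P.1 0) ^ 2)⁻¹ * quad g⁻¹ (Fin.tail P.2)))
      |>.add_const (n * k * Real.log (P.1 0))
    refine this.congr_deriv ?_
    simp
    ring
  have hmom0 : P.2 0 = 0 := (mul_eq_zero.1 (e1.symm.trans h1)).resolve_left (hΩpos _ hσ).ne'
  have e2 : fderiv ℝ (limitHamiltonian k g Ω) P (Pi.single 0 1, 0) =
      -(((P.1 0) ^ 3)⁻¹ * quad g⁻¹ (Fin.tail P.2)) + n * k * (P.1 0)⁻¹ := by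
    refine fderiv_eq_of_hasDerivAt_line hF ?_
    simp only [limitHamiltonian_eq, Prod.fst_add, Prod.snd_add, Prod.smul_fst, Prod.smul_snd,
      smul_zero, add_zero, Pi.add_apply, Pi.zero_apply, Pi.smul_apply, Pi.single_eq_same,
      smul_eq_mul, mul_one, hmom0, ne_eq, OfNat.ofNat_ne_zero, not_false_eq_true, zero_pow, mul_zero]
    have hid := (hasDerivAt_id (0 : ℝ)).const_add (P.1 0)
    have hne : P.1 0 + id (0 : ℝ) ≠ 0 := by simpa using hσ.ne'
    have := ((((hid.pow 2).inv (pow_ne_zero 2 hne)).mul_const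
      (quad g⁻¹ (Fin.tail P.2))).const_mul (1 / 2 : ℝ)).add ((hid.log hne).const_mul (n * k : ℝ))
    refine this.congr_deriv ?_
    simp
    field_simp
  refine ⟨hσ, hmom0, ?_⟩
  rw [e2] at h2
  field_simp at h2
  linarith

theorem logNorm_exp_smul {m : Matrix (Fin n) (Fin n) ℝ} (hm : m.PosDef) {W : Fin n → ℝ}
    (hW : W ≠ 0) (a : ℝ) : logNorm m (Real.exp a • W) = a + logNorm m W := by
  have e : quad m (Real.exp a • W) = Real.exp (2 * a) * quad m W := by
    simp only [quad, Matrix.mulVec_smul, smul_dotProduct, dotProduct_smul, smul_eq_mul]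
    rw [two_mul, Real.exp_add, mul_assoc]
  rw [logNorm, e, Real.log_mul (Real.exp_pos _).ne' (quad_pos hm hW).ne', Real.log_exp, logNorm]
  ring

/-- An equilibrium is a point `s = 0` with `W ≠ 0`. The angle-action chart is not available there,
but `positionMap` is still continuous, so the equilibrium is approached by points with small radius
and slightly rescaled `W`, chosen by `exists_nondegenerate_near`. -/
theorem thermostaticEquilibria_subset_closure (hm : (g⁻¹).PosDef) (hr : 4 ≤ r)
    (hΩ : ContDiffOn ℝ r Ω (Ioi 0)) (hΩpos : ∀ s, 0 < s → 0 < Ω s)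
    (hN : N = n * k) (hN0 : 0 < N) (hℓ : ℓ = 1 / 2 * Real.log N) :
    thermostaticEquilibria (limitHamiltonian k g Ω) ⊆ closure (nondegenerateSet k g Ω N ℓ) := by
  intro P hP
  obtain ⟨hσ, hmom0, hq⟩ :=
    thermostaticEquilibria_limitHamiltonian (le_trans (by norm_num) hr) hΩ hΩpos hP
  rw [← hN] at hq
  have hW : Fin.tail P.2 ≠ 0 := by
    intro h
    have h0 : quad g⁻¹ (Fin.tail P.2) = 0 := by simp [h, quad]
    rw [h0] at hq
    exact (mul_pos hN0 (pow_pos hσ 2)).ne hq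
  set W := Fin.tail P.2 with hWdef
  have hc : √(N / 2) ^ 2 = N / 2 := Real.sq_sqrt (by positivity)
  have hG : ContDiff ℝ (4 : ℕ) (massQuotient Ω ℓ) :=
    (contDiff_massQuotient hΩ hΩpos).of_le (natCast_le_coe (d := 4) hr)
  have hpos := massQuotient_pos (ℓ := ℓ) hΩpos
  -- The angle is frozen at `0`; the parameters are the radius and the increment of `log |W|` along
  -- the ray of `W`.
  let b : ℝ × ℝ → Phase n := fun q =>
    (Fin.cons 0 (Fin.tail P.1), Fin.cons q.1 (Real.exp q.2 • W))
  let ψ : ℝ × ℝ → Phase n := fun q => positionMap √(N / 2) ℓ (massQuotient Ω ℓ) g⁻¹ (b q)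
  have hbψ : ∀ q, ψ q = (Fin.cons (thermostatPosition ℓ (0, q.1, q.2 + logNorm g⁻¹ W))
      (Fin.tail P.1), Fin.cons (√(N / 2) * thermostatMomentum ℓ (massQuotient Ω ℓ)
        (0, q.1, q.2 + logNorm g⁻¹ W)) (Real.exp q.2 • W)) := by
    intro q
    simp only [ψ, b, positionMap, chartPoint, Fin.cons_zero, Fin.tail_cons,
      logNorm_exp_smul hm hW]
  have hψ : Continuous ψ := by
    rw [funext hbψ]
    have hp : Continuous (thermostatPosition ℓ) := (contDiff_thermostatPosition (r := 0) ℓ).continuous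
    have hmom : Continuous (thermostatMomentum ℓ (massQuotient Ω ℓ)) :=
      (contDiff_thermostatMomentum (r := 0) ℓ (hG.of_le (by simp))).continuous
    refine Continuous.prodMk (Continuous.finCons (A := fun _ => ℝ) ?_ continuous_const)
      (Continuous.finCons (A := fun _ => ℝ) ?_ (by fun_prop))
    · exact hp.comp (by fun_prop)
    · exact continuous_const.mul (hmom.comp (by fun_prop))
  -- At radius zero the position is `e^(j - ℓ)`, which is the equilibrium relation `|W| ^ 2 = N σ ^
  -- 2`.
  have hψ0 : ψ (0, 0) = P := by
    rw [hbψ]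
    have h1 : thermostatPosition ℓ (0, 0, 0 + logNorm g⁻¹ W) = P.1 0 := by
      simp only [thermostatPosition, logPosition, zero_mul, rootExcess_zero, zero_div, sub_zero,
        zero_add, logNorm, hq, hℓ]
      rw [Real.log_mul hN0.ne' (pow_pos hσ 2).ne', Real.log_pow, ← mul_sub, add_sub_cancel_left]
      push_cast
      rw [← mul_assoc, show (1 / 2 : ℝ) * 2 = 1 by norm_num, one_mul, Real.exp_log hσ]
    simp only [h1, thermostatMomentum, Real.sin_zero, mul_zero, zero_mul, zero_div, Real.exp_zero,
      one_smul]
    rw [Fin.cons_self_tail, ← hmom0, hWdef, Fin.cons_self_tail]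
  rw [mem_closure_iff_nhds]
  intro O hO
  have hO' : ψ ⁻¹' O ∈ 𝓝 ((0, 0) : ℝ × ℝ) := hψ.continuousAt.preimage_mem_nhds (by rwa [hψ0])
  obtain ⟨ε, hε, hεO⟩ := Metric.mem_nhds_iff.1 hO'
  obtain ⟨s, j, hs0, hsε, hjε, hk, hi⟩ := exists_nondegenerate_near hG hpos (logNorm g⁻¹ W) hε
  refine ⟨ψ (s, j - logNorm g⁻¹ W), hεO ?_, ?_⟩
  · rw [Metric.mem_ball, Prod.dist_eq, Real.dist_eq, Real.dist_eq]
    refine max_lt ?_ ?_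
    · simpa [abs_of_pos hs0] using hsε
    · simpa using hjε
  · have hne : Real.exp (j - logNorm g⁻¹ W) • W ≠ 0 := smul_ne_zero (Real.exp_pos _).ne' hW
    have hb2 : Fin.tail (b (s, j - logNorm g⁻¹ W)).2 ≠ 0 := by simpa [b] using hne
    have hrad := radiusSq_positionMap (c := √(N / 2)) hm hΩpos hN hN0 hc hℓ hb2
    have htail : Fin.tail (ψ (s, j - logNorm g⁻¹ W)).2 = Real.exp (j - logNorm g⁻¹ W) • W := by
      rw [hbψ]
      simp
    have hj : logNorm g⁻¹ (Fin.tail (ψ (s, j - logNorm g⁻¹ W)).2) = j := by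
      rw [htail, logNorm_exp_smul hm hW, sub_add_cancel]
    have hu : √(radiusSq k g Ω N ℓ (ψ (s, j - logNorm g⁻¹ W))) = s := by
      change √(radiusSq k g Ω N ℓ (positionMap _ _ _ _ _)) = s
      rw [hrad]
      exact Real.sqrt_sq hs0.le
    refine ⟨⟨?_, htail ▸ hne⟩, ?_⟩
    · rw [hbψ]
      exact Real.exp_pos _
    · simp only [mem_preimage, mem_ofPred_eq, hu, hj]
      exact ⟨hs0, hk, hi⟩

end NondegenerateSet

theorem theorem4 (n : ℕ) (hn : 1 ≤ n) (r : ℕ∞) (hr : ((2 * n + 2 : ℕ) : ℕ∞) < r)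
    (k : ℝ) (hk : 0 < k)
    (g : Matrix (Fin n) (Fin n) ℝ) (hg : g.PosDef)
    (V : (Fin n → ℝ) → ℝ) (hV : ContDiff ℝ r V)
    (hVper : ∀ (m : Fin n → ℤ) (q : Fin n → ℝ), V (fun i => q i + m i) = V q)
    (ΩT : ℝ → ℝ → ℝ)
    (hΩT : ∀ T, 0 < T → ContDiffOn ℝ r (ΩT T) (Ioi 0) ∧ ∀ s, 0 < s → 0 < ΩT T s)
    (Ω : ℝ → ℝ) (hΩ : ContDiffOn ℝ r Ω (Ioi 0)) (hΩpos : ∀ s, 0 < s → 0 < Ω s)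
    (hlim : TendstoInCr r (fun T s => ΩT T (s / √T)) Ω (Ioi 0)) :
    TendstoInCr r (fun T => rescaledHamiltonian k g V (ΩT T) T) (limitHamiltonian k g Ω)
      (thermostatPhaseSpace n) ∧
    ∃ U : Set (Phase n), IsOpen U ∧
      thermostaticEquilibria (limitHamiltonian k g Ω) ⊆ closure U ∧
      ∀ P ∈ U, KolmogorovNondegenerateAt r (limitHamiltonian k g Ω) P ∧
        IsoenergeticallyNondegenerateAt r (limitHamiltonian k g Ω) P := by
  have hm : (g⁻¹).PosDef := hg.inv
  have hN0 : 0 < (n : ℝ) * k := mul_pos (by exact_mod_cast hn) hk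
  -- The expansion to order `s ^ 2` involves the 4-jet of `G`; `2 n + 2 ≥ 4` because `n ≥ 1`.
  have hr4 : 4 ≤ r := le_trans (by exact_mod_cast (by omega : 4 ≤ 2 * n + 2)) hr.le
  have hr2 : 2 ≤ r := le_trans (by norm_num) hr4
  exact ⟨tendstoInCr_rescaledHamiltonian hV (fun T hT => (hΩT T hT).1) hΩ hlim,
    nondegenerateSet k g Ω (n * k) (1 / 2 * Real.log (n * k)),
    isOpen_nondegenerateSet hm hr2 hΩ hΩpos,
    thermostaticEquilibria_subset_closure hm hr4 hΩ hΩpos rfl hN0 rfl,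
    fun P hP => nondegenerate_of_mem hm hr2 hΩ hΩpos rfl hN0 rfl hP⟩
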